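/- Let $p$ be a prime and let $K$ be a complete discretely valued extension field of $\mathbb{Q}_p$. All modules are left modules. **Weights.** Let $V$ be a topological $K$-vector space with an endomorphism $\partial$. For $\lambda\in K$ put $V^\lambda=\{v : (\partial-\lambda)^k v=0 \text{ for } k\gg 0\}$, and $V^{\mathrm{ws}}=\bigoplus_\lambda V^\lambda$. A weight space decomposition of $V$ is a set $I\subset\{\lambda : V^\lambda\neq 0\}$ such that every $v\in V$ is a convergent sum $v=\sum_{\lambda\in I}v_\lambda$ with $v_\lambda\in V^\lambda$. It is of finite type if $I$ lies in finitely many cosets $\lambda_i+\mathbb{Z}$ and all $V^\lambda$, $\lambda\in I$, are finite dimensional; it is semisimple if $\partial$ acts on $V^\lambda$ by $\lambda$ for $\lambda\in I$. **Triangular decompositions.** Let $R$ be a noetherian $K$-algebra with an element $\partial$ such that $R=\bigoplus_{n\in\mathbb{Z}}R_n$ for $R_n=\{x : [\partial,x]=nx\}$. A triangular decomposition of $R$ consists of graded subalgebras $A,B,H\subset R$ such that multiplication gives a bijection $A\otimes_K H\otimes_K B\to R$; $BH=HB$ and $HA=AH$; $A=\bigoplus_{n\ge0}A_n$, $B=\bigoplus_{n\le0}B_n$,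 $A_0=B_0=K$, $H\subset R_0$; all $A_n,B_n$ are finite dimensional; and $H$ is a finite dimensional split semisimple $K$-algebra. The category $\mathcal{O}$ consists of the finitely generated $R$-modules $M$ such that every $m\in M$ is killed by all $B_{-k}$ with $k$ large. A triangular decomposition of a noetherian Banach $K$-algebra $S$ is an injective homomorphism $R\to S$ with dense image and a triangular decomposition $(A,B,H,\partial)$ of $R$ such that, with $\mathscr{A}_S,\mathscr{B}_S$ the closures of $A,B$ in $S$, multiplication induces an isomorphism of Banach spaces $\mathscr{A}_S\widehat\otimes_K H\widehat\otimes_K\mathscr{B}_S\cong S$, the spaces $\mathscr{A}_S$ and $\mathscr{B}_S$ have semisimple weight space decompositions for $\mathrm{ad}(\partial)$, and $\mathscr{A}_S^{\mathrm{ws}}=A$, $\mathscr{B}_S^{\mathrm{ws}}=B$. The category $\widehat{\mathcal{O}}_S$ consists of the finitely generated $S$-modules that are finite over $\mathscr{A}_S$ and, in their canonical Banach topology, have a weight space decomposition for $\partial$. **Fréchet–Stein algebras.** A Fréchet–Stein presentation is a projective system of noetherian Banach $K$-algebras $\mathscr{S}(n)$, $n\ge 0$, with continuous transition maps $\mathscr{S}(n+1)\to\mathscr{S}(n)$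 that have dense image and make $\mathscr{S}(n)$ a flat right $\mathscr{S}(n+1)$-module. Objects of $\varprojlim_n\mathrm{Mod}(\mathscr{S}(n))$ are families of modules $M(n)$ with isomorphisms $\mathscr{S}(n)\otimes_{\mathscr{S}(n+1)}M(n+1)\cong M(n)$. A module over $\varprojlim\mathscr{S}(n)$ is co-admissible if it is isomorphic to $\varprojlim M(n)$ for such a family with all $M(n)$ finitely generated; such a limit carries the inverse limit of the canonical Banach topologies. Let $\mathscr{R}=\varprojlim_n\mathscr{R}(n)$ be a Fréchet–Stein algebra, $R\subset\mathscr{R}$ a dense subalgebra, and $A,B,H\subset R$, $\partial\in R$, such that for every $n$ the map $R\to\mathscr{R}(n)$ is injective and $(R,A,B,H,\partial)$ is a triangular decomposition of $\mathscr{R}(n)$. Let $\mathscr{A}(n),\mathscr{B}(n)$ be the closures of $A,B$ in $\mathscr{R}(n)$, and assume that $\mathscr{A}=\varprojlim\mathscr{A}(n)$ and $\mathscr{B}=\varprojlim\mathscr{B}(n)$ are Fréchet–Stein presentations. Let $\widehat{\mathcal{O}}(n)=\widehat{\mathcal{O}}_{\mathscr{R}(n)}$, and let $\wideparen{\mathcal{O}}=\varprojlim\widehat{\mathcal{O}}(n)$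 be the full subcategory of $\varprojlim\mathrm{Mod}(\mathscr{R}(n))$ of the families with $M(n)\in\widehat{\mathcal{O}}(n)$ for all $n$. Then: 1. The functor $(M(n))_n\mapsto\varprojlim M(n)$ is fully faithful on $\wideparen{\mathcal{O}}$ and identifies $\wideparen{\mathcal{O}}$ with a full subcategory of the category $\mathcal{C}(\mathscr{R})$ of co-admissible $\mathscr{R}$-modules. The category $\wideparen{\mathcal{O}}$ is abelian and its inclusion in $\mathcal{C}(\mathscr{R})$ is exact (preserves finite limits and colimits). It is closed under finite direct sums and under closed $\mathscr{R}$-submodules. 2. Every $M\in\wideparen{\mathcal{O}}$ is a $K$-Fréchet space with a weight space decomposition of finite type for $\partial$. 3. $\mathscr{R}\otimes_R-$ maps $\mathcal{O}$ to $\wideparen{\mathcal{O}}$, $(-)^{\mathrm{ws}}$ maps $\wideparen{\mathcal{O}}$ to $\mathcal{O}$, and these functors are mutually inverse equivalences of abelian categories. 4. Every $M\in\wideparen{\mathcal{O}}$ is a co-admissible $\mathscr{A}$-module. -/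

import Mathlib

open CategoryTheory
open scoped TensorProduct ModuleCat

universe u v w

noncomputable section

/-! ## Extension of scalars along a homomorphism of (noncommutative) rings -/

section BaseChange

variable {R S : Type u} [Ring R] [Ring S]

/-- The `S`-submodule of `S ⊗[ℤ] M` spanned by the elements `s f(r) ⊗ m - s ⊗ r m`. -/
def baseChangeRel (f : R →+* S) (M : Type u) [AddCommGroup M] [Module R M] :
    Submodule S (S ⊗[ℤ] M) :=
  Submodule.span S
    {t | ∃ (s : S) (r : R) (m : M), t = (s * f r) ⊗ₜ[ℤ] m - s ⊗ₜ[ℤ] (r • m)}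

/-- The left `S`-module `S ⊗_R M`, where `S` is a right `R`-module through `f : R → S`. -/
abbrev BaseChange (f : R →+* S) (M : Type u) [AddCommGroup M] [Module R M] : Type u :=
  (S ⊗[ℤ] M) ⧸ baseChangeRel f M

/-- The pure tensor `s ⊗ m` in `S ⊗_R M`. -/
def BaseChange.tmul (f : R →+* S) {M : Type u} [AddCommGroup M] [Module R M] (s : S) (m : M) :
    BaseChange f M :=
  Submodule.Quotient.mk (s ⊗ₜ[ℤ] m)

lemma BaseChange.tmul_add (f : R →+* S) {M : Type u} [AddCommGroup M] [Module R M]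
    (s : S) (m m' : M) : tmul f s (m + m') = tmul f s m + tmul f s m' := by
  simp [tmul, TensorProduct.tmul_add]

lemma BaseChange.tmul_zero (f : R →+* S) {M : Type u} [AddCommGroup M] [Module R M]
    (s : S) : tmul f s (0 : M) = 0 := by
  simp [tmul]

lemma BaseChange.smul_tmul (f : R →+* S) {M : Type u} [AddCommGroup M] [Module R M]
    (s t : S) (m : M) : s • tmul f t m = tmul f (s * t) m := rfl

lemma BaseChange.tmul_smul (f : R →+* S) {M : Type u} [AddCommGroup M] [Module R M]
    (s : S) (r : R) (m : M) : tmul f s (r • m) = tmul f (s * f r) m := by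
  have h : (s * f r) ⊗ₜ[ℤ] m - s ⊗ₜ[ℤ] (r • m) ∈ baseChangeRel f M :=
    Submodule.subset_span ⟨s, r, m, rfl⟩
  exact ((Submodule.Quotient.eq _).2 h).symm

lemma BaseChange.hom_ext {f : R →+* S} {M : Type u} [AddCommGroup M] [Module R M]
    {P : Type v} [AddCommGroup P] [Module S P] {g h : BaseChange f M →ₗ[S] P}
    (H : ∀ s m, g (tmul f s m) = h (tmul f s m)) : g = h := by
  refine LinearMap.ext fun q => ?_
  obtain ⟨x, rfl⟩ := Submodule.Quotient.mk_surjective _ q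
  induction x using TensorProduct.induction_on with
  | zero => simp
  | tmul s m => exact H s m
  | add x y hx hy => rw [Submodule.Quotient.mk_add, map_add, map_add, hx, hy]

/-- Functoriality of `S ⊗_R M` in `M`. -/
def BaseChange.map (f : R →+* S) {M N : Type u} [AddCommGroup M] [Module R M]
    [AddCommGroup N] [Module R N] (g : M →ₗ[R] N) : BaseChange f M →ₗ[S] BaseChange f N :=
  Submodule.mapQ _ _
    (TensorProduct.AlgebraTensorModule.lTensor S S g.toAddMonoidHom.toIntLinearMap) <| by
      rw [baseChangeRel, Submodule.span_le]
      rintro _ ⟨s, r, m, rfl⟩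
      refine Submodule.subset_span ⟨s, r, g m, ?_⟩
      simp

@[simp] lemma BaseChange.map_tmul (f : R →+* S) {M N : Type u} [AddCommGroup M] [Module R M]
    [AddCommGroup N] [Module R N] (g : M →ₗ[R] N) (s : S) (m : M) :
    BaseChange.map f g (tmul f s m) = tmul f s (g m) := rfl

/-- The functor `S ⊗_R -` from left `R`-modules to left `S`-modules. -/
def extendScalarsNC (f : R →+* S) : ModuleCat.{u} R ⥤ ModuleCat.{u} S where
  obj M := ModuleCat.of S (BaseChange f M)
  map g := ModuleCat.ofHom (BaseChange.map f g.hom)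
  map_id M := by
    ext1
    exact BaseChange.hom_ext fun s m => rfl
  map_comp g h := by
    ext1
    exact BaseChange.hom_ext fun s m => rfl

/-- `S` is flat as a right `R`-module through `f : R → S`: the functor `S ⊗_R -` preserves
injective maps of left `R`-modules. -/
def IsRightFlat (f : R →+* S) : Prop :=
  ∀ (M N : Type u) [AddCommGroup M] [Module R M] [AddCommGroup N] [Module R N]
    (g : M →ₗ[R] N), Function.Injective g → Function.Injective (BaseChange.map f g)

end BaseChange

/-! ## Inverse limits of algebras and of modules over them -/

section Limits

variable {K : Type w} [Field K] {𝓢 : ℕ → Type u} [∀ n, Ring (𝓢 n)] [∀ n, Algebra K (𝓢 n)]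

/-- The inverse limit `lim 𝓢(n)` as a subalgebra of the product; it carries the
inverse limit topology as soon as the `𝓢(n)` are topological spaces. -/
def inverseLimit (ρ : ∀ n, 𝓢 (n + 1) →ₐ[K] 𝓢 n) : Subalgebra K (∀ n, 𝓢 n) where
  carrier := {x | ∀ n, ρ n (x (n + 1)) = x n}
  mul_mem' hx hy n := by
    simp only [Set.mem_ofPred_eq] at hx hy
    simp [hx n, hy n]
  add_mem' hx hy n := by
    simp only [Set.mem_ofPred_eq] at hx hy
    simp [hx n, hy n]
  algebraMap_mem' r n := by simp

/-- An object of the inverse limit of the module categories `Mod(𝓢(n))` along extension of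
scalars: modules `M(n)` with isomorphisms `𝓢(n) ⊗_{𝓢(n+1)} M(n+1) ≅ M(n)`. -/
structure ModuleSystem (ρ : ∀ n, 𝓢 (n + 1) →ₐ[K] 𝓢 n) where
  obj : ∀ n, ModuleCat.{u} (𝓢 n)
  iso : ∀ n, (extendScalarsNC (ρ n).toRingHom).obj (obj (n + 1)) ≅ obj n

variable {ρ : ∀ n, 𝓢 (n + 1) →ₐ[K] 𝓢 n}

namespace ModuleSystem

/-- Morphisms are families of linear maps compatible with the isomorphisms. -/
@[ext]
structure Hom (X Y : ModuleSystem ρ) where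
  app : ∀ n, X.obj n ⟶ Y.obj n
  comm : ∀ n, (X.iso n).hom ≫ app n =
    (extendScalarsNC (ρ n).toRingHom).map (app (n + 1)) ≫ (Y.iso n).hom

instance : Category (ModuleSystem ρ) where
  Hom := Hom
  id X := ⟨fun n => 𝟙 _, fun n => by simp⟩
  comp f g := ⟨fun n => f.app n ≫ g.app n, fun n => by
    rw [← Category.assoc, f.comm, Category.assoc, g.comm, Functor.map_comp, Category.assoc]⟩

/-- The transition map `M(n+1) → M(n)`, `m ↦ 1 ⊗ m`. -/
def trans (X : ModuleSystem ρ) (n : ℕ) (m : X.obj (n + 1)) : X.obj n :=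
  (X.iso n).hom.hom (BaseChange.tmul (ρ n).toRingHom (1 : 𝓢 n) m)

lemma trans_add (X : ModuleSystem ρ) (n : ℕ) (m m' : X.obj (n + 1)) :
    X.trans n (m + m') = X.trans n m + X.trans n m' := by
  rw [trans, BaseChange.tmul_add]
  exact map_add (X.iso n).hom.hom _ _

lemma trans_zero (X : ModuleSystem ρ) (n : ℕ) : X.trans n 0 = 0 := by
  rw [trans, BaseChange.tmul_zero]
  exact map_zero (X.iso n).hom.hom

lemma trans_smul (X : ModuleSystem ρ) (n : ℕ) (r : 𝓢 (n + 1)) (m : X.obj (n + 1)) :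
    X.trans n (r • m) = ρ n r • X.trans n m := by
  have h : BaseChange.tmul (ρ n).toRingHom (1 : 𝓢 n) (r • m) =
      ρ n r • BaseChange.tmul (ρ n).toRingHom (1 : 𝓢 n) m := by
    rw [BaseChange.tmul_smul, BaseChange.smul_tmul, one_mul, mul_one]
    rfl
  rw [trans, h]
  exact map_smul (X.iso n).hom.hom (ρ n r) _

lemma trans_app {X Y : ModuleSystem ρ} (f : X ⟶ Y) (n : ℕ) (m : X.obj (n + 1)) :
    Y.trans n ((f.app (n + 1)).hom m) = (f.app n).hom (X.trans n m) := by
  have h := congrArg (fun g => g.hom (BaseChange.tmul (ρ n).toRingHom (1 : 𝓢 n) m)) (f.comm n)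
  exact h.symm

/-- The inverse limit `lim M(n)` along the transition maps, as a module over `lim 𝓢(n)`. -/
def sections (X : ModuleSystem ρ) : Submodule (inverseLimit ρ) (∀ n, X.obj n) where
  carrier := {x | ∀ n, X.trans n (x (n + 1)) = x n}
  add_mem' hx hy n := by
    simp only [Set.mem_ofPred_eq] at hx hy
    simp [trans_add, hx n, hy n]
  zero_mem' n := X.trans_zero n
  smul_mem' r x hx n := by
    simp only [Set.mem_ofPred_eq] at hx
    change X.trans n (r.1 (n + 1) • x (n + 1)) = r.1 n • x n
    rw [trans_smul, hx n, r.2 n]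

/-- The functor `(M(n)) ↦ lim M(n)`. -/
def limitFunctor (ρ : ∀ n, 𝓢 (n + 1) →ₐ[K] 𝓢 n) :
    ModuleSystem ρ ⥤ ModuleCat.{u} (inverseLimit ρ) where
  obj X := ModuleCat.of _ X.sections
  map {X Y} f := ModuleCat.ofHom
    { toFun := fun x => ⟨fun n => (f.app n).hom (x.1 n), fun n => by
        rw [trans_app, x.2 n]⟩
      map_add' := fun x y => by
        ext n
        exact map_add (f.app n).hom _ _
      map_smul' := fun r x => by
        ext n
        exact map_smul (f.app n).hom (r.1 n) _ }
  map_id X := rfl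
  map_comp f g := rfl

end ModuleSystem

/-- The full subcategory of coherent sheaves: all `M(n)` are finitely generated. -/
def coherentSystem (ρ : ∀ n, 𝓢 (n + 1) →ₐ[K] 𝓢 n) : ObjectProperty (ModuleSystem ρ) :=
  fun X => ∀ n, Module.Finite (𝓢 n) (X.obj n)

/-- A module over `lim 𝓢(n)` is co-admissible if it is isomorphic to `lim M(n)` for some
coherent sheaf `(M(n))`. -/
def coadmissible (ρ : ∀ n, 𝓢 (n + 1) →ₐ[K] 𝓢 n) :
    ObjectProperty (ModuleCat.{u} (inverseLimit ρ)) :=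
  fun M => ∃ X : ModuleSystem ρ, coherentSystem ρ X ∧
    Nonempty ((ModuleSystem.limitFunctor ρ).obj X ≅ M)

/-- The Fréchet topology on `lim M(n)`: the inverse limit of the canonical topologies on the
`M(n)`. (For a finitely generated module the module topology is the quotient topology induced by
any surjection from a finite free module.) -/
abbrev ModuleSystem.limitTopology [∀ n, TopologicalSpace (𝓢 n)] (X : ModuleSystem ρ) :
    TopologicalSpace ((limitFunctor ρ).obj X) :=
  ⨅ n, TopologicalSpace.induced (fun x : X.sections => x.1 n) (moduleTopology (𝓢 n) (X.obj n))

end Limits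

/-! ## Fréchet spaces and Fréchet-Stein algebras -/

/-- The value group of `K` is generated by the absolute value of a uniformizer. -/
def IsDiscretelyValued (K : Type w) [NormedField K] : Prop :=
  ∃ π : K, 0 < ‖π‖ ∧ ‖π‖ < 1 ∧ ∀ x : K, x ≠ 0 → ∃ k : ℤ, ‖x‖ = ‖π‖ ^ k

/-- A `K`-Fréchet space: a metrizable complete locally convex space over the
nonarchimedean field `K`. -/
structure IsFrechetSpace (K : Type w) (V : Type v) [NormedField K] [AddCommGroup V] [Module K V]
    [TopologicalSpace V] : Prop where
  isTopologicalAddGroup : IsTopologicalAddGroup V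
  continuousSMul : ContinuousSMul K V
  metrizable : TopologicalSpace.MetrizableSpace V
  locallyConvex : ∀ U ∈ nhds (0 : V), ∃ L : AddSubgroup V, (L : Set V) ∈ nhds (0 : V) ∧
    (L : Set V) ⊆ U ∧ ∀ c : K, ‖c‖ ≤ 1 → ∀ x ∈ L, c • x ∈ L
  complete : @CompleteSpace V (IsTopologicalAddGroup.rightUniformSpace V)

section FrechetStein

variable {K : Type w} [NormedField K] {𝓢 : ℕ → Type u} [∀ n, NormedRing (𝓢 n)]
  [∀ n, NormedAlgebra K (𝓢 n)]

/-- A projective system of Banach algebras is a Fréchet-Stein presentation of its limit. -/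
structure IsFrechetStein (ρ : ∀ n, 𝓢 (n + 1) →ₐ[K] 𝓢 n) : Prop where
  noetherian : ∀ n, IsNoetherianRing (𝓢 n)
  continuous : ∀ n, Continuous (ρ n)
  denseRange : ∀ n, DenseRange (ρ n)
  flat : ∀ n, IsRightFlat (ρ n).toRingHom

end FrechetStein

/-! ## Weight space decompositions -/

section Weights

variable {K : Type w} {V : Type v} [Field K] [AddCommGroup V] [Module K V]

/-- The set of weights of `D`; the weight space of weight `l` is `D.maxGenEigenspace l`. -/
def weightSet (D : Module.End K V) : Set K := {l | D.maxGenEigenspace l ≠ ⊥}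

/-- The (automatically direct) sum of all weight spaces. -/
def weightPart (D : Module.End K V) : Submodule K V := ⨆ l : K, D.maxGenEigenspace l

/-- Weight space decomposition with respect to a set `I` of weights. -/
structure IsWeightDecomposition [TopologicalSpace V] (D : Module.End K V) (I : Set K) : Prop where
  subset : I ⊆ weightSet D
  exists_hasSum : ∀ v : V, ∃ x : I → V, (∀ l : I, x l ∈ D.maxGenEigenspace (l : K)) ∧ HasSum x v

/-- `I` is contained in finitely many cosets of `ℤ`. -/
def IsCompactType (I : Set K) : Prop :=
  ∃ F : Finset K, ∀ l ∈ I, ∃ m ∈ F, ∃ k : ℤ, l = m + (k : K)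

def HasWeightDecomposition [TopologicalSpace V] (D : Module.End K V) : Prop :=
  ∃ I : Set K, IsWeightDecomposition D I

def HasFiniteTypeWeightDecomposition [TopologicalSpace V] (D : Module.End K V) : Prop :=
  ∃ I : Set K, IsWeightDecomposition D I ∧ IsCompactType I ∧
    ∀ l ∈ I, FiniteDimensional K (D.maxGenEigenspace l)

def HasSemisimpleWeightDecomposition [TopologicalSpace V] (D : Module.End K V) : Prop :=
  ∃ I : Set K, IsWeightDecomposition D I ∧ ∀ l ∈ I, ∀ v ∈ D.maxGenEigenspace l, D v = l • v

end Weights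

/-! ## Triangular decompositions -/

section Triangular

variable {K : Type w} [Field K] {R : Type u} [Ring R] [Algebra K R]

/-- The degree `n` part `{x | [d, x] = n x}` of the inner grading defined by `d`. -/
def adGrading (K : Type w) {R : Type u} [Field K] [Ring R] [Algebra K R] (d : R) (n : ℤ) :
    Submodule K R where
  carrier := {x | d * x - x * d = n • x}
  add_mem' {x y} hx hy := by
    simp only [Set.mem_ofPred_eq] at hx hy ⊢
    rw [smul_add, ← hx, ← hy, mul_add, add_mul]
    abel
  zero_mem' := by simp
  smul_mem' c x hx := by
    simp only [Set.mem_ofPred_eq] at hx ⊢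
    rw [smul_comm n c x, ← hx, smul_sub, mul_smul_comm, smul_mul_assoc]

/-- The multiplication map `U ⊗ V ⊗ W → R`. -/
def mulMap₃ (U V W : Subalgebra K R) : U ⊗[K] (V ⊗[K] W) →ₗ[K] R :=
  LinearMap.mul' K R ∘ₗ TensorProduct.map U.val.toLinearMap
    (LinearMap.mul' K R ∘ₗ TensorProduct.map V.val.toLinearMap W.val.toLinearMap)

/-- A triangular decomposition `R = A ⊗ H ⊗ B` of the noetherian algebra `R`, which is graded
through the inner grading `R_n = {x | [d, x] = n x}`. -/
structure IsTriangularDecomposition (A B H : Subalgebra K R) (d : R) : Prop where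
  noetherian : IsNoetherianRing R
  /-- `R` is the direct sum of the `R_n`. -/
  grading : DirectSum.IsInternal (adGrading K d)
  mul_bijective : Function.Bijective (mulMap₃ A H B)
  mul_comm_B : Subalgebra.toSubmodule B * Subalgebra.toSubmodule H =
    Subalgebra.toSubmodule H * Subalgebra.toSubmodule B
  mul_comm_A : Subalgebra.toSubmodule H * Subalgebra.toSubmodule A =
    Subalgebra.toSubmodule A * Subalgebra.toSubmodule H
  /-- `A` is graded in nonnegative degrees. -/
  graded_A : Subalgebra.toSubmodule A =
    ⨆ n : ℕ, Subalgebra.toSubmodule A ⊓ adGrading K d (n : ℤ)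
  /-- `B` is graded in nonpositive degrees. -/
  graded_B : Subalgebra.toSubmodule B =
    ⨆ n : ℕ, Subalgebra.toSubmodule B ⊓ adGrading K d (-(n : ℤ))
  graded_H : Subalgebra.toSubmodule H ≤ adGrading K d 0
  zero_A : Subalgebra.toSubmodule A ⊓ adGrading K d 0 = K ∙ (1 : R)
  zero_B : Subalgebra.toSubmodule B ⊓ adGrading K d 0 = K ∙ (1 : R)
  finite_A : ∀ n : ℤ, FiniteDimensional K ↥(Subalgebra.toSubmodule A ⊓ adGrading K d n)
  finite_B : ∀ n : ℤ, FiniteDimensional K ↥(Subalgebra.toSubmodule B ⊓ adGrading K d n)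
  /-- `H` is a finite dimensional split semisimple algebra. -/
  split_H : ∃ (r : ℕ) (m : Fin r → ℕ),
    Nonempty (H ≃ₐ[K] (∀ i, Matrix (Fin (m i)) (Fin (m i)) K))

/-- The category `𝒪` of `R`: finitely generated `R`-modules on which `B` acts locally
nilpotently. -/
def categoryO (B : Subalgebra K R) (d : R) : ObjectProperty (ModuleCat.{u} R) :=
  fun M => Module.Finite R M ∧
    ∀ x : M, ∃ n : ℕ, ∀ k : ℕ, n < k → ∀ b ∈ B, b ∈ adGrading K d (-(k : ℤ)) → b • x = 0

/-- The `K`-linear operator given by the action of `d` on an `R`-module. -/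
def actionEnd (K : Type w) {R : Type u} [Field K] [Ring R] [Algebra K R] (d : R)
    (M : ModuleCat.{u} R) : Module.End K M :=
  Algebra.lsmul K K M d

lemma adGrading_smul_mem {d r : R} {n : ℤ} (hr : r ∈ adGrading K d n) (M : ModuleCat.{u} R)
    {l : K} {x : M} (hx : x ∈ (actionEnd K d M).maxGenEigenspace l) :
    r • x ∈ (actionEnd K d M).maxGenEigenspace (l + n) := by
  rw [Module.End.mem_maxGenEigenspace] at hx ⊢
  obtain ⟨k, hk⟩ := hx
  have hr' : d * r - r * d = n • r := hr
  have key : ∀ y : M, (actionEnd K d M - (l + (n : K)) • (1 : Module.End K M)) (r • y) =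
      r • ((actionEnd K d M - l • (1 : Module.End K M)) y) := by
    intro y
    have h1 : d • r • y - r • d • y = n • r • y := by
      rw [← mul_smul, ← mul_smul, ← sub_smul, hr', smul_assoc]
    have h2 : l • r • y = r • l • y := by
      rw [algebra_compatible_smul R l (r • y), algebra_compatible_smul R l y, ← mul_smul,
        ← mul_smul, Algebra.commutes]
    have h3 : (n : K) • r • y = n • r • y := Int.cast_smul_eq_zsmul K n (r • y)
    change d • r • y - (l + (n : K)) • r • y = r • (d • y - l • y)
    rw [add_smul, h2, h3, ← h1, smul_sub]
    abel
  have key2 : ∀ (j : ℕ) (y : M),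
      ((actionEnd K d M - (l + (n : K)) • (1 : Module.End K M)) ^ j) (r • y) =
      r • (((actionEnd K d M - l • (1 : Module.End K M)) ^ j) y) := by
    intro j
    induction j with
    | zero => intro y; simp
    | succ j ih => intro y; rw [pow_succ, pow_succ, Module.End.mul_apply, key, ih,
        Module.End.mul_apply]
  exact ⟨k, by rw [key2, hk, smul_zero]⟩

/-- The sum `M^{ws}` of the weight spaces of `d`, which is an `R`-submodule of `M`. -/
def wsSubmodule {d : R} (hd : DirectSum.IsInternal (adGrading K d)) (M : ModuleCat.{u} R) :
    Submodule R M where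
  carrier := weightPart (actionEnd K d M)
  add_mem' := (weightPart (actionEnd K d M)).add_mem
  zero_mem' := (weightPart (actionEnd K d M)).zero_mem
  smul_mem' r x hx := by
    have hr : r ∈ ⨆ n, adGrading K d n := by
      rw [hd.submodule_iSup_eq_top]; trivial
    change r • x ∈ weightPart (actionEnd K d M)
    induction hr using Submodule.iSup_induction' with
    | mem n r hr =>
      change x ∈ ⨆ l : K, (actionEnd K d M).maxGenEigenspace l at hx
      induction hx using Submodule.iSup_induction' with
      | mem l x hx =>
        exact Submodule.mem_iSup_of_mem (l + (n : K)) (adGrading_smul_mem hr M hx)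
      | zero => rw [smul_zero]; exact Submodule.zero_mem _
      | add x y _ _ hx hy => rw [smul_add]; exact Submodule.add_mem _ hx hy
    | zero => rw [zero_smul]; exact Submodule.zero_mem _
    | add r s _ _ hr hs => rw [add_smul]; exact Submodule.add_mem _ hr hs

lemma map_mem_wsSubmodule {d : R} (hd : DirectSum.IsInternal (adGrading K d))
    {M N : ModuleCat.{u} R} (f : M ⟶ N) {x : M} (hx : x ∈ wsSubmodule hd M) :
    f.hom x ∈ wsSubmodule hd N := by
  change x ∈ ⨆ l : K, (actionEnd K d M).maxGenEigenspace l at hx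
  change f.hom x ∈ weightPart (actionEnd K d N)
  induction hx using Submodule.iSup_induction' with
  | mem l x hx =>
    refine Submodule.mem_iSup_of_mem l ?_
    rw [Module.End.mem_maxGenEigenspace] at hx ⊢
    obtain ⟨k, hk⟩ := hx
    have key : ∀ (j : ℕ) (y : M),
        ((actionEnd K d N - l • (1 : Module.End K N)) ^ j) (f.hom y) =
        f.hom (((actionEnd K d M - l • (1 : Module.End K M)) ^ j) y) := by
      intro j
      induction j with
      | zero => intro y; simp
      | succ j ih =>
        intro y
        rw [pow_succ, pow_succ, Module.End.mul_apply, Module.End.mul_apply, ← ih]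
        congr 1
        simp only [LinearMap.sub_apply, LinearMap.smul_apply, Module.End.one_apply, actionEnd,
          Algebra.lsmul_coe, map_sub, map_smul]
        rw [algebra_compatible_smul R l y, map_smul, ← algebra_compatible_smul R l (f.hom y)]
    exact ⟨k, by rw [key, hk, map_zero]⟩
  | zero => rw [map_zero]; exact Submodule.zero_mem _
  | add x y _ _ hx hy => rw [map_add]; exact Submodule.add_mem _ hx hy

/-- The weight space functor `M ↦ M^{ws}` on `R`-modules. -/
def wsFunctor {d : R} (hd : DirectSum.IsInternal (adGrading K d)) :
    ModuleCat.{u} R ⥤ ModuleCat.{u} R where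
  obj M := ModuleCat.of R (wsSubmodule hd M)
  map f := ModuleCat.ofHom (f.hom.restrict fun _ hx => map_mem_wsSubmodule hd f hx)
  map_id _ := rfl
  map_comp _ _ := rfl

end Triangular

section Banach

variable {K : Type w} [NormedField K]

/-- The nonarchimedean tensor product seminorm on `U ⊗ V ⊗ W`: the infimum over all
representations `∑ xᵢ ⊗ yᵢ ⊗ zᵢ` of `maxᵢ ‖xᵢ‖ ‖yᵢ‖ ‖zᵢ‖`. -/
def tensorNorm {U V W : Type*} [NormedAddCommGroup U] [NormedSpace K U] [NormedAddCommGroup V]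
    [NormedSpace K V] [NormedAddCommGroup W] [NormedSpace K W] (t : U ⊗[K] (V ⊗[K] W)) : ℝ :=
  sInf {c : ℝ | 0 ≤ c ∧ ∃ (n : ℕ) (x : Fin n → U) (y : Fin n → V) (z : Fin n → W),
    t = ∑ i, x i ⊗ₜ[K] (y i ⊗ₜ[K] z i) ∧ ∀ i, ‖x i‖ * ‖y i‖ * ‖z i‖ ≤ c}

/-- `φ` exhibits the Banach space `E` as the completed tensor product of `U`, `V` and `W`, that is,
as the completion of `U ⊗ V ⊗ W` for the tensor product seminorm: `φ` has dense image
and induces (up to equivalence) the tensor product seminorm. -/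
structure IsCompletedTensorProduct {U V W E : Type*} [NormedAddCommGroup U] [NormedSpace K U]
    [NormedAddCommGroup V] [NormedSpace K V] [NormedAddCommGroup W] [NormedSpace K W]
    [NormedAddCommGroup E] [NormedSpace K E] (φ : U ⊗[K] (V ⊗[K] W) →ₗ[K] E) : Prop where
  complete : CompleteSpace E
  denseRange : DenseRange φ
  upper : ∃ C : ℝ, ∀ t, ‖φ t‖ ≤ C * tensorNorm t
  lower : ∃ C : ℝ, ∀ t, tensorNorm t ≤ C * ‖φ t‖

variable {R : Type u} [Ring R] [Algebra K R] {S : Type u} [NormedRing S] [NormedAlgebra K S]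

/-- The closure in the Banach algebra `S` of the image of `A ⊆ R` under `i : R → S`. -/
abbrev imageClosure {R : Type u} [Semiring R] [Algebra K R] (i : R →ₐ[K] S)
    (A : Subalgebra K R) : Subalgebra K S :=
  (A.map i).topologicalClosure

/-- The closure of `A` has a semisimple weight space decomposition for `ad(d)`, and the sum
of its weight spaces is `A`. -/
def HasAdWeights (i : R →ₐ[K] S) (A : Subalgebra K R) (d : R) : Prop :=
  ∃ D : Module.End K (imageClosure i A), (∀ a, (D a : S) = i d * a - a * i d) ∧
    HasSemisimpleWeightDecomposition D ∧
    (weightPart D).map (imageClosure i A).val.toLinearMap = Subalgebra.toSubmodule (A.map i)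

/-- A triangular decomposition of the noetherian Banach algebra `S`, with dense subalgebra `R`. -/
structure IsBanachTriangularDecomposition (i : R →ₐ[K] S) (A B H : Subalgebra K R) (d : R) :
    Prop where
  noetherian : IsNoetherianRing S
  injective : Function.Injective i
  denseRange : DenseRange i
  algebraic : IsTriangularDecomposition A B H d
  tensor : IsCompletedTensorProduct (mulMap₃ (imageClosure i A) (H.map i) (imageClosure i B))
  weights_A : HasAdWeights i A d
  weights_B : HasAdWeights i B d

/-- The category `𝒪̂` of the Banach algebra `S`: finitely generated `S`-modules which are finite
over the closure of `A` and, in their canonical topology, have a weight space decomposition. -/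
def categoryOHat (i : R →ₐ[K] S) (A : Subalgebra K R) (d : R) :
    ObjectProperty (ModuleCat.{u} S) :=
  fun M => Module.Finite S M ∧ Module.Finite (imageClosure i A) M ∧
    @HasWeightDecomposition K M _ _ _ (moduleTopology S M) (actionEnd K (i d) M)

end Banach

section FrechetTriangular

variable {K : Type w} [NormedField K] {𝓡 : ℕ → Type u} [∀ n, NormedRing (𝓡 n)]
  [∀ n, NormedAlgebra K (𝓡 n)] {ρ : ∀ n, 𝓡 (n + 1) →ₐ[K] 𝓡 n}

/-- The map `R → 𝓡(n)` for a subalgebra `R` of `lim 𝓡(n)`. -/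
def toLevel (R : Subalgebra K (inverseLimit ρ)) (n : ℕ) : R →ₐ[K] 𝓡 n :=
  (Pi.evalAlgHom K 𝓡 n).comp ((inverseLimit ρ).val.comp R.val)

/-- A triangular decomposition `(R, A, B, H, d)` of the Fréchet-Stein algebra `lim 𝓡(n)`. -/
structure IsFrechetTriangularDecomposition (R : Subalgebra K (inverseLimit ρ))
    (A B H : Subalgebra K R) (d : R) : Prop where
  dense : Dense (R : Set (inverseLimit ρ))
  injective : ∀ n, Function.Injective (toLevel R n)
  level : ∀ n, IsBanachTriangularDecomposition (toLevel R n) A B H d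

/-- The closure `𝒜(n)` of `A` in `𝓡(n)`. -/
abbrev levelClosure (R : Subalgebra K (inverseLimit ρ)) (A : Subalgebra K R) (n : ℕ) :
    Subalgebra K (𝓡 n) :=
  imageClosure (toLevel R n) A

lemma closureTransition_mem (hρ : ∀ n, Continuous (ρ n)) (R : Subalgebra K (inverseLimit ρ))
    (A : Subalgebra K R) (n : ℕ) (x : 𝓡 (n + 1)) (hx : x ∈ levelClosure R A (n + 1)) :
    ρ n x ∈ levelClosure R A n := by
  refine map_mem_closure (hρ n) hx ?_
  rintro _ ⟨a, ha, rfl⟩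
  exact ⟨a, ha, (a.1.2 n).symm⟩

/-- The transition maps `𝒜(n+1) → 𝒜(n)` between the closures of `A` in the `𝓡(n)`. -/
def closureTransition (hρ : ∀ n, Continuous (ρ n)) (R : Subalgebra K (inverseLimit ρ))
    (A : Subalgebra K R) (n : ℕ) :
    levelClosure R A (n + 1) →ₐ[K] levelClosure R A n :=
  ((ρ n).comp (levelClosure R A (n + 1)).val).codRestrict (levelClosure R A n) fun x =>
    closureTransition_mem hρ R A n x.1 x.2

/-- The inclusion of `𝒜 = lim 𝒜(n)` into `lim 𝓡(n)`. -/
def closureInclusion (hρ : ∀ n, Continuous (ρ n)) (R : Subalgebra K (inverseLimit ρ))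
    (A : Subalgebra K R) :
    inverseLimit (𝓢 := fun n => levelClosure R A n) (closureTransition hρ R A) →+* inverseLimit ρ where
  toFun x := ⟨fun n => (x.1 n).1, fun n => congrArg Subtype.val (x.2 n)⟩
  map_one' := rfl
  map_mul' _ _ := rfl
  map_zero' := rfl
  map_add' _ _ := rfl

/-- The inverse limit of the categories `𝒪̂(n)` along extension of scalars. -/
def limitO (R : Subalgebra K (inverseLimit ρ)) (A : Subalgebra K R) (d : R) :
    ObjectProperty (ModuleSystem ρ) :=
  fun X => ∀ n, categoryOHat (toLevel R n) A d (X.obj n)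

/-- The category `𝒪⌢ = lim 𝒪̂(n)`, regarded inside the modules over `lim 𝓡(n)`
through `(M(n)) ↦ lim M(n)`. -/
def categoryOFrechet (R : Subalgebra K (inverseLimit ρ)) (A : Subalgebra K R) (d : R) :
    ObjectProperty (ModuleCat.{u} (inverseLimit ρ)) :=
  fun M => ∃ X : ModuleSystem ρ, limitO R A d X ∧
    Nonempty ((ModuleSystem.limitFunctor ρ).obj X ≅ M)

/-- The functor `M ↦ M^{ws}` from modules over `lim 𝓡(n)` to `R`-modules. -/
def wsFrechet (R : Subalgebra K (inverseLimit ρ)) {d : R}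
    (hd : DirectSum.IsInternal (adGrading K d)) :
    ModuleCat.{u} (inverseLimit ρ) ⥤ ModuleCat.{u} R :=
  ModuleCat.restrictScalars R.val.toRingHom ⋙ wsFunctor hd

end FrechetTriangular

end

/-! Everything is governed by the weight part. An object of the limit category is the extension of
scalars of one `R`-module `N` in `𝒪`, and `N` can be recovered as its sum of weight spaces, at every
Banach level and in the limit. The predicate `IsScalarExtension` says that a given module is a model
of `S ⊗_R N`, so that levels, limits and submodules can be compared without fixing a tensor product.

Analytic core: a convergent sum of weight vectors vanishes only if all its terms do
(`weight_sum_unique`). The operator `∏_{1 ≤ i ≤ N} (i - D) / i` fixes weight `0`, kills the weights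
`1, ..., N` and acts on weight `m + 1` by a signed binomial coefficient. Being integers, these
eigenvalues preserve open subgroups of a nonarchimedean group, so the operators converge to the
projection onto weight `0` (`tendsto_weightOp`). A noetherian dévissage passes from eigenvectors to
generalized weight vectors. As a result, weight spaces are spanned by homogeneous multiples of
weight generators, stable submodules contain the weight components of their elements, and
injectivity can be tested on weight vectors.

Algebraic core: the grading element is `d = z + j` with `z` central in the split semisimple `H`,
hence diagonalizable, and `j ∈ A H B_{<0}`. Induction on the degree of nilpotency then shows that
modules in `𝒪` are sums of weight spaces (`weightPart_eq_top`).

From `R` to a Banach level `S`: a vector killed by `B_{-k}` for `k > n` sees only finitely many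
coefficients of an element of `R = A ⊗ H ⊗ B`. These `A`-valued coefficients extend continuously to
`S` by the completed tensor product (`exists_expansion`). Hence `S ⊗_R N` is finite over the closure
of `A`, generated by weight vectors, and functionals built from the coefficients show that `N`
embeds in it. Conversely a module in `𝒪̂` is the extension of its weight part
(`isScalarExtension_weightPart`).

Along the tower, the levels `M(n+1)` and `M(n)` are extensions of the same `N`, so weight spaces do
not change with `n`. Flatness and a Mittag-Leffler argument for dense transition maps give `lim M(n)
= 𝓡 ⊗_R N` (`isScalarExtension_lim`). Morphisms, cokernels and finite products are thus read off
from `𝒪`. A closed submodule contains the weight components of its elements and is therefore the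
extension of its own weight part (`exists_system_of_isClosed`); this also covers kernels.
Co-admissibility over `𝒜` holds because a transition map that is bijective on weight parts is an
extension of scalars along `𝒜(n+1) → 𝒜(n)` (`isScalarExtension_of_weights`). -/

set_option linter.unusedSectionVars false

noncomputable section

/-! ## Universal property of the extension of scalars -/

namespace BaseChange

section Lift

variable {R S : Type u} [Ring R] [Ring S] (f : R →+* S) {M : Type u} [AddCommGroup M] [Module R M]

lemma add_tmul (s t : S) (m : M) : tmul f (s + t) m = tmul f s m + tmul f t m := by
  simp [tmul, TensorProduct.add_tmul]

lemma zero_tmul (m : M) : tmul f 0 m = 0 := by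
  simp [tmul]

@[elab_as_elim]
lemma induction_on {p : BaseChange f M → Prop} (x : BaseChange f M) (zero : p 0)
    (tmul : ∀ s m, p (tmul f s m)) (add : ∀ x y, p x → p y → p (x + y)) : p x := by
  obtain ⟨x, rfl⟩ := Submodule.Quotient.mk_surjective _ x
  induction x using TensorProduct.induction_on with
  | zero => exact zero
  | tmul s m => exact tmul s m
  | add x y hx hy => exact add _ _ hx hy

/-- The canonical map `m ↦ 1 ⊗ m`. -/
def unit (M : Type u) [AddCommGroup M] [Module R M] : M →+ BaseChange f M where
  toFun m := tmul f 1 m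
  map_zero' := tmul_zero f 1
  map_add' := tmul_add f 1

lemma unit_apply (m : M) : unit f M m = tmul f 1 m := rfl

lemma unit_smul (r : R) (m : M) : unit f M (r • m) = f r • unit f M m := by
  rw [unit_apply, unit_apply, tmul_smul, smul_tmul, one_mul, mul_one]

lemma smul_unit (s : S) (m : M) : s • unit f M m = tmul f s m := by
  rw [unit_apply, smul_tmul, mul_one]

lemma span_range_unit : Submodule.span S (Set.range (unit f M)) = ⊤ := by
  refine eq_top_iff.2 fun x _ => ?_
  induction x using induction_on with
  | zero => exact Submodule.zero_mem _
  | tmul s m =>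
    rw [← smul_unit]
    exact Submodule.smul_mem _ _ (Submodule.subset_span ⟨m, rfl⟩)
  | add x y hx hy => exact Submodule.add_mem _ (hx trivial) (hy trivial)

/-- Balanced biadditive maps induce additive maps on the extension of scalars. -/
def liftAdd {P : Type*} [AddCommGroup P] (φ : S →+ M →+ P)
    (h : ∀ s r m, φ (s * f r) m = φ s (r • m)) : BaseChange f M →+ P :=
  QuotientAddGroup.lift (baseChangeRel f M).toAddSubgroup
    (TensorProduct.liftAddHom φ fun n s m => by
      rw [map_zsmul, map_zsmul]; rfl) <| by
    intro x hx
    -- The relations span an `S`-submodule while `φ` is only additive; proving the vanishing for all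
    -- multiples `s • x` makes the span induction go through.
    have key : ∀ s : S, (TensorProduct.liftAddHom φ fun n s m => by
        rw [map_zsmul, map_zsmul]; rfl) (s • x) = 0 := by
      change x ∈ baseChangeRel f M at hx
      induction hx using Submodule.span_induction with
      | mem x hx =>
        obtain ⟨t, r, m, rfl⟩ := hx
        intro s
        rw [smul_sub, TensorProduct.smul_tmul', TensorProduct.smul_tmul', map_sub,
          TensorProduct.liftAddHom_tmul, TensorProduct.liftAddHom_tmul, smul_eq_mul, smul_eq_mul,
          ← mul_assoc, h, sub_self]
      | zero => intro s; rw [smul_zero, map_zero]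
      | add x y _ _ hx hy => intro s; rw [smul_add, map_add, hx, hy, add_zero]
      | smul t x _ hx => intro s; rw [← mul_smul]; exact hx _
    simpa using key 1

@[simp] lemma liftAdd_tmul {P : Type*} [AddCommGroup P] (φ : S →+ M →+ P)
    (h : ∀ s r m, φ (s * f r) m = φ s (r • m)) (s : S) (m : M) :
    liftAdd f φ h (tmul f s m) = φ s m := rfl

/-- Semilinear maps `M → P` correspond to linear maps `S ⊗_R M → P`. -/
def lift {P : Type v} [AddCommGroup P] [Module S P] (j : M →+ P)
    (hj : ∀ r m, j (r • m) = f r • j m) : BaseChange f M →ₗ[S] P where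
  toFun := liftAdd f
    { toFun := fun s => (DistribSMul.toAddMonoidHom P s).comp j
      map_zero' := by ext; simp
      map_add' := fun s t => by ext; simp [add_smul] } fun s r m => by simp [hj, mul_smul]
  map_add' := map_add _
  map_smul' s x := by
    induction x using induction_on with
    | zero => simp
    | tmul t m => simp [smul_tmul, mul_smul]
    | add x y hx hy => rw [smul_add, map_add, hx, hy, map_add, smul_add]

@[simp] lemma lift_tmul {P : Type v} [AddCommGroup P] [Module S P] (j : M →+ P)
    (hj : ∀ r m, j (r • m) = f r • j m) (s : S) (m : M) :
    lift f j hj (tmul f s m) = s • j m := rfl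

lemma lift_unit {P : Type v} [AddCommGroup P] [Module S P] (j : M →+ P)
    (hj : ∀ r m, j (r • m) = f r • j m) (m : M) : lift f j hj (unit f M m) = j m := by
  rw [unit_apply, lift_tmul, one_smul]

lemma map_unit {N : Type u} [AddCommGroup N] [Module R N] (g : M →ₗ[R] N) (m : M) :
    BaseChange.map f g (unit f M m) = unit f N (g m) := rfl

lemma map_surjective {N : Type u} [AddCommGroup N] [Module R N] {g : M →ₗ[R] N}
    (hg : Function.Surjective g) : Function.Surjective (BaseChange.map f g) := by
  rw [← LinearMap.range_eq_top, eq_top_iff, ← span_range_unit, Submodule.span_le]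
  rintro _ ⟨n, rfl⟩
  obtain ⟨m, rfl⟩ := hg n
  exact ⟨unit f M m, map_unit f g m⟩

/-- Right exactness of the extension of scalars. -/
lemma ker_map_le {N : Type u} [AddCommGroup N] [Module R N] {g : M →ₗ[R] N}
    (hg : Function.Surjective g) : LinearMap.ker (BaseChange.map f g) ≤
      Submodule.span S (unit f M '' (LinearMap.ker g : Set M)) := by
  set Q := Submodule.span S (unit f M '' (LinearMap.ker g : Set M))
  let j₀ : M →+ (BaseChange f M ⧸ Q) := Q.mkQ.toAddMonoidHom.comp (unit f M)
  have hj₀ : ∀ m ∈ LinearMap.ker g, j₀ m = 0 := fun m hm =>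
    (Submodule.Quotient.mk_eq_zero Q).2 (Submodule.subset_span ⟨m, hm, rfl⟩)
  -- Arbitrary preimages may be chosen because `j₀` kills the kernel of `g`. The induced map on `S ⊗
  -- N` composed with `S ⊗ g` is the quotient map by `Q`, so the kernel of `S ⊗ g` lies in `Q`.
  let j : N →+ (BaseChange f M ⧸ Q) :=
    { toFun := fun n => j₀ (Function.surjInv hg n)
      map_zero' := hj₀ _ (Function.surjInv_eq hg 0)
      map_add' := fun a b => by
        rw [← map_add, ← sub_eq_zero, ← map_sub]
        refine hj₀ _ ?_
        simp [LinearMap.mem_ker, Function.surjInv_eq hg] }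
  have hj : ∀ m, j (g m) = j₀ m := fun m => by
    rw [← sub_eq_zero]
    change j₀ _ - j₀ _ = 0
    rw [← map_sub]
    refine hj₀ _ ?_
    simp [LinearMap.mem_ker, Function.surjInv_eq hg]
  have hsm : ∀ (r : R) n, j (r • n) = f r • j n := fun r n => by
    obtain ⟨m, rfl⟩ := hg n
    rw [← map_smul, hj, hj]
    change Q.mkQ (unit f M (r • m)) = f r • Q.mkQ (unit f M m)
    rw [unit_smul, map_smul]
  have hcomp : (lift f j hsm).comp (BaseChange.map f g) = Q.mkQ := by
    refine hom_ext fun s m => ?_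
    rw [LinearMap.comp_apply, map_tmul, lift_tmul, hj, ← smul_unit, map_smul]
    rfl
  intro x hx
  have := LinearMap.congr_fun hcomp x
  rw [LinearMap.comp_apply, LinearMap.mem_ker.1 hx, map_zero] at this
  exact (Submodule.Quotient.mk_eq_zero Q).1 this.symm

end Lift

end BaseChange

/-- `j : M → P` exhibits the `S`-module `P` as the extension of scalars of `M`. -/
structure IsScalarExtension {R S : Type u} [Ring R] [Ring S] (f : R →+* S) {M : Type u}
    [AddCommGroup M] [Module R M] {P : Type v} [AddCommGroup P] [Module S P] (j : M →+ P) :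
    Prop where
  smul : ∀ r m, j (r • m) = f r • j m
  bijective : Function.Bijective (BaseChange.lift f j smul)

namespace IsScalarExtension

open BaseChange

variable {R S : Type u} [Ring R] [Ring S] {f : R →+* S} {M : Type u} [AddCommGroup M] [Module R M]
  {P : Type v} [AddCommGroup P] [Module S P] {j : M →+ P}

lemma unit (f : R →+* S) (M : Type u) [AddCommGroup M] [Module R M] :
    IsScalarExtension f (BaseChange.unit f M) where
  smul := unit_smul f
  bijective := by
    have : BaseChange.lift f (BaseChange.unit f M) (unit_smul f) = LinearMap.id :=
      hom_ext fun s m => by rw [lift_tmul, smul_unit]; rfl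
    rw [this]
    exact Function.bijective_id

/-- The isomorphism `S ⊗_R M ≅ P`. -/
def equiv (h : IsScalarExtension f j) : BaseChange f M ≃ₗ[S] P :=
  LinearEquiv.ofBijective (BaseChange.lift f j h.smul) h.bijective

@[simp] lemma equiv_tmul (h : IsScalarExtension f j) (s : S) (m : M) :
    h.equiv (tmul f s m) = s • j m := rfl

lemma equiv_unit (h : IsScalarExtension f j) (m : M) : h.equiv (BaseChange.unit f M m) = j m :=
  lift_unit f j h.smul m

lemma equiv_symm (h : IsScalarExtension f j) (m : M) :
    h.equiv.symm (j m) = BaseChange.unit f M m := by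
  rw [LinearEquiv.symm_apply_eq, equiv_unit]

lemma span_range (h : IsScalarExtension f j) : Submodule.span S (Set.range j) = ⊤ := by
  have h2 := congrArg (Submodule.map h.equiv.toLinearMap) (span_range_unit f (M := M))
  rw [Submodule.map_span, Submodule.map_top, LinearEquiv.range, ← Set.range_comp] at h2
  rw [← h2]
  congr 2
  exact funext fun m => (h.equiv_unit m).symm

/-- The linear map on `P` induced by a semilinear map on `M`. -/
def desc (h : IsScalarExtension f j) {Q : Type*} [AddCommGroup Q] [Module S Q] (k : M →+ Q)
    (hk : ∀ r m, k (r • m) = f r • k m) : P →ₗ[S] Q :=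
  (BaseChange.lift f k hk).comp h.equiv.symm.toLinearMap

lemma desc_apply (h : IsScalarExtension f j) {Q : Type*} [AddCommGroup Q] [Module S Q] (k : M →+ Q)
    (hk : ∀ r m, k (r • m) = f r • k m) (m : M) : h.desc k hk (j m) = k m := by
  simp only [desc, LinearMap.comp_apply, LinearEquiv.coe_coe, equiv_symm, lift_unit]

lemma hom_ext (h : IsScalarExtension f j) {Q : Type*} [AddCommGroup Q] [Module S Q]
    {g g' : P →ₗ[S] Q} (H : ∀ m, g (j m) = g' (j m)) : g = g' :=
  LinearMap.ext_on_range h.span_range H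

lemma of_linearEquiv (h : IsScalarExtension f j) {Q : Type*} [AddCommGroup Q] [Module S Q]
    (e : P ≃ₗ[S] Q) : IsScalarExtension f (e.toLinearMap.toAddMonoidHom.comp j) where
  smul r m := by
    change e (j (r • m)) = f r • e (j m)
    rw [h.smul, map_smul]
  bijective := by
    convert e.bijective.comp h.bijective using 1
    funext x
    induction x using BaseChange.induction_on with
    | zero => simp
    | tmul s m => simp
    | add x y hx hy => rw [map_add, hx, hy]; simp

/-- Transitivity of the extension of scalars. -/
lemma comp {T : Type u} [Ring T] {g : S →+* T} {P : Type u} [AddCommGroup P] [Module S P]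
    {j : M →+ P} (h : IsScalarExtension f j) {Q : Type v} [AddCommGroup Q] [Module T Q]
    {k : P →+ Q} (h' : IsScalarExtension g k) : IsScalarExtension (g.comp f) (k.comp j) := by
  have hs : ∀ (r : R) m, (k.comp j) (r • m) = (g.comp f) r • (k.comp j) m := fun r m => by
    change k (j (r • m)) = g (f r) • k (j m)
    rw [h.smul, h'.smul]
  refine ⟨hs, ?_, ?_⟩
  -- Injectivity comes from a left inverse: `b₀` is the map `s ⊗ m ↦ g(s) ⊗ m`, and it descends to
  -- `Q` by the universal properties of `P` and of `Q`.
  · let b₀ : BaseChange f M →+ BaseChange (g.comp f) M := liftAdd f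
      { toFun := fun s =>
          { toFun := fun m => tmul (g.comp f) (g s) m
            map_zero' := tmul_zero _ _
            map_add' := tmul_add _ _ }
        map_zero' := by ext m; simp [zero_tmul]
        map_add' := fun s t => by ext m; simp [add_tmul] } fun s r m => by
          change tmul _ (g (s * f r)) m = tmul _ (g s) (r • m)
          rw [tmul_smul, map_mul]; rfl
    have hb₀ : ∀ s x, b₀ (s • x) = g s • b₀ x := fun s x => by
      induction x using BaseChange.induction_on with
      | zero => simp
      | tmul t m =>
        rw [smul_tmul]
        change tmul _ (g (s * t)) m = g s • tmul _ (g t) m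
        rw [map_mul, smul_tmul]
      | add x y hx hy => rw [smul_add, map_add, hx, hy, map_add, smul_add]
    let b : P →+ BaseChange (g.comp f) M := b₀.comp h.equiv.symm.toLinearMap.toAddMonoidHom
    have hb : ∀ s x, b (s • x) = g s • b x := fun s x => by
      change b₀ (h.equiv.symm (s • x)) = g s • b₀ (h.equiv.symm x)
      rw [map_smul, hb₀]
    have hinv : (h'.desc b hb).comp (BaseChange.lift (g.comp f) (k.comp j) hs) = LinearMap.id := by
      refine BaseChange.hom_ext fun t m => ?_
      rw [LinearMap.comp_apply, lift_tmul, map_smul]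
      change t • h'.desc b hb (k (j m)) = _
      rw [desc_apply]
      change t • b₀ (h.equiv.symm (j m)) = _
      rw [equiv_symm]
      change t • tmul _ (g 1) m = tmul _ t m
      rw [map_one, smul_tmul, mul_one]
    exact Function.LeftInverse.injective (g := h'.desc b hb) fun x => LinearMap.congr_fun hinv x
  · rw [← LinearMap.range_eq_top, eq_top_iff, ← h'.span_range, Submodule.span_le]
    rintro _ ⟨p, rfl⟩
    obtain ⟨x, rfl⟩ := h.equiv.surjective p
    induction x using BaseChange.induction_on with
    | zero => simp
    | tmul s m =>
      rw [equiv_tmul, h'.smul]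
      refine Submodule.smul_mem _ _ ⟨BaseChange.unit _ M m, ?_⟩
      rw [lift_unit]; rfl
    | add x y hx hy => rw [map_add, map_add]; exact Submodule.add_mem _ hx hy

/-- The second factor of a composite scalar extension is a scalar extension. -/
lemma of_comp {T : Type u} [Ring T] {g : S →+* T} {P : Type u} [AddCommGroup P] [Module S P]
    {j : M →+ P} (h : IsScalarExtension f j) {Q : Type v} [AddCommGroup Q] [Module T Q]
    {k : P →+ Q} (hk : ∀ s x, k (s • x) = g s • k x)
    (h' : IsScalarExtension (g.comp f) (k.comp j)) : IsScalarExtension g k := by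
  refine ⟨hk, ?_⟩
  have h2 := (h.comp (IsScalarExtension.unit g P)).equiv.symm.trans h'.equiv
  -- Two models of the extension of `M` to `T` are isomorphic; the lift of `k` agrees with this
  -- isomorphism on the image of `M`, which generates.
  have h3 : BaseChange.lift g k hk =
      ((h.comp (IsScalarExtension.unit g P)).equiv.symm.trans h'.equiv).toLinearMap := by
    refine (h.comp (IsScalarExtension.unit g P)).hom_ext fun m => ?_
    simp only [LinearEquiv.coe_coe, LinearEquiv.trans_apply, equiv_symm, equiv_unit]
    exact lift_unit g k hk (j m)
  rw [h3]
  exact LinearEquiv.bijective _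

end IsScalarExtension

/-- This transports flatness from the concrete tensor product to arbitrary models of it. -/
lemma IsRightFlat.injective_of_isScalarExtension {R S : Type u} [Ring R] [Ring S] {f : R →+* S}
    (hf : IsRightFlat f) {M N : Type u} [AddCommGroup M] [Module R M] [AddCommGroup N] [Module R N]
    {P Q : Type*} [AddCommGroup P] [Module S P] [AddCommGroup Q] [Module S Q] {j : M →+ P}
    {k : N →+ Q} (hj : IsScalarExtension f j) (hk : IsScalarExtension f k) (g : M →ₗ[R] N)
    (hg : Function.Injective g) (G : P →ₗ[S] Q) (hG : ∀ m, G (j m) = k (g m)) :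
    Function.Injective G := by
  have : G = hk.equiv.toLinearMap.comp ((BaseChange.map f g).comp hj.equiv.symm.toLinearMap) := by
    refine hj.hom_ext fun m => ?_
    simp only [LinearMap.comp_apply, LinearEquiv.coe_coe, IsScalarExtension.equiv_symm, hG,
      BaseChange.map_unit, IsScalarExtension.equiv_unit]
  rw [this]
  exact hk.equiv.injective.comp ((hf _ _ g hg).comp hj.equiv.symm.injective)

/-- Right exactness for scalar extensions. -/
lemma IsScalarExtension.ker_le {R S : Type u} [Ring R] [Ring S] {f : R →+* S}
    {M N : Type u} [AddCommGroup M] [Module R M] [AddCommGroup N] [Module R N]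
    {P Q : Type*} [AddCommGroup P] [Module S P] [AddCommGroup Q] [Module S Q] {j : M →+ P}
    {k : N →+ Q} (hj : IsScalarExtension f j) (hk : IsScalarExtension f k) (g : M →ₗ[R] N)
    (hg : Function.Surjective g) (G : P →ₗ[S] Q) (hG : ∀ m, G (j m) = k (g m)) :
    LinearMap.ker G ≤ Submodule.span S (j '' (LinearMap.ker g : Set M)) := by
  intro x hx
  obtain ⟨y, rfl⟩ := hj.equiv.surjective x
  have h1 : G.comp hj.equiv.toLinearMap = hk.equiv.toLinearMap.comp (BaseChange.map f g) :=
    (IsScalarExtension.unit f M).hom_ext fun m => by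
      simp only [LinearMap.comp_apply, LinearEquiv.coe_coe, IsScalarExtension.equiv_unit, hG,
        BaseChange.map_unit]
  have h2 : BaseChange.map f g y = 0 := by
    refine hk.equiv.injective ?_
    have := LinearMap.congr_fun h1 y
    rw [map_zero]
    exact this.symm.trans hx
  have h3 := Submodule.mem_map_of_mem (f := hj.equiv.toLinearMap) (BaseChange.ker_map_le f hg h2)
  rw [Submodule.map_span, ← Set.image_comp] at h3
  have h4 : (j : M → P) = hj.equiv.toLinearMap ∘ BaseChange.unit f M :=
    funext fun m => (hj.equiv_unit m).symm
  rw [h4]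
  exact h3

/-! ## Finitely generated modules over noetherian Banach algebras -/

section BanachModules

variable (K : Type w) [NontriviallyNormedField K] {S : Type u} [NormedRing S] [NormedAlgebra K S]
  [CompleteSpace S] [IsNoetherianRing S]

include K in
/-- Submodules of finite free modules over a noetherian Banach algebra are closed. -/
theorem isClosed_submodule_pi {r : ℕ} (W : Submodule S (Fin r → S)) :
    IsClosed (W : Set (Fin r → S)) := by
  set W' := W.topologicalClosure
  suffices h : W' ≤ W by
    have : W' = W := le_antisymm h W.le_topologicalClosure
    rw [← this]
    exact W.isClosed_topologicalClosure
  -- The closure is finitely generated, and a sufficiently small perturbation of its generators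
  -- generates it again. Since `W` is dense in its closure, the perturbed generators can be taken in
  -- `W`.
  obtain ⟨k, x, hx⟩ := Submodule.fg_iff_exists_fin_generating_family.1
    (IsNoetherian.noetherian W')
  have hxm : ∀ i, x i ∈ W' := fun i => hx ▸ Submodule.subset_span ⟨i, rfl⟩
  let F : Submodule K (Fin r → S) := W'.restrictScalars K
  have : CompleteSpace F := (W.isClosed_topologicalClosure).completeSpace_coe
  let T : (Fin k → S) →L[K] F :=
    { toFun := fun s => ⟨∑ i, s i • x i, Submodule.sum_mem _ fun i _ => W'.smul_mem _ (hxm i)⟩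
      map_add' := fun s t => by
        ext1; simp [add_smul, Finset.sum_add_distrib]
      map_smul' := fun c s => by
        ext1; simp [Finset.smul_sum]
      cont := by
        refine Continuous.subtype_mk ?_ _
        fun_prop }
  have hT : Function.Surjective T := by
    rintro ⟨y, hy⟩
    change y ∈ W' at hy
    rw [← hx, Submodule.mem_span_range_iff_exists_fun] at hy
    obtain ⟨c, rfl⟩ := hy
    exact ⟨c, rfl⟩
  obtain ⟨C, hC, hCT⟩ := T.exists_preimage_norm_le hT
  -- `k * δ` will bound the operator norm of the perturbation `P` on `S ^ k`; it has to be less than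
  -- `1` for `1 - P` to be invertible.
  obtain ⟨δ, hδ, hδk⟩ : ∃ δ : ℝ, 0 < δ ∧ k * δ < 1 := by
    refine ⟨1 / (k + 1), by positivity, ?_⟩
    rw [mul_one_div, div_lt_one (by positivity)]
    linarith
  have hy : ∀ i, ∃ y ∈ W, ‖x i - y‖ < δ / C := fun i => by
    obtain ⟨y, hy, h⟩ := Metric.mem_closure_iff.1 (hxm i) (δ / C) (by positivity)
    exact ⟨y, hy, by rwa [← dist_eq_norm]⟩
  choose y hyW hy using hy
  have ha : ∀ i, ∃ a : Fin k → S, (T a : Fin r → S) = x i - y i ∧ ‖a‖ ≤ δ := fun i => by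
    obtain ⟨a, h1, h2⟩ := hCT ⟨x i - y i, W'.sub_mem (hxm i) (W.le_topologicalClosure (hyW i))⟩
    refine ⟨a, by rw [h1], h2.trans ?_⟩
    calc C * ‖x i - y i‖ ≤ C * (δ / C) := by gcongr; exact (hy i).le
      _ = δ := by field_simp
  choose a haT ha using ha
  -- The matrix with rows `a i`: it expresses the differences `x i - y i` through the generators
  -- `x`.
  let P₀ : (Fin k → S) →ₗ[K] (Fin k → S) :=
    { toFun := fun s => ∑ i, s i • a i
      map_add' := fun s t => by simp [add_smul, Finset.sum_add_distrib]
      map_smul' := fun c s => by simp [Finset.smul_sum] }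
  have hP₀ : ∀ s, ‖P₀ s‖ ≤ (k * δ) * ‖s‖ := fun s => by
    calc ‖∑ i, s i • a i‖ ≤ ∑ i : Fin k, ‖s i • a i‖ := norm_sum_le _ _
      _ ≤ ∑ _i : Fin k, ‖s‖ * δ := by
        refine Finset.sum_le_sum fun i _ => (norm_smul_le _ _).trans ?_
        exact mul_le_mul (norm_le_pi_norm s i) (ha i) (norm_nonneg _) (norm_nonneg _)
      _ = (k * δ) * ‖s‖ := by simp; ring
  let P : (Fin k → S) →L[K] (Fin k → S) := P₀.mkContinuous _ hP₀
  have hP : ‖P‖ < 1 := (P₀.mkContinuous_norm_le (by positivity) hP₀).trans_lt hδk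
  intro w hw
  obtain ⟨t, ht⟩ := hT ⟨w, hw⟩
  set U := Units.oneSub P hP
  have hU : ((U : (Fin k → S) →L[K] (Fin k → S))) ((U⁻¹ : Units _).1 t) = t := by
    rw [← mul_apply_eq_comp, Units.mul_inv, one_apply_eq_self]
  set s := (U⁻¹ : Units _).1 t
  -- Solving `t = (1 - P) s` turns coefficients `t` for the `x i` into coefficients `s` for the `y
  -- i`.
  have hs : t = s - P s := by rw [← hU]; rfl
  have hPs : (T (P s) : Fin r → S) = ∑ i, s i • (x i - y i) := by
    simp_rw [← haT]
    change ∑ j, (∑ i, s i • a i) j • x j = ∑ i, s i • ∑ j, a i j • x j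
    simp_rw [Finset.smul_sum, Finset.sum_apply, Finset.sum_smul, Pi.smul_apply, smul_eq_mul,
      mul_smul]
    exact Finset.sum_comm
  have hw' : w = ∑ i, s i • y i := by
    have h1 : w = (T t : Fin r → S) := by rw [ht]
    rw [h1, hs, map_sub]
    change (∑ i, s i • x i) - (T (P s) : Fin r → S) = _
    rw [hPs, ← Finset.sum_sub_distrib]
    refine Finset.sum_congr rfl fun i _ => ?_
    rw [smul_sub]; abel
  rw [hw']
  exact Submodule.sum_mem _ fun i _ => W.smul_mem _ (hyW i)

variable {M : Type v} [AddCommGroup M] [Module S M] [Module.Finite S M] [TopologicalSpace M]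
  [IsModuleTopology S M]

include K in
theorem isClosed_submodule (N : Submodule S M) : IsClosed (N : Set M) := by
  obtain ⟨r, q, hq⟩ := Module.Finite.exists_fin' S M
  have := (IsModuleTopology.isQuotientMap_of_surjective (φ := q) hq).isClosed_preimage
    (s := (N : Set M))
  rw [← this]
  exact isClosed_submodule_pi K (N.comap q)

include K in
theorem t2Space_of_finite (S : Type u) [NormedRing S] [NormedAlgebra K S]
    [CompleteSpace S] [IsNoetherianRing S] [Module S M] [Module.Finite S M] [IsModuleTopology S M] :
    T2Space M := by
  have := IsModuleTopology.topologicalAddGroup S M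
  have h : IsClosed ((⊥ : Submodule S M) : Set M) := isClosed_submodule K _
  have : T1Space M := by
    refine IsTopologicalAddGroup.t1Space M ?_
    simpa using h
  infer_instance

-- Balls in `S ^ r` are additive subgroups by the ultrametric inequality, and a presentation `S ^ r
-- → M` is open, so their images form the required lattices.
omit [CompleteSpace S] [IsNoetherianRing S] in
theorem exists_openAddSubgroup_of_finite [IsUltrametricDist K] [IsUltrametricDist S]
    [Module K M] [IsScalarTower K S M] {U : Set M} (hU : U ∈ nhds (0 : M)) :
    ∃ L : AddSubgroup M, (L : Set M) ∈ nhds (0 : M) ∧ (L : Set M) ⊆ U ∧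
      ∀ c : K, ‖c‖ ≤ 1 → ∀ x ∈ L, c • x ∈ L := by
  obtain ⟨r, q, hq⟩ := Module.Finite.exists_fin' S M
  have hq' := IsModuleTopology.isOpenQuotientMap_of_surjective (φ := q) hq
  have hU' : q ⁻¹' U ∈ nhds (0 : Fin r → S) :=
    hq'.continuous.continuousAt.preimage_mem_nhds (by rwa [map_zero])
  obtain ⟨ε, hε, hb⟩ := Metric.mem_nhds_iff.1 hU'
  let B : AddSubgroup (Fin r → S) :=
    { carrier := Metric.ball 0 ε
      add_mem' := fun {a b} ha hb => by
        rw [mem_ball_zero_iff] at *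
        exact (IsUltrametricDist.norm_add_le_max a b).trans_lt (max_lt ha hb)
      zero_mem' := Metric.mem_ball_self hε
      neg_mem' := fun {a} ha => by
        simpa using ha }
  refine ⟨B.map q.toAddMonoidHom, ?_, ?_, ?_⟩
  · have := hq'.isOpenMap.image_mem_nhds (Metric.ball_mem_nhds (0 : Fin r → S) hε)
    rwa [map_zero] at this
  · rintro _ ⟨x, hx, rfl⟩
    exact hb hx
  · rintro c hc _ ⟨x, hx, rfl⟩
    refine ⟨c • x, ?_, ?_⟩
    · change c • x ∈ Metric.ball 0 ε
      change x ∈ Metric.ball 0 ε at hx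
      rw [mem_ball_zero_iff] at *
      exact ((norm_smul_le c x).trans (mul_le_of_le_one_left (norm_nonneg _) hc)).trans_lt hx
    · exact (q.restrictScalars K).map_smul c x

omit [CompleteSpace S] [IsNoetherianRing S] in
theorem nonarchimedeanAddGroup_of_finite (S : Type u) [NormedRing S] [NormedAlgebra K S]
    [Module S M] [Module.Finite S M] [IsModuleTopology S M] [IsUltrametricDist K]
    [IsUltrametricDist S] [Module K M] [IsScalarTower K S M] : NonarchimedeanAddGroup M := by
  have := IsModuleTopology.topologicalAddGroup S M
  refine ⟨fun U hU => ?_⟩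
  obtain ⟨L, hL, hLU, -⟩ := exists_openAddSubgroup_of_finite (S := S) K hU
  exact ⟨⟨L, L.isOpen_of_mem_nhds hL⟩, hLU⟩

omit [CompleteSpace S] [IsNoetherianRing S] [Module.Finite S M] in
theorem continuousSMul_of_isModuleTopology (S : Type u) [NormedRing S] [NormedAlgebra K S]
    [Module S M] [IsModuleTopology S M] [Module K M] [IsScalarTower K S M] :
    ContinuousSMul K M := by
  refine ⟨?_⟩
  have : (fun p : K × M => p.1 • p.2) = fun p => (algebraMap K S p.1) • p.2 := by
    funext p
    rw [algebraMap_smul]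
  rw [this]
  exact ((continuous_algebraMap K S).comp continuous_fst).smul continuous_snd

/-- A finitely generated module over a noetherian Banach algebra is a Banach space for its
canonical topology. -/
theorem exists_continuousLinearEquiv_banach [Module K M] [IsScalarTower K S M] :
    ∃ (r : ℕ) (W : Submodule S (Fin r → S)) (_ : IsClosed (W : Set (Fin r → S))),
      Nonempty (M ≃L[K] ((Fin r → S) ⧸ W)) := by
  obtain ⟨r, q, hq⟩ := Module.Finite.exists_fin' S M
  refine ⟨r, LinearMap.ker q, isClosed_submodule_pi K _, ?_⟩
  let e : ((Fin r → S) ⧸ LinearMap.ker q) ≃ₗ[S] M := q.quotKerEquivOfSurjective hq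
  have := IsModuleTopology.topologicalAddGroup S M
  have h1 : Continuous e := IsModuleTopology.continuous_of_linearMap e.toLinearMap
  have h2 : Continuous e.symm := IsModuleTopology.continuous_of_linearMap e.symm.toLinearMap
  exact ⟨{ e.symm.restrictScalars K with
    continuous_toFun := h2
    continuous_invFun := h1 }⟩

/-- Open mapping theorem: if a finitely generated Banach module is finite over a smaller
noetherian Banach algebra, then the two canonical topologies coincide. -/
theorem isModuleTopology_of_finite [Module K M] [IsScalarTower K S M]
    {𝒜 : Type*} [NormedRing 𝒜] [NormedAlgebra K 𝒜] [CompleteSpace 𝒜]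
    [Module 𝒜 M] [Module.Finite 𝒜 M] [IsScalarTower K 𝒜 M] (ι : 𝒜 → S)
    (hι : Continuous ι) (hs : ∀ (a : 𝒜) (m : M), a • m = ι a • m) : IsModuleTopology 𝒜 M := by
  obtain ⟨r, q, hq⟩ := Module.Finite.exists_fin' 𝒜 M
  obtain ⟨r', W, hW, ⟨e⟩⟩ := exists_continuousLinearEquiv_banach (S := S) (M := M) K
  have := IsModuleTopology.topologicalAddGroup S M
  have : ContinuousSMul 𝒜 M := ⟨by
    simp_rw [hs]
    exact (hι.comp continuous_fst).smul continuous_snd⟩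
  have hqc : Continuous q := IsModuleTopology.continuous_of_linearMap q
  -- A presentation over `𝒜` becomes a continuous surjection of Banach spaces, hence open, hence a
  -- quotient map; this says that the topology is the module topology over `𝒜`.
  let q' : (Fin r → 𝒜) →L[K] ((Fin r' → S) ⧸ W) :=
    e.toContinuousLinearMap.comp ⟨q.restrictScalars K, hqc⟩
  have hq' : IsOpenMap q' := q'.isOpenMap (e.surjective.comp hq)
  have hqo : IsOpenMap q := by
    have : (q : (Fin r → 𝒜) → M) = e.symm ∘ q' := by
      funext x
      exact (e.symm_apply_apply (q x)).symm
    rw [this]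
    exact e.symm.toHomeomorph.isOpenMap.comp hq'
  have h1 : IsOpenQuotientMap q := ⟨hq, hqc, hqo⟩
  refine ⟨?_⟩
  rw [ModuleTopology.eq_coinduced_of_surjective hq]
  exact h1.isQuotientMap.eq_coinduced

end BanachModules

/-! ## Uniqueness of convergent weight decompositions -/

section WeightSums

open Filter Topology

variable {K : Type*} [Field K] {V : Type*} [AddCommGroup V] [Module K V] [TopologicalSpace V]
  [IsTopologicalAddGroup V] [ContinuousConstSMul K V]

/-- The operator `∏_{1 ≤ i ≤ N} (i - D) / i`. -/
def weightOp (D : V →L[K] V) : ℕ → V →L[K] V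
  | 0 => ContinuousLinearMap.id K V
  | N + 1 => ((N : K) + 1)⁻¹ • (((N : K) + 1) • weightOp D N - D.comp (weightOp D N))

lemma weightOp_apply_zero [CharZero K] (D : V →L[K] V) {v : V} (hv : D v = 0) (N : ℕ) :
    weightOp D N v = v := by
  induction N with
  | zero => rfl
  | succ N ih =>
    have : (N : K) + 1 ≠ 0 := by exact_mod_cast Nat.succ_ne_zero N
    simp [weightOp, ih, hv, this]

/-- The eigenvalue `∏ (i - (m + 1)) / i` is a signed binomial coefficient. Its integrality offsets
the denominators `i`: integer multiples stay inside open subgroups. It vanishes as soon as `m < N`.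
-/
lemma weightOp_apply_succ [CharZero K] (D : V →L[K] V) {v : V} (m : ℕ)
    (hv : D v = ((m + 1 : ℕ) : K) • v) (N : ℕ) :
    weightOp D N v = ((-1) ^ N * (m.choose N : ℤ)) • v := by
  induction N with
  | zero => simp [weightOp]
  | succ N ih =>
    have h0 : (N : K) + 1 ≠ 0 := by exact_mod_cast Nat.succ_ne_zero N
    have h1 : ((m.choose (N + 1) : K)) * (N + 1) = m.choose N * ((m : K) - N) := by
      have := Nat.choose_succ_right_eq m N
      rcases le_or_gt N m with h | h
      · have h2 : ((m - N : ℕ) : K) = (m : K) - N := by push_cast [h]; ring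
        rw [← h2]
        exact_mod_cast this
      · rw [Nat.choose_eq_zero_of_lt h, Nat.choose_eq_zero_of_lt (h.trans N.lt_succ_self)]
        simp
    simp only [weightOp, smul_apply, sub_apply,
      ContinuousLinearMap.comp_apply, ih, map_zsmul, hv]
    simp only [← Int.cast_smul_eq_zsmul K, smul_smul, ← sub_smul]
    congr 1
    rw [inv_mul_eq_iff_eq_mul₀ h0]
    push_cast
    have h3 : ((N : K) + 1) * ((-1) ^ (N + 1) * (m.choose (N + 1) : K)) =
        (-1) ^ (N + 1) * (m.choose (N + 1) * (N + 1)) := by ring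
    rw [h3, h1]
    ring

/-- The operators `weightOp D N` converge to the projection onto the kernel of `D`. -/
theorem tendsto_weightOp [CharZero K] {V : Type*} [AddCommGroup V] [Module K V]
    [TopologicalSpace V] [NonarchimedeanAddGroup V] [ContinuousConstSMul K V]
    (D : V →L[K] V) {x : ℕ → V}
    (hx : ∀ n, D (x n) = (n : K) • x n) {v : V} (hv : HasSum x v) :
    Tendsto (fun N => weightOp D N v) atTop (𝓝 (x 0)) := by
  have h0 : Tendsto (fun N => weightOp D N v - x 0) atTop (𝓝 0) := by
    intro U hU
    obtain ⟨L, hL⟩ := NonarchimedeanAddGroup.is_nonarchimedean U hU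
    have hxt : Tendsto x atTop (𝓝 0) := hv.summable.tendsto_atTop_zero
    obtain ⟨N₀, hN₀⟩ := eventually_atTop.1 (hxt.eventually (L.mem_nhds_zero))
    refine mem_map.2 (mem_atTop_sets.2 ⟨N₀, fun N hN => hL ?_⟩)
    have h1 : HasSum (fun n => weightOp D N (x n) - if n = 0 then x 0 else 0)
        (weightOp D N v - x 0) := ((weightOp D N).hasSum hv).sub (hasSum_ite_eq 0 (x 0))
    -- The weight `0` term cancels, weights `1, ..., N` are killed, and beyond `N ≥ N₀` the vectors
    -- already lie in `L`, which is stable under integer multiples. The sum stays in `L` because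
    -- open subgroups are closed.
    have h2 : ∀ n, weightOp D N (x n) - (if n = 0 then x 0 else 0) ∈ L := by
      intro n
      rcases n with _ | m
      · rw [if_pos rfl, weightOp_apply_zero _ (by simpa using hx 0), sub_self]
        exact L.toAddSubgroup.zero_mem
      · rw [if_neg m.succ_ne_zero, sub_zero, weightOp_apply_succ D m (hx _)]
        rcases lt_or_ge m N with h | h
        · rw [Nat.choose_eq_zero_of_lt h]
          simp
        · exact L.toAddSubgroup.zsmul_mem (hN₀ _ (by omega)) _
    exact L.isClosed.mem_of_tendsto h1
      (Eventually.of_forall fun s => L.toAddSubgroup.sum_mem fun n _ => h2 n)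
  simpa using h0.add_const (x 0)

/-- A convergent sum of eigenvectors with eigenvalues in `ℕ` vanishes only if all terms vanish. -/
theorem eq_zero_of_hasSum_eigenvectors [CharZero K] {V : Type*} [AddCommGroup V] [Module K V]
    [TopologicalSpace V] [NonarchimedeanAddGroup V] [T2Space V] [ContinuousConstSMul K V]
    (D : V →L[K] V) {x : ℕ → V}
    (hx : ∀ n, D (x n) = (n : K) • x n) (hv : HasSum x 0) (n : ℕ) : x n = 0 := by
  induction n using Nat.strong_induction_on with
  | _ n ih =>
    -- The terms below `n` vanish by induction. Replacing `D` by `D - n` moves weight `n` to weight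
    -- `0`, so `x n` is a limit of operators applied to `0`.
    have h1 : HasSum (fun m => x (m + n)) 0 := by
      have := (hasSum_nat_add_iff' n).2 hv
      rwa [Finset.sum_eq_zero fun i hi => ih i (Finset.mem_range.1 hi), sub_zero] at this
    have h2 := tendsto_weightOp (D - (n : K) • ContinuousLinearMap.id K V)
      (x := fun m => x (m + n)) (fun m => by simp [hx, add_smul]) h1
    simp only [map_zero, zero_add] at h2
    exact tendsto_nhds_unique h2 tendsto_const_nhds

/-- The projections onto the weight spaces of a Banach space are continuous. -/
theorem exists_weight_projections {K : Type*} [NontriviallyNormedField K] [CharZero K]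
    {V : Type*} [NormedAddCommGroup V]
    [NormedSpace K V] [CompleteSpace V] [IsUltrametricDist V] (D : V →L[K] V)
    (hD : ∀ v, ∃ x : ℕ → V, (∀ n, D (x n) = (n : K) • x n) ∧ HasSum x v) :
    ∃ π : ℕ → V →L[K] V, ∀ v, (∀ n, D (π n v) = (n : K) • π n v) ∧ HasSum (fun n => π n v) v := by
  choose X hX hXs using hD
  suffices h : ∀ n, ∃ f : V →L[K] V, ∀ v, f v = X v n by
    choose π hπ using h
    refine ⟨π, fun v => ⟨fun n => ?_, ?_⟩⟩
    · rw [hπ, hX]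
    · simp_rw [hπ]; exact hXs v
  intro n
  induction n using Nat.strong_induction_on with
  | _ n ih =>
    choose! π hπ using ih
    -- After removal of the components below `n` and a shift by `n`, these operators converge
    -- pointwise to the component of weight `n`. By Banach-Steinhaus the limit is a continuous
    -- linear map.
    let g : ℕ → V →L[K] V := fun N =>
      (weightOp (D - (n : K) • ContinuousLinearMap.id K V) N).comp
        (ContinuousLinearMap.id K V - ∑ j ∈ Finset.range n, π j)
    have hg : Tendsto (fun N v => g N v) atTop (𝓝 fun v => X v n) := by
      rw [tendsto_pi_nhds]
      intro v
      have h1 := (hasSum_nat_add_iff' n).2 (hXs v)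
      have h2 := tendsto_weightOp (D - (n : K) • ContinuousLinearMap.id K V)
        (x := fun m => X v (m + n)) (fun m => by simp [hX, add_smul]) h1
      simp only [zero_add] at h2
      convert h2 using 2 with N
      simp only [g, ContinuousLinearMap.comp_apply, sub_apply,
        ContinuousLinearMap.id_apply, sum_apply]
      rw [Finset.sum_congr rfl fun j hj => hπ j (Finset.mem_range.1 hj) v]
    exact ⟨continuousLinearMapOfTendsto g hg, fun v => rfl⟩

end WeightSums

/-! ## Generalized weight vectors -/

section GeneralizedWeights

variable {K : Type*} [Field K]

lemma intertwine_pow {M M' : Type*} [AddCommGroup M] [Module K M] [AddCommGroup M'] [Module K M']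
    {D : Module.End K M} {D' : Module.End K M'} {l l' : K} (f : M →+ M')
    (h : ∀ m, D' (f m) - l' • f m = f (D m - l • m)) (k : ℕ) (m : M) :
    ((D' - l' • (1 : Module.End K M')) ^ k) (f m) = f (((D - l • (1 : Module.End K M)) ^ k) m) := by
  induction k generalizing m with
  | zero => simp
  | succ k ih =>
    rw [pow_succ, pow_succ, Module.End.mul_apply, Module.End.mul_apply, ← ih]
    congr 1
    exact h m

lemma map_mem_maxGenEigenspace {M M' : Type*} [AddCommGroup M] [Module K M] [AddCommGroup M']
    [Module K M'] {D : Module.End K M} {D' : Module.End K M'} {l l' : K} (f : M →+ M')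
    (h : ∀ m, D' (f m) - l' • f m = f (D m - l • m)) {m : M} (hm : m ∈ D.maxGenEigenspace l) :
    f m ∈ D'.maxGenEigenspace l' := by
  rw [Module.End.mem_maxGenEigenspace] at hm ⊢
  obtain ⟨k, hk⟩ := hm
  exact ⟨k, by rw [intertwine_pow f h, hk, map_zero]⟩

lemma map_mem_maxGenEigenspace_of_comm {M M' : Type*} [AddCommGroup M] [Module K M]
    [AddCommGroup M'] [Module K M'] {D : Module.End K M} {D' : Module.End K M'} (f : M →ₗ[K] M')
    (h : ∀ m, D' (f m) = f (D m)) {l : K} {m : M} (hm : m ∈ D.maxGenEigenspace l) :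
    f m ∈ D'.maxGenEigenspace l :=
  map_mem_maxGenEigenspace f.toAddMonoidHom
    (fun m => by
      change D' (f m) - l • f m = f (D m - l • m)
      rw [h, map_sub, map_smul]) hm

lemma mem_maxGenEigenspace_of_eigen {M : Type*} [AddCommGroup M] [Module K M]
    {D : Module.End K M} {l : K} {m : M} (hm : D m = l • m) : m ∈ D.maxGenEigenspace l := by
  rw [Module.End.mem_maxGenEigenspace]
  exact ⟨1, by simp [hm]⟩

lemma smul_mem_maxGenEigenspace {𝒜 : Type*} [Ring 𝒜] [Algebra K 𝒜] {δ : Module.End K 𝒜} {M : Type*}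
    [AddCommGroup M] [Module 𝒜 M] [Module K M] [IsScalarTower K 𝒜 M] {D : Module.End K M}
    (hD : ∀ (a : 𝒜) (m : M), D (a • m) = δ a • m + a • D m) {l c : K} {a : 𝒜} (ha : δ a = c • a)
    {m : M} (hm : m ∈ D.maxGenEigenspace l) : a • m ∈ D.maxGenEigenspace (l + c) := by
  refine map_mem_maxGenEigenspace (DistribSMul.toAddMonoidHom M a) (fun m => ?_) hm
  simp only [DistribSMul.toAddMonoidHom_apply, hD, ha, smul_sub, add_smul, smul_assoc]
  rw [smul_comm a l m]
  abel

section Generators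

variable {𝒜 : Type*} [Ring 𝒜] {M : Type*} [AddCommGroup M] [Module 𝒜 M] [Module K M]
  {D : Module.End K M}

lemma span_weightPart_of_generators {ι : Type*} {f : ι → M} {wt : ι → K}
    (hf : ∀ i, f i ∈ D.maxGenEigenspace (wt i)) (hspan : Submodule.span 𝒜 (Set.range f) = ⊤) :
    Submodule.span 𝒜 (weightPart D : Set M) = ⊤ := by
  rw [eq_top_iff, ← hspan]
  refine Submodule.span_mono ?_
  rintro _ ⟨i, rfl⟩
  exact Submodule.mem_iSup_of_mem (wt i) (hf i)

lemma exists_weight_generators [Module.Finite 𝒜 M]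
    (hspan : Submodule.span 𝒜 (weightPart D : Set M) = ⊤) :
    ∃ (s : Finset M) (wt : s → K), (∀ i : s, (i : M) ∈ D.maxGenEigenspace (wt i)) ∧
      Submodule.span 𝒜 (Set.range fun i : s => (i : M)) = ⊤ := by
  have h1 : Submodule.span 𝒜 (⋃ l, (D.maxGenEigenspace l : Set M)) = ⊤ := by
    rw [eq_top_iff, ← hspan, Submodule.span_le]
    intro x hx
    change x ∈ ⨆ l, D.maxGenEigenspace l at hx
    induction hx using Submodule.iSup_induction' with
    | mem l x hx => exact Submodule.subset_span (Set.mem_iUnion.2 ⟨l, hx⟩)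
    | zero => exact Submodule.zero_mem _
    | add x y _ _ hx hy => exact Submodule.add_mem _ hx hy
  have h2 : (Submodule.span 𝒜 (⋃ l, (D.maxGenEigenspace l : Set M))).FG :=
    h1 ▸ Module.Finite.fg_top
  obtain ⟨s, hs, hs'⟩ := Submodule.fg_span_iff_fg_span_finset_subset _ |>.1 h2
  have h3 : ∀ i : s, ∃ l, (i : M) ∈ D.maxGenEigenspace l := fun i => by
    simpa using hs i.2
  choose wt hwt using h3
  refine ⟨s, wt, hwt, ?_⟩
  rw [← h1, hs']
  congr 1
  ext; simp

end Generators

end GeneralizedWeights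

/-! ## Modules over Banach algebras with a weight decomposition -/

section WeightedModules

open Filter Topology

variable {K : Type w} [NontriviallyNormedField K]

/-- A derivation of a Banach algebra with finite dimensional weight spaces for weights in `ℕ`,
whose (convergent) sum is the whole algebra. -/
structure IsWeightDerivation {𝒜 : Type u} [NormedRing 𝒜] [NormedAlgebra K 𝒜] (δ : Module.End K 𝒜) :
    Prop where
  continuous : Continuous δ
  leibniz : ∀ a b, δ (a * b) = δ a * b + a * δ b
  decomp : ∀ a, ∃ x : ℕ → 𝒜, (∀ n, δ (x n) = (n : K) • x n) ∧ HasSum x a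
  finite : ∀ n : ℕ, FiniteDimensional K (δ.eigenspace (n : K))

variable [IsUltrametricDist K] [CharZero K]
  {𝒜 : Type u} [NormedRing 𝒜] [NormedAlgebra K 𝒜] [CompleteSpace 𝒜] [IsUltrametricDist 𝒜]
  [IsNoetherianRing 𝒜] {δ : Module.End K 𝒜} (hδ : IsWeightDerivation δ)
  {M : Type v} [AddCommGroup M] [Module 𝒜 M] [Module K M] [IsScalarTower K 𝒜 M]
  {D : Module.End K M} (hD : ∀ (a : 𝒜) (m : M), D (a • m) = δ a • m + a • D m)

-- Although `D` is not `𝒜`-linear, the Leibniz rule expresses its composition with a presentation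
-- through `δ` and finitely many values of `D`, and presentations are quotient maps.
omit [IsUltrametricDist K] [CharZero K] [CompleteSpace 𝒜] [IsUltrametricDist 𝒜]
  [IsNoetherianRing 𝒜] in
include hδ hD in
lemma continuous_of_leibniz [Module.Finite 𝒜 M] [TopologicalSpace M] [IsModuleTopology 𝒜 M] :
    Continuous D := by
  obtain ⟨r, q, hq⟩ := Module.Finite.exists_fin' 𝒜 M
  have := IsModuleTopology.topologicalAddGroup 𝒜 M
  have hq' := IsModuleTopology.isQuotientMap_of_surjective (φ := q) hq
  rw [hq'.continuous_iff]
  have h1 : (D ∘ q : (Fin r → 𝒜) → M) = fun a =>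
      ∑ i, (δ (a i) • q (Pi.single i 1) + a i • D (q (Pi.single i 1))) := by
    funext a
    have : a = ∑ i, a i • (Pi.single i (1 : 𝒜) : Fin r → 𝒜) := by
      ext j; simp [Finset.sum_apply, Pi.single_apply]
    conv_lhs => rw [this]
    simp only [Function.comp_apply, map_sum, map_smul, hD]
  rw [h1]
  have := hδ.continuous
  fun_prop

/-- The operator induced on a quotient. -/
def quotientEnd (N : Submodule 𝒜 M) (D : Module.End K M) (h : ∀ m ∈ N, D m ∈ N) :
    Module.End K (M ⧸ N) :=
  (Submodule.Quotient.restrictScalarsEquiv K N).toLinearMap ∘ₗ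
    ((N.restrictScalars K).mapQ (N.restrictScalars K) D h) ∘ₗ
    (Submodule.Quotient.restrictScalarsEquiv K N).symm.toLinearMap

omit [IsUltrametricDist K] [CharZero K] [CompleteSpace 𝒜] [IsUltrametricDist 𝒜]
  [IsNoetherianRing 𝒜] in
lemma quotientEnd_mk (N : Submodule 𝒜 M) (h : ∀ m ∈ N, D m ∈ N) (m : M) :
    quotientEnd N D h (N.mkQ m) = N.mkQ (D m) := rfl

omit [IsUltrametricDist K] [CharZero K] [CompleteSpace 𝒜] [IsUltrametricDist 𝒜]
  [IsNoetherianRing 𝒜] in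
include hD in
lemma quotientEnd_leibniz (N : Submodule 𝒜 M) (h : ∀ m ∈ N, D m ∈ N) (a : 𝒜) (m : M ⧸ N) :
    quotientEnd N D h (a • m) = δ a • m + a • quotientEnd N D h m := by
  obtain ⟨m, rfl⟩ := N.mkQ_surjective m
  rw [← map_smul, quotientEnd_mk, quotientEnd_mk, hD, map_add, map_smul, map_smul]

-- The base case of the dévissage. In a cyclic module generated by an eigenvector, expanding the
-- coefficient `a` writes `x = a • m` as a sum of eigenvectors of weights `l₁ + n`; a generalized
-- weight vector keeps only one of them.
include hδ hD in
lemma cyclic_eigen [Module.Finite 𝒜 M] [TopologicalSpace M] [IsModuleTopology 𝒜 M] {m : M} {l₁ : K}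
    (hm : D m = l₁ • m) {l : K} {x : M} (hx : x ∈ D.maxGenEigenspace l)
    (hxm : x ∈ Submodule.span 𝒜 {m}) (hx0 : x ≠ 0) : ∃ n : ℕ, l = l₁ + n ∧ D x = l • x := by
  have := IsModuleTopology.topologicalAddGroup 𝒜 M
  have := t2Space_of_finite (M := M) K 𝒜
  have := nonarchimedeanAddGroup_of_finite (M := M) K 𝒜
  have := continuousSMul_of_isModuleTopology (M := M) K 𝒜
  let DL : M →L[K] M := ⟨D, continuous_of_leibniz hδ hD⟩
  obtain ⟨a, rfl⟩ := Submodule.mem_span_singleton.1 hxm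
  obtain ⟨y, hy, hya⟩ := hδ.decomp a
  have hs : HasSum (fun n => y n • m) (a • m) :=
    hya.map (AddMonoidHom.flip (smulAddHom 𝒜 M) m) (by
      change Continuous fun a : 𝒜 => a • m
      fun_prop)
  have he : ∀ n, D (y n • m) = (l₁ + n) • (y n • m) := fun n => by
    rw [hD, hy, hm, add_smul, smul_assoc, smul_comm (y n) l₁ m, add_comm]
  rw [Module.End.mem_maxGenEigenspace] at hx
  obtain ⟨k, hk⟩ := hx
  have hpow : ∀ n, ((D - l • (1 : Module.End K M)) ^ k) (y n • m) =
      (l₁ + n - l) ^ k • (y n • m) := fun n => by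
    clear hk
    induction k with
    | zero => simp
    | succ k ih =>
      rw [pow_succ', Module.End.mul_apply, ih]
      simp only [LinearMap.sub_apply, map_smul, LinearMap.smul_apply, Module.End.one_apply, he,
        smul_smul, ← sub_smul]
      congr 1
      ring
  have hpc : ∀ k, Continuous ((D - l • (1 : Module.End K M)) ^ k : Module.End K M) := fun k => by
    induction k with
    | zero => exact continuous_id
    | succ k ih =>
      rw [pow_succ]
      refine ih.comp ?_
      change Continuous fun v => D v - l • v
      have := continuous_of_leibniz hδ hD
      fun_prop
  have hs0 : HasSum (fun n : ℕ => (l₁ + n - l) ^ k • (y n • m)) 0 := by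
    have := hs.map ((D - l • (1 : Module.End K M)) ^ k : Module.End K M) (hpc k)
    rw [hk] at this
    simpa only [Function.comp_def, hpow] using this
  -- Applying `(D - l) ^ k` to the expansion gives a vanishing sum of eigenvectors with coefficients
  -- `(l₁ + n - l) ^ k`. Uniqueness kills each term, and the coefficient is nonzero unless `l₁ + n =
  -- l`.
  have hz : ∀ n : ℕ, l₁ + n ≠ l → y n • m = 0 := fun n hn => by
    have h1 := eq_zero_of_hasSum_eigenvectors (DL - l₁ • ContinuousLinearMap.id K M) (fun n => by
      change D ((l₁ + n - l) ^ k • (y n • m)) - l₁ • ((l₁ + n - l) ^ k • (y n • m)) = _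
      rw [map_smul, he, add_smul, smul_add, smul_comm _ l₁, add_sub_cancel_left, smul_comm])
      hs0 n
    exact (smul_eq_zero.1 h1).resolve_left (pow_ne_zero _ (sub_ne_zero.2 hn))
  by_cases h : ∃ n : ℕ, l₁ + n = l
  · obtain ⟨n, hn⟩ := h
    refine ⟨n, hn.symm, ?_⟩
    have h1 : HasSum (fun n => y n • m) (y n • m) := hasSum_single n fun n' hn' =>
      hz n' fun h => hn' (by
        have := h.trans hn.symm
        exact_mod_cast add_left_cancel this)
    rw [hs.unique h1, he, hn]
  · push Not at h
    refine absurd ?_ hx0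
    have h1 : (fun n => y n • m) = fun _ => (0 : M) := funext fun n => hz n (h n)
    rw [h1] at hs
    exact hs.unique hasSum_zero

-- By `cyclic_eigen` the nonzero terms are true eigenvectors with weights in `l₁ + ℕ`, so the sum
-- can be reindexed by `ℕ` and the eigenvector case applies.
include hδ hD in
lemma cyclic_unique [Module.Finite 𝒜 M] [TopologicalSpace M] [IsModuleTopology 𝒜 M] {m : M} {l₁ : K}
    (hm : D m = l₁ • m) {x : K → M} (hx : ∀ l, x l ∈ D.maxGenEigenspace l)
    (hxm : ∀ l, x l ∈ Submodule.span 𝒜 {m}) (hs : HasSum x 0) : x = 0 := by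
  have := IsModuleTopology.topologicalAddGroup 𝒜 M
  have := t2Space_of_finite (M := M) K 𝒜
  have := nonarchimedeanAddGroup_of_finite (M := M) K 𝒜
  have := continuousSMul_of_isModuleTopology (M := M) K 𝒜
  let DL : M →L[K] M := ⟨D, continuous_of_leibniz hδ hD⟩
  have hinj : Function.Injective fun n : ℕ => l₁ + n := fun a b h => by
    exact_mod_cast add_left_cancel h
  have key : ∀ l, x l ≠ 0 → ∃ n : ℕ, l = l₁ + n ∧ D (x l) = l • x l := fun l hl =>
    cyclic_eigen hδ hD hm (hx l) (hxm l) hl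
  have hs' : HasSum (fun n : ℕ => x (l₁ + n)) 0 := by
    refine (hinj.hasSum_iff fun l hl => ?_).2 hs
    by_contra h
    obtain ⟨n, hn, -⟩ := key l h
    exact hl ⟨n, hn.symm⟩
  have h0 := eq_zero_of_hasSum_eigenvectors (DL - l₁ • ContinuousLinearMap.id K M)
    (x := fun n : ℕ => x (l₁ + n)) (fun n => by
      change D (x (l₁ + n)) - l₁ • x (l₁ + n) = (n : K) • x (l₁ + n)
      by_cases h : x (l₁ + n) = 0
      · simp [h]
      · obtain ⟨_, -, h2⟩ := key _ h
        rw [h2, add_smul, add_sub_cancel_left]) hs'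
  funext l
  by_contra h
  obtain ⟨n, rfl, -⟩ := key l h
  exact h (h0 n)

variable (hspan : Submodule.span 𝒜 (weightPart D : Set M) = ⊤)

include hδ hD hspan in
/-- Weight decompositions in finitely generated weighted modules are unique. -/
theorem weight_sum_unique [Module.Finite 𝒜 M] [TopologicalSpace M] [IsModuleTopology 𝒜 M]
    {x : K → M} (hx : ∀ l, x l ∈ D.maxGenEigenspace l) (hs : HasSum x 0) : x = 0 := by
  -- Noetherian dévissage: take a maximal `D`-stable submodule in which uniqueness holds, and
  -- enlarge it by one cyclic step if it is not everything.
  let P : Submodule 𝒜 M → Prop := fun N => (∀ m ∈ N, D m ∈ N) ∧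
    ∀ x : K → M, (∀ l, x l ∈ D.maxGenEigenspace l) → (∀ l, x l ∈ N) → HasSum x 0 → x = 0
  have hP : ({N | P N} : Set (Submodule 𝒜 M)).Nonempty := by
    refine ⟨⊥, fun m hm => ?_, fun x _ hx _ => ?_⟩
    · rw [(Submodule.mem_bot 𝒜).1 hm, map_zero]; exact Submodule.zero_mem _
    · exact funext fun l => (Submodule.mem_bot 𝒜).1 (hx l)
  have : IsNoetherian 𝒜 M := isNoetherian_of_isNoetherianRing_of_finite 𝒜 M
  obtain ⟨N, ⟨hND, hNu⟩, hmax⟩ :=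
    WellFounded.has_min (wellFounded_gt : WellFounded (fun a b : Submodule 𝒜 M => a > b)) _ hP
  suffices hN : N = ⊤ by
    exact hNu x hx (fun l => hN ▸ Submodule.mem_top) hs
  by_contra hN
  obtain ⟨l, m₀, hm₀, hm₀N⟩ : ∃ l, ∃ m ∈ D.maxGenEigenspace l, m ∉ N := by
    by_contra! hcon
    refine hN (eq_top_iff.2 ?_)
    rw [← hspan, Submodule.span_le]
    have : weightPart D ≤ N.restrictScalars K := iSup_le fun l m hm => hcon l m hm
    exact this
  obtain ⟨k, hk⟩ := (Module.End.mem_maxGenEigenspace D l m₀).1 hm₀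
  -- The last vector outside `N` in the chain `(D - l) ^ j m₀`; it becomes an eigenvector in `M ⧸
  -- N`.
  obtain ⟨m, hmN, hm⟩ : ∃ m, m ∉ N ∧ D m - l • m ∈ N := by
    by_contra! hcon
    have : ∀ j, ((D - l • (1 : Module.End K M)) ^ j) m₀ ∉ N := fun j => by
      induction j with
      | zero => simpa using hm₀N
      | succ j ih => rw [pow_succ', Module.End.mul_apply]; exact hcon _ ih
    exact this k (hk ▸ N.zero_mem)
  refine hmax (N ⊔ Submodule.span 𝒜 {m}) ⟨?_, ?_⟩ ?_
  · intro y hy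
    obtain ⟨n, hn, z, hz, rfl⟩ := Submodule.mem_sup.1 hy
    obtain ⟨a, rfl⟩ := Submodule.mem_span_singleton.1 hz
    have hm' : m ∈ N ⊔ Submodule.span 𝒜 {m} :=
      Submodule.mem_sup_right (Submodule.mem_span_singleton_self m)
    have hDm : D m ∈ N ⊔ Submodule.span 𝒜 {m} := by
      rw [← sub_add_cancel (D m) (l • m), algebra_compatible_smul 𝒜 l m]
      refine Submodule.add_mem _ (Submodule.mem_sup_left ?_) (Submodule.smul_mem _ _ hm')
      rw [← algebra_compatible_smul 𝒜 l m]
      exact hm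
    rw [map_add, hD]
    exact Submodule.add_mem _ (Submodule.mem_sup_left (hND n hn))
      (Submodule.add_mem _ (Submodule.smul_mem _ _ hm') (Submodule.smul_mem _ _ hDm))
  · intro x hx hxN hs
    refine hNu x hx (fun l' => ?_) hs
    have hc : Continuous N.mkQ := continuous_quot_mk
    -- Modulo `N` all terms lie in the cyclic module of an eigenvector and so vanish. Hence they lie
    -- in `N`, where uniqueness is known.
    have h1 := cyclic_unique hδ (quotientEnd_leibniz hD N hND) (m := N.mkQ m) (l₁ := l)
      (x := fun l' => N.mkQ (x l')) (by
        rw [quotientEnd_mk, ← sub_eq_zero]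
        change N.mkQ (D m) - N.mkQ (l • m) = 0
        rw [← map_sub]
        exact (Submodule.Quotient.mk_eq_zero N).2 hm) (fun l' =>
          map_mem_maxGenEigenspace_of_comm (N.mkQ.restrictScalars K)
            (fun m => quotientEnd_mk N hND m) (hx l'))
      (fun l' => by
        obtain ⟨n, hn, z, hz, h⟩ := Submodule.mem_sup.1 (hxN l')
        obtain ⟨a, rfl⟩ := Submodule.mem_span_singleton.1 hz
        have h2 : N.mkQ n = 0 := (Submodule.Quotient.mk_eq_zero N).2 hn
        rw [← h, map_add, h2, zero_add, map_smul]
        exact Submodule.smul_mem _ _ (Submodule.mem_span_singleton_self _))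
      (by
        have := hs.map N.mkQ hc
        rw [map_zero] at this
        exact this)
    exact (Submodule.Quotient.mk_eq_zero N).1 (congrFun h1 l')
  · refine lt_of_le_of_ne le_sup_left fun h => hmN ?_
    rw [h]
    exact Submodule.mem_sup_right (Submodule.mem_span_singleton_self m)

/-- The part of weight `l` generated by vectors `f i` of weight `wt i`. -/
def weightSpan (δ : Module.End K 𝒜) {ι : Type*} (f : ι → M) (wt : ι → K) (l : K) : Submodule K M :=
  ⨆ i, ⨆ n : {n : ℕ // wt i + n = l},
    (δ.eigenspace (n.1 : K)).map ((LinearMap.toSpanSingleton 𝒜 M (f i)).restrictScalars K)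

omit [IsUltrametricDist K] [CompleteSpace 𝒜] [IsUltrametricDist 𝒜] [IsNoetherianRing 𝒜] in
include hδ in
lemma finiteDimensional_weightSpan {ι : Type*} [Finite ι] (f : ι → M) (wt : ι → K) (l : K) :
    FiniteDimensional K (weightSpan δ f wt l) := by
  have h1 : ∀ i, Finite {n : ℕ // wt i + n = l} := fun i => by
    have : Subsingleton {n : ℕ // wt i + n = l} := ⟨fun a b => Subtype.ext (by
      have := a.2.trans b.2.symm
      exact_mod_cast add_left_cancel this)⟩
    infer_instance
  have h2 := hδ.finite
  unfold weightSpan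
  infer_instance

omit [IsUltrametricDist K] [CharZero K] [CompleteSpace 𝒜] [IsUltrametricDist 𝒜]
  [IsNoetherianRing 𝒜] in
include hD in
lemma weightSpan_le {ι : Type*} {f : ι → M} {wt : ι → K}
    (hf : ∀ i, f i ∈ D.maxGenEigenspace (wt i)) (l : K) :
    weightSpan δ f wt l ≤ D.maxGenEigenspace l := by
  refine iSup_le fun i => iSup_le fun n => ?_
  rintro _ ⟨a, ha, rfl⟩
  have := smul_mem_maxGenEigenspace hD (Module.End.mem_eigenspace_iff.1 ha) (hf i)
  rwa [n.2] at this

-- Write `v` as a combination of the generators and expand each coefficient into homogeneous parts.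
-- `Function.extend` reindexes the terms from the degree `n` to the weight `wt i + n`, with value
-- zero elsewhere.
omit [IsUltrametricDist K] [CompleteSpace 𝒜] [IsUltrametricDist 𝒜] [IsNoetherianRing 𝒜] in
include hδ in
lemma exists_hasSum_weightSpan [TopologicalSpace M] [IsModuleTopology 𝒜 M] {ι : Type*} [Finite ι]
    {f : ι → M} (wt : ι → K) (hf : Submodule.span 𝒜 (Set.range f) = ⊤) (v : M) :
    ∃ x : K → M, (∀ l, x l ∈ weightSpan δ f wt l) ∧ HasSum x v := by
  have := IsModuleTopology.topologicalAddGroup 𝒜 M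
  have := Fintype.ofFinite ι
  have hv : v ∈ Submodule.span 𝒜 (Set.range f) := hf ▸ Submodule.mem_top
  obtain ⟨a, rfl⟩ := (Submodule.mem_span_range_iff_exists_fun 𝒜).1 hv
  choose y hy hys using fun i => hδ.decomp (a i)
  have hinj : ∀ i, Function.Injective fun n : ℕ => wt i + n := fun i a b h => by
    exact_mod_cast add_left_cancel h
  refine ⟨fun l => ∑ i, Function.extend (fun n : ℕ => wt i + n) (fun n => y i n • f i) 0 l,
    fun l => ?_, ?_⟩
  · refine Submodule.sum_mem _ fun i _ => ?_
    by_cases h : ∃ n : ℕ, wt i + n = l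
    · obtain ⟨n, rfl⟩ := h
      rw [(hinj i).extend_apply]
      refine Submodule.mem_iSup_of_mem i (Submodule.mem_iSup_of_mem ⟨n, rfl⟩ ?_)
      exact ⟨y i n, Module.End.mem_eigenspace_iff.2 (hy i n), rfl⟩
    · rw [Function.extend_apply' _ _ _ h]
      exact Submodule.zero_mem _
  · refine hasSum_sum fun i _ => ?_
    rw [hasSum_extend_zero (hinj i)]
    exact (hys i).map (AddMonoidHom.flip (smulAddHom 𝒜 M) (f i)) (by
      change Continuous fun a : 𝒜 => a • f i
      fun_prop)

include hδ hD in
/-- The weight spaces of a module generated by weight vectors. -/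
theorem maxGenEigenspace_eq_weightSpan [Module.Finite 𝒜 M] {ι : Type*} [Finite ι] {f : ι → M}
    {wt : ι → K} (hf : ∀ i, f i ∈ D.maxGenEigenspace (wt i))
    (hspan : Submodule.span 𝒜 (Set.range f) = ⊤) (l : K) :
    D.maxGenEigenspace l = weightSpan δ f wt l := by
  classical
  let := moduleTopology 𝒜 M
  have : IsModuleTopology 𝒜 M := ⟨rfl⟩
  have := IsModuleTopology.topologicalAddGroup 𝒜 M
  refine le_antisymm (fun v hv => ?_) (weightSpan_le hD hf l)
  obtain ⟨x, hx, hxs⟩ := exists_hasSum_weightSpan hδ wt hspan v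
  -- A vector of weight `l` has two expansions: the one through the generators and itself as a
  -- single term. Uniqueness identifies it with the component `x l`.
  have h1 : HasSum (fun l' => x l' - if l' = l then v else 0) 0 := by
    simpa using hxs.sub (hasSum_ite_eq l v)
  have h2 := weight_sum_unique hδ hD (span_weightPart_of_generators hf hspan) (fun l' => ?_) h1
  · have h3 := congrFun h2 l
    simp only [if_true, Pi.zero_apply, sub_eq_zero] at h3
    exact h3 ▸ hx l
  · refine Submodule.sub_mem _ (weightSpan_le hD hf l' (hx l')) ?_
    split_ifs with h
    · exact h ▸ hv
    · exact Submodule.zero_mem _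

include hδ hD hspan in
theorem finiteDimensional_maxGenEigenspace [Module.Finite 𝒜 M] (l : K) :
    FiniteDimensional K (D.maxGenEigenspace l) := by
  obtain ⟨s, wt, hs, hs'⟩ := exists_weight_generators hspan
  rw [maxGenEigenspace_eq_weightSpan hδ hD hs hs']
  exact finiteDimensional_weightSpan hδ _ _ _

include hδ hD hspan in
/-- The weights lie in finitely many cosets of `ℕ`. -/
theorem exists_weights_finite_cosets [Module.Finite 𝒜 M] :
    ∃ F : Finset K, ∀ l ∈ weightSet D, ∃ m ∈ F, ∃ k : ℕ, l = m + (k : K) := by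
  classical
  obtain ⟨s, wt, hs, hs'⟩ := exists_weight_generators hspan
  refine ⟨Finset.univ.image wt, fun l hl => ?_⟩
  by_contra! hcon
  refine hl ?_
  rw [maxGenEigenspace_eq_weightSpan hδ hD hs hs', eq_bot_iff]
  refine iSup_le fun i => iSup_le fun n => ?_
  exact absurd n.2.symm (hcon (wt i) (Finset.mem_image_of_mem _ (Finset.mem_univ i)) n.1)

include hδ hspan in
theorem exists_hasSum_weights (hD : ∀ (a : 𝒜) (m : M), D (a • m) = δ a • m + a • D m)
    [Module.Finite 𝒜 M] [TopologicalSpace M] [IsModuleTopology 𝒜 M] (v : M) :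
    ∃ x : K → M, (∀ l, x l ∈ D.maxGenEigenspace l) ∧ HasSum x v := by
  obtain ⟨s, wt, hs, hs'⟩ := exists_weight_generators hspan
  obtain ⟨x, hx, hxs⟩ := exists_hasSum_weightSpan hδ wt hs' v
  exact ⟨x, fun l => weightSpan_le hD hs l (hx l), hxs⟩

include hδ hD hspan in
/-- Submodules stable under the weight operator contain the weight components of their elements. -/
theorem weight_component_mem [Module.Finite 𝒜 M] [TopologicalSpace M] [IsModuleTopology 𝒜 M]
    (N : Submodule 𝒜 M) (hN : ∀ m ∈ N, D m ∈ N) {v : M} (hv : v ∈ N) {x : K → M}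
    (hx : ∀ l, x l ∈ D.maxGenEigenspace l) (hs : HasSum x v) (l : K) : x l ∈ N := by
  have hmk : ∀ l, ∀ m ∈ D.maxGenEigenspace l,
      N.mkQ m ∈ (quotientEnd N D hN).maxGenEigenspace l := fun l m hm =>
    map_mem_maxGenEigenspace_of_comm (N.mkQ.restrictScalars K) (fun m => quotientEnd_mk N hN m) hm
  have hsp : Submodule.span 𝒜 (weightPart (quotientEnd N D hN) : Set (M ⧸ N)) = ⊤ := by
    obtain ⟨s, wt, hs, hs'⟩ := exists_weight_generators hspan
    refine span_weightPart_of_generators (f := fun i : s => N.mkQ i) (fun i => hmk _ _ (hs i)) ?_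
    have := congrArg (Submodule.map N.mkQ) hs'
    rw [Submodule.map_span, Submodule.map_top, N.range_mkQ, ← Set.range_comp] at this
    exact this
  have hc : Continuous N.mkQ := continuous_quot_mk
  -- In `M ⧸ N` the images of the components sum to the class of `v`, which is zero.
  have h1 := weight_sum_unique hδ (quotientEnd_leibniz hD N hN) hsp
    (x := fun l => N.mkQ (x l)) (fun l => hmk l _ (hx l)) (by
      have := hs.map N.mkQ hc
      rwa [show N.mkQ v = 0 from (Submodule.Quotient.mk_eq_zero N).2 hv] at this)
  exact (Submodule.Quotient.mk_eq_zero N).1 (congrFun h1 l)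

include hδ hD hspan in
/-- Injectivity of an equivariant linear map can be tested on weight spaces. -/
theorem injective_of_injective_on_weights [Module.Finite 𝒜 M] {M' : Type*} [AddCommGroup M']
    [Module 𝒜 M'] (f : M →ₗ[𝒜] M') (hker : ∀ m, f m = 0 → f (D m) = 0)
    (hinj : ∀ l, ∀ m ∈ D.maxGenEigenspace l, f m = 0 → m = 0) : Function.Injective f := by
  let := moduleTopology 𝒜 M
  have : IsModuleTopology 𝒜 M := ⟨rfl⟩
  have := IsModuleTopology.topologicalAddGroup 𝒜 M
  have := t2Space_of_finite (M := M) K 𝒜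
  rw [injective_iff_map_eq_zero]
  intro v hv
  obtain ⟨x, hx, hxs⟩ := exists_hasSum_weights hδ hspan hD v
  have h1 : x = fun _ => 0 := funext fun l => hinj l _ (hx l)
    (weight_component_mem hδ hD hspan (LinearMap.ker f) (fun m hm => hker m hm) hv hx hxs l)
  rw [h1] at hxs
  exact hxs.unique hasSum_zero

end WeightedModules

/-! ## Inner gradings -/

section Gradings

variable {K : Type w} [Field K] {R : Type u} [Ring R] [Algebra K R] {d : R}

lemma mem_adGrading {x : R} {n : ℤ} : x ∈ adGrading K d n ↔ d * x - x * d = n • x := Iff.rfl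

lemma mul_mem_adGrading {x y : R} {m n : ℤ} (hx : x ∈ adGrading K d m)
    (hy : y ∈ adGrading K d n) : x * y ∈ adGrading K d (m + n) := by
  rw [mem_adGrading] at *
  rw [add_smul, ← smul_mul_assoc, ← mul_smul_comm, ← hx, ← hy]
  noncomm_ring

lemma one_mem_adGrading : (1 : R) ∈ adGrading K d 0 := by
  rw [mem_adGrading]; simp

lemma self_mem_adGrading : d ∈ adGrading K d 0 := by
  rw [mem_adGrading]; simp

lemma adGrading_mul_le (m n : ℤ) :
    adGrading K d m * adGrading K d n ≤ adGrading K d (m + n) :=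
  Submodule.mul_le.2 fun _ hx _ hy => mul_mem_adGrading hx hy

/-- The projections onto the homogeneous components. -/
lemma exists_grading_projections (hd : DirectSum.IsInternal (adGrading K d)) :
    ∃ p : ℤ → R →ₗ[K] R, (∀ n, ∀ x ∈ adGrading K d n, p n x = x) ∧
      (∀ m n, m ≠ n → ∀ x ∈ adGrading K d m, p n x = 0) := by
  classical
  let e := LinearEquiv.ofBijective (DirectSum.coeLinearMap (adGrading K d)) hd
  have he : ∀ n (x : adGrading K d n),
      e.symm x = DirectSum.lof K ℤ (fun n => adGrading K d n) n x := fun n x => by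
    rw [LinearEquiv.symm_apply_eq]
    exact (DirectSum.coeLinearMap_lof (adGrading K d) n x).symm
  refine ⟨fun n => (adGrading K d n).subtype ∘ₗ
    DirectSum.component K ℤ (fun n => adGrading K d n) n ∘ₗ e.symm.toLinearMap, ?_, ?_⟩
  · intro n x hx
    simp only [LinearMap.comp_apply, LinearEquiv.coe_coe]
    rw [he n ⟨x, hx⟩, DirectSum.component.lof_self]
    rfl
  · intro m n hmn x hx
    simp only [LinearMap.comp_apply, LinearEquiv.coe_coe]
    rw [he m ⟨x, hx⟩, DirectSum.component.of, dif_neg hmn]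
    rfl

/-- The projection to degree `n` fixes `x`, keeps the summands of degree `n` and kills the others.
-/
lemma mem_of_mem_iSup_of_mem_adGrading (hd : DirectSum.IsInternal (adGrading K d)) {ι : Type*}
    {V : ι → Submodule K R} {g : ι → ℤ} (hV : ∀ i, V i ≤ adGrading K d (g i)) {n : ℤ} {x : R}
    (hx : x ∈ ⨆ i, V i) (hxn : x ∈ adGrading K d n) : x ∈ ⨆ i : {i // g i = n}, V i := by
  obtain ⟨p, hp, hp'⟩ := exists_grading_projections hd
  have key : ∀ y ∈ ⨆ i, V i, p n y ∈ ⨆ i : {i // g i = n}, V i := by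
    intro y hy
    induction hy using Submodule.iSup_induction' with
    | mem i y hy =>
      by_cases h : g i = n
      · rw [hp n y (h ▸ hV i hy)]
        exact Submodule.mem_iSup_of_mem (⟨i, h⟩ : {i // g i = n}) hy
      · rw [hp' _ n h y (hV i hy)]
        exact Submodule.zero_mem _
    | zero => rw [map_zero]; exact Submodule.zero_mem _
    | add y z _ _ hy hz => rw [map_add]; exact Submodule.add_mem _ hy hz
  have := key x hx
  rwa [hp n x hxn] at this

end Gradings

/-! ## Weights of locally nilpotent modules -/

section LinearWeights

variable {K : Type*} [Field K] {N : Type*} [AddCommGroup N] [Module K N] (D : Module.End K N)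

/-- `D - c` is the nonzero scalar `l - c` plus the nilpotent operator `D - l`. The induction builds
the inverse: if `(D - c) z = (D - l) y`, then `(l - c)⁻¹ (y - z)` is a preimage of `y`. -/
lemma exists_preimage_of_ne {l c : K} (hlc : l ≠ c) (k : ℕ) (y : N)
    (hy : ((D - l • (1 : Module.End K N)) ^ k) y = 0) :
    ∃ z, ((D - l • (1 : Module.End K N)) ^ k) z = 0 ∧ D z - c • z = y := by
  induction k generalizing y with
  | zero => exact ⟨0, by simp, by simpa using hy.symm⟩
  | succ k ih =>
    obtain ⟨z, hz, hz'⟩ := ih ((D - l • (1 : Module.End K N)) y) (by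
      rwa [pow_succ, Module.End.mul_apply] at hy)
    refine ⟨(l - c)⁻¹ • (y - z), ?_, ?_⟩
    · rw [map_smul, map_sub, hy, pow_succ', Module.End.mul_apply, hz]
      simp
    · have h1 : D (y - z) - c • (y - z) = (l - c) • y := by
        have h2 : D y - l • y = D z - c • z := hz'.symm
        rw [map_sub, smul_sub, sub_smul, sub_eq_iff_eq_add.1 h2]
        abel
      rw [map_smul, smul_comm c, ← smul_sub, h1, smul_smul, inv_mul_cancel₀ (sub_ne_zero.2 hlc),
        one_smul]

/-- The components of `(D - c) x` of weights other than `c` equal `(D - c) z` for some `z` in the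
weight part. What remains shows that `x - z` has generalized weight `c`. -/
lemma mem_weightPart_of_sub_smul_mem {c : K} {x : N} (hx : D x - c • x ∈ weightPart D) :
    x ∈ weightPart D := by
  have key : ∀ y ∈ weightPart D, ∃ z ∈ weightPart D,
      y - (D z - c • z) ∈ D.maxGenEigenspace c := by
    intro y hy
    change y ∈ ⨆ l, D.maxGenEigenspace l at hy
    induction hy using Submodule.iSup_induction' with
    | mem l y hy =>
      by_cases hl : l = c
      · subst hl
        exact ⟨0, Submodule.zero_mem _, by simpa using hy⟩
      · obtain ⟨k, hk⟩ := (Module.End.mem_maxGenEigenspace D l y).1 hy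
        obtain ⟨z, hz, hz'⟩ := exists_preimage_of_ne D hl k y hk
        refine ⟨z, Submodule.mem_iSup_of_mem l
          ((Module.End.mem_maxGenEigenspace D l z).2 ⟨k, hz⟩), ?_⟩
        rw [hz', sub_self]
        exact Submodule.zero_mem _
    | zero => exact ⟨0, Submodule.zero_mem _, by simp⟩
    | add y y' _ _ h h' =>
      obtain ⟨z, hz, h⟩ := h
      obtain ⟨z', hz', h'⟩ := h'
      refine ⟨z + z', Submodule.add_mem _ hz hz', ?_⟩
      convert Submodule.add_mem _ h h' using 1
      rw [map_add, smul_add]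
      abel
  obtain ⟨z, hz, h⟩ := key _ hx
  obtain ⟨k, hk⟩ := (Module.End.mem_maxGenEigenspace D c _).1 h
  have h1 : x - z ∈ D.maxGenEigenspace c := by
    refine (Module.End.mem_maxGenEigenspace D c _).2 ⟨k + 1, ?_⟩
    rw [pow_succ, Module.End.mul_apply]
    convert hk using 2
    simp only [LinearMap.sub_apply, LinearMap.smul_apply, Module.End.one_apply, map_sub]
  have := Submodule.add_mem (weightPart D) (Submodule.mem_iSup_of_mem c h1) hz
  rwa [sub_add_cancel] at this

lemma mem_weightPart_of_aeval_mem {ι : Type*} (s : Finset ι) (c : ι → K) {x : N}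
    (hx : Polynomial.aeval D (∏ i ∈ s, (Polynomial.X - Polynomial.C (c i))) x ∈ weightPart D) :
    x ∈ weightPart D := by
  classical
  induction s using Finset.induction_on with
  | empty => simpa using hx
  | insert i s hi ih =>
    rw [Finset.prod_insert hi, map_mul, Module.End.mul_apply] at hx
    refine ih (mem_weightPart_of_sub_smul_mem D (c := c i) ?_)
    simpa [Algebra.algebraMap_eq_smul_one] using hx

end LinearWeights

/-! ### The grading element and the weights of modules in category `𝒪` -/

section CategoryO

variable {K : Type w} [Field K] {R : Type u} [Ring R] [Algebra K R]

/-- Central elements of split semisimple algebras are diagonalizable. -/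
lemma exists_split_polynomial_of_central {r : ℕ} {m : Fin r → ℕ}
    (z : ∀ i, Matrix (Fin (m i)) (Fin (m i)) K) (hz : ∀ y, z * y = y * z) :
    ∃ c : Fin r → K,
      Polynomial.aeval z (∏ i, (Polynomial.X - Polynomial.C (c i))) = 0 := by
  have h1 : ∀ i, ∃ c : K, z i = Matrix.scalar _ c := fun i => by
    have h2 : z i ∈ Set.range (Matrix.scalar (Fin (m i)) : K →+* _) := by
      rw [Matrix.mem_range_scalar_iff_commute_single']
      intro a b
      have h3 := congrFun (hz (Pi.single i (Matrix.single a b 1))) i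
      simp only [Pi.mul_apply, Pi.single_eq_same] at h3
      exact h3.symm
    obtain ⟨c, hc⟩ := h2
    exact ⟨c, hc.symm⟩
  choose c hc using h1
  refine ⟨c, ?_⟩
  funext j
  have h4 : Polynomial.aeval z (∏ i, (Polynomial.X - Polynomial.C (c i))) j =
      Polynomial.aeval (z j) (∏ i, (Polynomial.X - Polynomial.C (c i))) :=
    (Polynomial.aeval_algHom_apply
      (Pi.evalAlgHom K (fun i => Matrix (Fin (m i)) (Fin (m i)) K) j) z _).symm
  have h5 : z j = algebraMap K _ (c j) := by rw [hc]; rfl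
  rw [h4, h5, Polynomial.aeval_algebraMap_apply, Polynomial.coe_aeval_eq_eval,
    Polynomial.eval_prod, Finset.prod_eq_zero (Finset.mem_univ j) (by simp), map_zero]
  rfl

namespace IsTriangularDecomposition

variable {A B H : Subalgebra K R} {d : R} (h : IsTriangularDecomposition A B H d)

include h

lemma mul_eq_top : Subalgebra.toSubmodule A * Subalgebra.toSubmodule H *
    Subalgebra.toSubmodule B = ⊤ := by
  rw [eq_top_iff]
  intro x _
  obtain ⟨t, rfl⟩ := h.mul_bijective.2 x
  induction t using TensorProduct.induction_on with
  | zero => rw [map_zero]; exact Submodule.zero_mem _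
  | tmul a t =>
    induction t using TensorProduct.induction_on with
    | zero => rw [TensorProduct.tmul_zero, map_zero]; exact Submodule.zero_mem _
    | tmul y b =>
      have : mulMap₃ A H B (a ⊗ₜ (y ⊗ₜ b)) = (a : R) * y * b := by
        simp [mulMap₃, mul_assoc]
      rw [this]
      exact Submodule.mul_mem_mul (Submodule.mul_mem_mul a.2 y.2) b.2
    | add t t' h1 h2 =>
      rw [TensorProduct.tmul_add, map_add]; exact Submodule.add_mem _ (h1 trivial) (h2 trivial)
  | add t t' h1 h2 => rw [map_add]; exact Submodule.add_mem _ (h1 trivial) (h2 trivial)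

/-- A graded refinement of `B H = H B`: since `H` has degree `0`, comparing degrees on both sides
gives the inclusion in each degree separately. -/
lemma mul_H_le (n : ℤ) :
    (Subalgebra.toSubmodule B ⊓ adGrading K d n) * Subalgebra.toSubmodule H ≤
    Subalgebra.toSubmodule H * (Subalgebra.toSubmodule B ⊓ adGrading K d n) := by
  refine Submodule.mul_le.2 fun b hb y hy => ?_
  have h1 : b * y ∈ ⨆ k : ℕ, Subalgebra.toSubmodule H *
      (Subalgebra.toSubmodule B ⊓ adGrading K d (-(k : ℤ))) := by
    rw [← Submodule.mul_iSup, ← h.graded_B, ← h.mul_comm_B]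
    exact Submodule.mul_mem_mul hb.1 hy
  have h2 : b * y ∈ adGrading K d n := by
    have := mul_mem_adGrading hb.2 (h.graded_H hy)
    rwa [add_zero] at this
  have h3 := mem_of_mem_iSup_of_mem_adGrading h.grading (g := fun k : ℕ => -(k : ℤ)) (fun k => by
    refine (mul_le_mul' h.graded_H inf_le_right).trans ?_
    have := adGrading_mul_le (K := K) (d := d) 0 (-(k : ℤ))
    rwa [zero_add] at this) h1 h2
  refine (iSup_le fun i => ?_ : _ ≤ Subalgebra.toSubmodule H *
    (Subalgebra.toSubmodule B ⊓ adGrading K d n)) h3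
  rw [i.2]

/-- The grading element is the sum of a central element of `H`
and an element of `A H B_{<0}`. -/
lemma exists_central_part : ∃ z ∈ H, (∀ y ∈ H, z * y = y * z) ∧
    d - z ∈ Subalgebra.toSubmodule A * Subalgebra.toSubmodule H *
      ⨆ j : ℕ, Subalgebra.toSubmodule B ⊓ adGrading K d (-((j + 1 : ℕ) : ℤ)) := by
  obtain ⟨p, hp, hp'⟩ := exists_grading_projections h.grading
  set A' := Subalgebra.toSubmodule A
  set H' := Subalgebra.toSubmodule H
  set B' := Subalgebra.toSubmodule B
  set Bn : ℕ → Submodule K R := fun j => B' ⊓ adGrading K d (-((j + 1 : ℕ) : ℤ))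
  set J := A' * H' * ⨆ j, Bn j
  have hHH : H' * H' = H' := by
    refine le_antisymm (Submodule.mul_le.2 fun x hx y hy => H.mul_mem hx hy) fun x hx => ?_
    rw [← mul_one x]
    exact Submodule.mul_mem_mul hx H.one_mem
  have hB : B' = Submodule.span K {1} ⊔ ⨆ j, Bn j := by
    refine le_antisymm ?_ (sup_le ?_ (iSup_le fun j => inf_le_left))
    · conv_lhs => rw [show B' = _ from h.graded_B]
      refine iSup_le fun n => ?_
      rcases n with _ | n
      · refine le_trans ?_ le_sup_left
        rw [← h.zero_B]
        simp
      · exact le_trans (le_iSup Bn n) le_sup_right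
    · rw [← h.zero_B]
      exact inf_le_left
  have hAH : A' * H' = ⨆ i : ℕ, (A' ⊓ adGrading K d (i : ℤ)) * H' := by
    rw [← Submodule.iSup_mul, ← h.graded_A]
  have hdtop : d ∈ A' * H' * B' := by rw [h.mul_eq_top]; trivial
  rw [hB, Submodule.mul_sup, ← Submodule.one_eq_span, mul_one] at hdtop
  -- Split `R = A H + J` with `J = A H B_{<0}` and take degree `0` parts. Since `A_0 = K`, the first
  -- part is an element of `H`; it is the sought `z`. The second stays in `J` because `J` is graded.
  obtain ⟨x, hx, y₀, hy, hxy⟩ := Submodule.mem_sup.1 hdtop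
  have hpx : p 0 x ∈ H' := by
    rw [hAH] at hx
    clear hxy
    induction hx using Submodule.iSup_induction' with
    | mem i x hx =>
      have hxi : x ∈ adGrading K d (i : ℤ) := by
        have := adGrading_mul_le (K := K) (d := d) (i : ℤ) 0
          (mul_le_mul' inf_le_right h.graded_H hx)
        rwa [add_zero] at this
      rcases i with _ | i
      · rw [hp 0 x hxi]
        have h0 := h.zero_A
        have hx' : x ∈ (A' ⊓ adGrading K d 0) * H' := hx
        rw [h0, ← Submodule.one_eq_span, one_mul] at hx'
        exact hx'
      · rw [hp' _ 0 (by exact_mod_cast i.succ_ne_zero) x hxi]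
        exact Submodule.zero_mem _
    | zero => rw [map_zero]; exact Submodule.zero_mem _
    | add x y _ _ hx hy => rw [map_add]; exact Submodule.add_mem _ hx hy
  have hpy : p 0 y₀ ∈ J := by
    have hJ : J = ⨆ i : ℕ × ℕ, (A' ⊓ adGrading K d (i.1 : ℤ)) * H' * Bn i.2 := by
      rw [iSup_prod]
      simp only [J, hAH, Submodule.iSup_mul, Submodule.mul_iSup]
      exact iSup_comm
    change y₀ ∈ J at hy
    rw [hJ] at hy ⊢
    clear hxy
    induction hy using Submodule.iSup_induction' with
    | mem i y hy =>
      have hyi : y ∈ adGrading K d ((i.1 : ℤ) + 0 + -((i.2 + 1 : ℕ) : ℤ)) := by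
        have h1 : (A' ⊓ adGrading K d (i.1 : ℤ)) * H' * Bn i.2 ≤
            adGrading K d ((i.1 : ℤ) + 0) * adGrading K d (-((i.2 + 1 : ℕ) : ℤ)) :=
          mul_le_mul' ((mul_le_mul' inf_le_right h.graded_H).trans (adGrading_mul_le _ _))
            inf_le_right
        exact adGrading_mul_le _ _ (h1 hy)
      by_cases h0 : (i.1 : ℤ) + 0 + -((i.2 + 1 : ℕ) : ℤ) = 0
      · rw [h0] at hyi
        rw [hp 0 y hyi]
        exact Submodule.mem_iSup_of_mem i hy
      · rw [hp' _ 0 h0 y hyi]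
        exact Submodule.zero_mem _
    | zero => rw [map_zero]; exact Submodule.zero_mem _
    | add x y _ _ hx hy => rw [map_add]; exact Submodule.add_mem _ hx hy
  have hd0 : d - p 0 x = p 0 y₀ := by
    rw [sub_eq_iff_eq_add', ← map_add, hxy, hp 0 d self_mem_adGrading]
  have hHJ : H' * J ≤ J := by
    simp only [J]
    rw [← mul_assoc, ← mul_assoc, h.mul_comm_A, mul_assoc A' H' H', hHH]
  have hJH : J * H' ≤ J := by
    have h1 : (⨆ j, Bn j) * H' ≤ H' * ⨆ j, Bn j := by
      rw [Submodule.iSup_mul, Submodule.mul_iSup]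
      exact iSup_mono fun j => h.mul_H_le _
    calc J * H' = A' * H' * ((⨆ j, Bn j) * H') := by simp only [J, mul_assoc]
      _ ≤ A' * H' * (H' * ⨆ j, Bn j) := mul_le_mul' le_rfl h1
      _ = J := by
        rw [← mul_assoc, mul_assoc A' H' H', hHH]
  -- `H` and `J` meet trivially: applying the degree `0` projection to the factor `B` of the
  -- triangular decomposition defines a map that fixes `H` and kills `J`.
  have hdisj : ∀ y ∈ H', y ∈ J → y = 0 := by
    let E₀ : A ⊗[K] (H ⊗[K] B) →ₗ[K] R :=
      LinearMap.mul' K R ∘ₗ TensorProduct.map A.val.toLinearMap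
        (LinearMap.mul' K R ∘ₗ TensorProduct.map H.val.toLinearMap (p 0 ∘ₗ B.val.toLinearMap))
    let e := LinearEquiv.ofBijective (mulMap₃ A H B) h.mul_bijective
    let E : R →ₗ[K] R := E₀ ∘ₗ e.symm.toLinearMap
    have hE : ∀ (a : A) (y : H) (b : B), E ((a : R) * y * b) = a * (y * p 0 b) := fun a y b => by
      have : e.symm ((a : R) * y * b) = a ⊗ₜ (y ⊗ₜ b) := by
        rw [LinearEquiv.symm_apply_eq]
        simp [e, mulMap₃, mul_assoc]
      simp only [E, LinearMap.comp_apply, LinearEquiv.coe_coe, this]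
      simp [E₀]
    have hEJ : ∀ y ∈ J, E y = 0 := by
      intro y hy
      have hy : J ≤ LinearMap.ker E := by
        simp only [J]
        rw [Submodule.mul_iSup]
        refine iSup_le fun j => Submodule.mul_le.2 fun x hx b hb => ?_
        have : ∀ x ∈ A' * H', E (x * b) = 0 := fun x hx => by
          induction hx using Submodule.mul_induction_on' with
          | mem_mul_mem a ha y hy =>
            rw [hE ⟨a, ha⟩ ⟨y, hy⟩ ⟨b, hb.1⟩, hp' _ 0 (by simp; omega) b hb.2]
            simp
          | add x _ y _ hx hy => rw [add_mul, map_add, hx, hy, add_zero]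
        exact this x hx
      exact hy ‹_›
    intro y hy hyJ
    have h1 := hE 1 ⟨y, hy⟩ 1
    simp only [OneMemClass.coe_one, one_mul, mul_one, hp 0 1 one_mem_adGrading] at h1
    rw [← h1, hEJ y hyJ]
  refine ⟨p 0 x, hpx, fun y hy => ?_, ?_⟩
  · rw [← sub_eq_zero]
    refine hdisj _ (H'.sub_mem (H.mul_mem hpx hy) (H.mul_mem hy hpx)) ?_
    have h2 : d * y = y * d := by
      have := mem_adGrading.1 (h.graded_H hy)
      rwa [zero_smul, sub_eq_zero] at this
    -- `d` commutes with `y`, so the commutators of its two parts with `y` cancel. Their common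
    -- value lies in both `H` and `J`.
    have h3 : p 0 x * y - y * p 0 x = y * p 0 y₀ - p 0 y₀ * y := by
      rw [← hd0]
      rw [mul_sub, sub_mul, h2]
      abel
    rw [h3]
    exact J.sub_mem (hHJ (Submodule.mul_mem_mul hy hpy)) (hJH (Submodule.mul_mem_mul hpy hy))
  · rw [hd0]
    exact hpy

lemma finiteDimensional_H : FiniteDimensional K H := by
  obtain ⟨r, m, ⟨e⟩⟩ := h.split_H
  exact Module.Finite.equiv e.symm.toLinearEquiv

/-- Modules on which `B` acts locally nilpotently are sums of weight spaces. -/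
theorem weightPart_eq_top {N : Type*} [AddCommGroup N] [Module R N] [Module K N]
    [IsScalarTower K R N]
    (hN : ∀ x : N, ∃ n : ℕ, ∀ k : ℕ, n < k → ∀ b ∈ B, b ∈ adGrading K d (-(k : ℤ)) → b • x = 0) :
    weightPart (Algebra.lsmul K K N d) = ⊤ := by
  set D : Module.End K N := Algebra.lsmul K K N d
  have hDx : ∀ x, D x = d • x := fun x => rfl
  have hRW : ∀ r : R, ∀ x ∈ weightPart D, r • x ∈ weightPart D := by
    intro r x hx
    have hr : r ∈ ⨆ n, adGrading K d n := by
      rw [h.grading.submodule_iSup_eq_top]; trivial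
    induction hr using Submodule.iSup_induction' with
    | mem n r hr =>
      change x ∈ ⨆ l : K, D.maxGenEigenspace l at hx
      induction hx using Submodule.iSup_induction' with
      | mem l x hx =>
        refine Submodule.mem_iSup_of_mem (l + (n : K))
          (map_mem_maxGenEigenspace (DistribSMul.toAddMonoidHom N r) (fun m => ?_) hx)
        have hr' : d * r = r * d + n • r := sub_eq_iff_eq_add'.1 (mem_adGrading.1 hr)
        simp only [DistribSMul.toAddMonoidHom_apply, hDx, smul_sub, add_smul, ← mul_smul, hr']
        rw [mul_smul, smul_comm r l m, smul_assoc, Int.cast_smul_eq_zsmul K n (r • m)]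
        abel
      | zero => rw [smul_zero]; exact Submodule.zero_mem _
      | add x y _ _ hx hy => rw [smul_add]; exact Submodule.add_mem _ hx hy
    | zero => rw [zero_smul]; exact Submodule.zero_mem _
    | add r s _ _ hr hs => rw [add_smul]; exact Submodule.add_mem _ hr hs
  obtain ⟨z, hzH, hzc, hdz⟩ := h.exists_central_part
  obtain ⟨r, m, ⟨e⟩⟩ := h.split_H
  obtain ⟨c, hc⟩ := exists_split_polynomial_of_central (e ⟨z, hzH⟩) (fun y => by
    obtain ⟨y, rfl⟩ := e.surjective y
    rw [← map_mul, ← map_mul]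
    exact congrArg e (Subtype.ext (hzc y y.2)))
  set Q : Polynomial K := ∏ i, (Polynomial.X - Polynomial.C (c i))
  have hQ : Polynomial.aeval z Q = 0 := by
    have h1 : Polynomial.aeval (⟨z, hzH⟩ : H) Q = 0 := by
      refine e.injective ?_
      rw [map_zero, ← hc]
      exact (Polynomial.aeval_algHom_apply e.toAlgHom _ _).symm
    have h2 := Polynomial.aeval_algHom_apply H.val (⟨z, hzH⟩ : H) Q
    rw [h1, map_zero] at h2
    exact h2
  -- Induction on the bound `n` for nilpotency. `B_{<0}` lowers the bound, so by induction `d - z`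
  -- sends `x` into the weight part, whereas `H` preserves the bound. For `n = 0` the element `1 ∈
  -- B_0` kills `x`.
  have main : ∀ n : ℕ, ∀ x : N,
      (∀ k : ℕ, n ≤ k → ∀ b ∈ B, b ∈ adGrading K d (-(k : ℤ)) → b • x = 0) →
      x ∈ weightPart D := by
    intro n
    induction n with
    | zero =>
      intro x hx
      have := hx 0 le_rfl 1 B.one_mem (by simpa using one_mem_adGrading)
      rw [one_smul] at this
      rw [this]
      exact Submodule.zero_mem _
    | succ n ih =>
      have hJ : ∀ x : N,
          (∀ k : ℕ, n + 1 ≤ k → ∀ b ∈ B, b ∈ adGrading K d (-(k : ℤ)) → b • x = 0) →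
          (d - z) • x ∈ weightPart D := by
        intro x hx
        have h1 : ∀ b ∈ ⨆ j : ℕ, Subalgebra.toSubmodule B ⊓ adGrading K d (-((j + 1 : ℕ) : ℤ)),
            b • x ∈ weightPart D := by
          intro b hb
          induction hb using Submodule.iSup_induction' with
          | mem j b hb =>
            refine ih _ fun k hk b' hb' hb'k => ?_
            rw [← mul_smul]
            refine hx (k + (j + 1)) (by omega) _ (B.mul_mem hb' hb.1) ?_
            have := mul_mem_adGrading hb'k hb.2
            rw [← neg_add] at this
            exact_mod_cast this
          | zero => rw [zero_smul]; exact Submodule.zero_mem _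
          | add r s _ _ hr hs => rw [add_smul]; exact Submodule.add_mem _ hr hs
        generalize d - z = y at hdz
        induction hdz using Submodule.mul_induction_on' with
        | mem_mul_mem a _ b hb => rw [mul_smul]; exact hRW _ _ (h1 b hb)
        | add r _ s _ hr hs => rw [add_smul]; exact Submodule.add_mem _ hr hs
      have hH : ∀ y ∈ H, ∀ x : N,
          (∀ k : ℕ, n + 1 ≤ k → ∀ b ∈ B, b ∈ adGrading K d (-(k : ℤ)) → b • x = 0) →
          (∀ k : ℕ, n + 1 ≤ k → ∀ b ∈ B, b ∈ adGrading K d (-(k : ℤ)) → b • y • x = 0) := by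
        intro y hy x hx k hk b hb hbk
        have h1 := h.mul_H_le (-(k : ℤ)) (Submodule.mul_mem_mul ⟨hb, hbk⟩ hy)
        rw [← mul_smul]
        generalize b * y = w at h1
        induction h1 using Submodule.mul_induction_on' with
        | mem_mul_mem y' _ b hb => rw [mul_smul, hx k hk b hb.1 hb.2, smul_zero]
        | add r _ s _ hr hs => rw [add_smul, hr, hs, add_zero]
      intro x hx
      -- Modulo the weight part, powers of `d` act on `x` as powers of `z`. Hence the split
      -- polynomial `Q` that annihilates `z` sends `x` into the weight part, and `x` itself lies
      -- there.
      have hpow : ∀ j : ℕ, (D ^ j) x - z ^ j • x ∈ weightPart D := by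
        intro j
        induction j with
        | zero => simp
        | succ j ihj =>
          have h1 : (D ^ (j + 1)) x - z ^ (j + 1) • x =
              d • ((D ^ j) x - z ^ j • x) + (d - z) • z ^ j • x := by
            rw [pow_succ', pow_succ', Module.End.mul_apply, hDx, smul_sub, sub_smul, mul_smul]
            abel
          rw [h1]
          exact Submodule.add_mem _ (hRW _ _ ihj) (hJ _ (hH _ (pow_mem hzH j) x hx))
      refine mem_weightPart_of_aeval_mem D Finset.univ c ?_
      have h2 : ∀ P : Polynomial K,
          Polynomial.aeval D P x - (Polynomial.aeval z P) • x ∈ weightPart D := by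
        intro P
        induction P using Polynomial.induction_on' with
        | add P Q hP hQ =>
          convert Submodule.add_mem _ hP hQ using 1
          rw [map_add, map_add, LinearMap.add_apply, add_smul]
          abel
        | monomial j a =>
          rw [Polynomial.aeval_monomial, Polynomial.aeval_monomial, ← Algebra.smul_def,
            ← Algebra.smul_def, LinearMap.smul_apply, smul_assoc, ← smul_sub]
          exact Submodule.smul_mem _ _ (hpow j)
      have h3 := h2 Q
      rwa [hQ, zero_smul, sub_zero] at h3
  rw [eq_top_iff]
  intro x _
  obtain ⟨n, hn⟩ := hN x
  exact main (n + 1) x fun k hk => hn k hk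

end IsTriangularDecomposition

end CategoryO

/-! ## Contractions of completed tensor products -/

section Contraction

variable {K : Type w} [NontriviallyNormedField K]

lemma exists_tensor_representation {U V W : Type*} [AddCommGroup U] [Module K U] [AddCommGroup V]
    [Module K V] [AddCommGroup W] [Module K W] (t : U ⊗[K] (V ⊗[K] W)) :
    ∃ (n : ℕ) (x : Fin n → U) (y : Fin n → V) (z : Fin n → W),
      t = ∑ i, x i ⊗ₜ[K] (y i ⊗ₜ[K] z i) := by
  have hadd : ∀ t t' : U ⊗[K] (V ⊗[K] W),
      (∃ (n : ℕ) (x : Fin n → U) (y : Fin n → V) (z : Fin n → W),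
        t = ∑ i, x i ⊗ₜ[K] (y i ⊗ₜ[K] z i)) →
      (∃ (n : ℕ) (x : Fin n → U) (y : Fin n → V) (z : Fin n → W),
        t' = ∑ i, x i ⊗ₜ[K] (y i ⊗ₜ[K] z i)) →
      ∃ (n : ℕ) (x : Fin n → U) (y : Fin n → V) (z : Fin n → W),
        t + t' = ∑ i, x i ⊗ₜ[K] (y i ⊗ₜ[K] z i) := by
    rintro _ _ ⟨n, x, y, z, rfl⟩ ⟨n', x', y', z', rfl⟩
    refine ⟨n + n', Fin.append x x', Fin.append y y', Fin.append z z', ?_⟩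
    simp [Fin.sum_univ_add]
  induction t using TensorProduct.induction_on with
  | zero => exact ⟨0, Fin.elim0, Fin.elim0, Fin.elim0, by simp⟩
  | tmul a s =>
    induction s using TensorProduct.induction_on with
    | zero => exact ⟨0, Fin.elim0, Fin.elim0, Fin.elim0, by simp⟩
    | tmul b c => exact ⟨1, fun _ => a, fun _ => b, fun _ => c, by simp⟩
    | add s s' h h' => rw [TensorProduct.tmul_add]; exact hadd _ _ h h'
  | add t t' h h' => exact hadd _ _ h h'

/-- The tensor norm uses maxima over representations rather than sums; the ultrametric inequality in
the target is what makes a bound on pure tensors sufficient. -/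
lemma norm_le_tensorNorm {U V W E : Type*} [NormedAddCommGroup U] [NormedSpace K U]
    [NormedAddCommGroup V] [NormedSpace K V] [NormedAddCommGroup W] [NormedSpace K W]
    [NormedAddCommGroup E] [NormedSpace K E] [IsUltrametricDist E] (Ψ : U ⊗[K] (V ⊗[K] W) →ₗ[K] E)
    {C : ℝ} (hC : 0 ≤ C) (h : ∀ x y z, ‖Ψ (x ⊗ₜ (y ⊗ₜ z))‖ ≤ C * (‖x‖ * ‖y‖ * ‖z‖))
    (t : U ⊗[K] (V ⊗[K] W)) : ‖Ψ t‖ ≤ C * tensorNorm t := by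
  set s : Set ℝ := {c : ℝ | 0 ≤ c ∧ ∃ (n : ℕ) (x : Fin n → U) (y : Fin n → V) (z : Fin n → W),
    t = ∑ i, x i ⊗ₜ[K] (y i ⊗ₜ[K] z i) ∧ ∀ i, ‖x i‖ * ‖y i‖ * ‖z i‖ ≤ c}
  have hs : s.Nonempty := by
    obtain ⟨n, x, y, z, rfl⟩ := exists_tensor_representation t
    refine ⟨∑ i, ‖x i‖ * ‖y i‖ * ‖z i‖, by positivity, n, x, y, z, rfl, fun i => ?_⟩
    exact Finset.single_le_sum (f := fun i => ‖x i‖ * ‖y i‖ * ‖z i‖)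
      (fun j _ => by positivity) (Finset.mem_univ i)
  have hle : ∀ c ∈ s, ‖Ψ t‖ ≤ C * c := by
    rintro c ⟨hc, n, x, y, z, ht, hb⟩
    rw [ht, map_sum]
    refine IsUltrametricDist.norm_sum_le_of_forall_le_of_nonneg (by positivity) fun i _ => ?_
    exact (h _ _ _).trans (mul_le_mul_of_nonneg_left (hb i) hC)
  change ‖Ψ t‖ ≤ C * sInf s
  rcases hC.eq_or_lt with rfl | hC
  · obtain ⟨c, hc⟩ := hs
    simpa using hle c hc
  · rw [← div_le_iff₀' hC]
    exact le_csInf hs fun c hc => by rw [div_le_iff₀' hC]; exact hle c hc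

/-- Contraction of a completed tensor product `U ⊗ V ⊗ W` with functionals on `V` and `W`. -/
lemma exists_contraction {S : Type u} [NormedRing S] [NormedAlgebra K S]
    {U V W : Subalgebra K S} (hS : IsCompletedTensorProduct (mulMap₃ U V W))
    [CompleteSpace U] [IsUltrametricDist U]
    (γ : V →L[K] K) (β : W →L[K] K) :
    ∃ E : S →L[K] U, ∀ (a : U) (y : V) (b : W), E ((a : S) * y * b) = (γ y * β b) • a := by
  let Ψ : U ⊗[K] (V ⊗[K] W) →ₗ[K] U := (TensorProduct.rid K U).toLinearMap ∘ₗ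
    TensorProduct.map LinearMap.id
      (LinearMap.mul' K K ∘ₗ TensorProduct.map γ.toLinearMap β.toLinearMap)
  have hΨ : ∀ a y b, Ψ (a ⊗ₜ (y ⊗ₜ b)) = (γ y * β b) • a := fun a y b => by simp [Ψ]
  obtain ⟨C, hC⟩ := hS.lower
  have hb := norm_le_tensorNorm Ψ (C := ‖γ‖ * ‖β‖) (by positivity) fun x y z => by
    rw [hΨ, norm_smul, norm_mul]
    calc ‖γ y‖ * ‖β z‖ * ‖x‖ ≤ (‖γ‖ * ‖y‖) * (‖β‖ * ‖z‖) * ‖x‖ := by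
          gcongr
          · exact γ.le_opNorm y
          · exact β.le_opNorm z
      _ = ‖γ‖ * ‖β‖ * (‖x‖ * ‖y‖ * ‖z‖) := by ring
  refine ⟨Ψ.extendOfNorm (mulMap₃ U V W), fun a y b => ?_⟩
  -- The lower bound in the completed tensor product controls the tensor norm by the norm of `S`, so
  -- the contraction is bounded on the dense image of the multiplication map and extends.
  have h1 := LinearMap.extendOfNorm_eq (f := Ψ) hS.denseRange ⟨‖γ‖ * ‖β‖ * C, fun t => by
    rw [mul_assoc]
    exact (hb t).trans (mul_le_mul_of_nonneg_left (hC t) (by positivity))⟩ (a ⊗ₜ (y ⊗ₜ b))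
  rw [hΨ] at h1
  rw [← h1]
  congr 1
  simp [mulMap₃, mul_assoc]

end Contraction

/-! ## The derivation of the closure of a graded subalgebra -/

section AdWeights

variable {K : Type w} [NontriviallyNormedField K] [CharZero K]
  {R : Type u} [Ring R] [Algebra K R] {S : Type u} [NormedRing S] [NormedAlgebra K S]
  {i : R →ₐ[K] S} {d : R}

/-- The image in the closure. -/
def toClosure (i : R →ₐ[K] S) (C : Subalgebra K R) : C →ₗ[K] imageClosure i C where
  toFun c := ⟨i c, Subalgebra.le_topologicalClosure _ ⟨c, c.2, rfl⟩⟩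
  map_add' _ _ := Subtype.ext (map_add i _ _)
  map_smul' _ _ := Subtype.ext (map_smul i _ _)

lemma coe_toClosure (C : Subalgebra K R) (c : C) : (toClosure i C c : S) = i c := rfl

lemma toClosure_injective (hi : Function.Injective i) (C : Subalgebra K R) :
    Function.Injective (toClosure i C) := fun _ _ h =>
  Subtype.ext (hi (congrArg Subtype.val h))

/-- The sign `ε = ±1` treats `A` and `B` alike: `ε ad(d)` has weights in `ℕ` in both cases. Since
the weight part of the closure is the algebra itself, the eigenspaces are the images of its graded
pieces. -/
lemma exists_weightDerivation (hi : Function.Injective i) {C : Subalgebra K R} {ε : ℤ}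
    (hε : ε * ε = 1)
    (hC : Subalgebra.toSubmodule C = ⨆ n : ℕ, Subalgebra.toSubmodule C ⊓ adGrading K d (ε * n))
    (hfin : ∀ n : ℤ, FiniteDimensional K ↥(Subalgebra.toSubmodule C ⊓ adGrading K d n))
    (h : HasAdWeights i C d) :
    ∃ δ : Module.End K (imageClosure i C),
      (∀ a, (δ a : S) = (ε : K) • (i d * a - a * i d)) ∧ IsWeightDerivation δ ∧
      (∀ (n : ℕ) a, δ a = (n : K) • a ↔
        ∃ c : C, (c : R) ∈ adGrading K d (ε * n) ∧ toClosure i C c = a) := by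
  obtain ⟨D, hD, ⟨I, hI, hss⟩, hw⟩ := h
  have hεK : (ε : K) * ε = 1 := by exact_mod_cast hε
  set δ : Module.End K (imageClosure i C) := (ε : K) • D
  have hδ : ∀ a, (δ a : S) = (ε : K) • (i d * a - a * i d) := fun a => by
    rw [← hD]; rfl
  have hmem : ∀ a ∈ weightPart D, ∃ c : C, toClosure i C c = a := by
    intro a ha
    have h1 : (a : S) ∈ Subalgebra.toSubmodule (C.map i) := by
      rw [← hw]; exact ⟨a, ha, rfl⟩
    obtain ⟨c, hc, hca⟩ := h1
    exact ⟨⟨c, hc⟩, Subtype.ext hca⟩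
  have heig : ∀ (l : K) a, D a = l • a → ∃ c : C, d * c - c * d = l • (c : R) ∧
      toClosure i C c = a := by
    intro l a ha
    obtain ⟨c, rfl⟩ := hmem a (Submodule.mem_iSup_of_mem l (mem_maxGenEigenspace_of_eigen ha))
    refine ⟨c, hi ?_, rfl⟩
    have := congrArg Subtype.val ha
    rw [hD] at this
    simpa [coe_toClosure] using this
  have hiff : ∀ (n : ℕ) a, δ a = (n : K) • a ↔
      ∃ c : C, (c : R) ∈ adGrading K d (ε * n) ∧ toClosure i C c = a := by
    intro n a
    constructor
    · intro ha
      have h1 : D a = ((ε * n : ℤ) : K) • a := by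
        have : D a = (ε : K) • δ a := by simp [δ, smul_smul, hεK]
        rw [this, ha, smul_smul]
        push_cast
        rfl
      obtain ⟨c, hc, hca⟩ := heig _ _ h1
      refine ⟨c, ?_, hca⟩
      rw [mem_adGrading, hc, Int.cast_smul_eq_zsmul]
    · rintro ⟨c, hc, rfl⟩
      refine Subtype.ext ?_
      rw [hδ, coe_toClosure, ← map_mul, ← map_mul, ← map_sub, mem_adGrading.1 hc, map_zsmul,
        ← Int.cast_smul_eq_zsmul K, smul_smul]
      change _ = (n : K) • i c
      congr 1
      push_cast
      rw [← mul_assoc, hεK, one_mul]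
  refine ⟨δ, hδ, ⟨?_, ?_, ?_, ?_⟩, hiff⟩
  · refine continuous_induced_rng.2 ?_
    change Continuous fun a => (δ a : S)
    simp_rw [hδ]
    have : Continuous fun a : imageClosure i C => (a : S) := continuous_subtype_val
    exact ((this.const_mul _).sub (this.mul_const _)).const_smul _
  · intro a b
    refine Subtype.ext ?_
    change (δ (a * b) : S) = (δ a : S) * b + a * (δ b : S)
    rw [hδ, hδ, hδ, smul_mul_assoc, mul_smul_comm, ← smul_add]
    congr 1
    change i d * ((a : S) * b) - ((a : S) * b) * i d = _
    noncomm_ring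
  · intro v
    obtain ⟨x, hx, hxs⟩ := hI.exists_hasSum v
    -- A weight not of the form `ε n` would have an eigenvector in `C`, which lies in the sum of the
    -- eigenspaces of `ad(d)` for the eigenvalues `ε n`; independence of eigenspaces makes it zero.
    have hn : ∀ l : I, ∃ n : ℕ, ((ε * n : ℤ) : K) = l := by
      intro l
      by_contra! hcon
      obtain ⟨y, hy, hy0⟩ := (Submodule.ne_bot_iff _).1 (hI.subset l.2)
      obtain ⟨c, hc, rfl⟩ := heig l y (hss l l.2 y hy)
      refine hy0 ?_
      let ad : Module.End K R := LinearMap.mulLeft K d - LinearMap.mulRight K d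
      have h1 : (c : R) ∈ ad.eigenspace l := Module.End.mem_eigenspace_iff.2 hc
      have h2 : (c : R) ∈ ⨆ μ ≠ (l : K), ad.eigenspace μ := by
        have h3 : (c : R) ∈ Subalgebra.toSubmodule C := c.2
        rw [hC] at h3
        refine (iSup_le fun n => ?_ : _ ≤ ⨆ μ ≠ (l : K), ad.eigenspace μ) h3
        refine le_trans ?_ (le_iSup₂_of_le ((ε * n : ℤ) : K) (hcon n) le_rfl)
        rintro z ⟨-, hz⟩
        refine Module.End.mem_eigenspace_iff.2 ?_
        rw [Int.cast_smul_eq_zsmul]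
        exact hz
      have h4 := (Submodule.disjoint_def.1 (ad.eigenspaces_iSupIndep l)) _ h1 h2
      have : c = 0 := Subtype.ext h4
      rw [this, map_zero]
    choose e he using hn
    have hinj : Function.Injective e := fun l l' hl => Subtype.ext (by rw [← he, ← he, hl])
    refine ⟨Function.extend e x 0, fun n => ?_, (hasSum_extend_zero hinj).2 hxs⟩
    by_cases hne : ∃ l, e l = n
    · obtain ⟨l, rfl⟩ := hne
      rw [hinj.extend_apply]
      change (ε : K) • D (x l) = _
      rw [hss l l.2 _ (hx l), ← he l, smul_smul]
      push_cast
      rw [← mul_assoc, hεK, one_mul]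
    · rw [Function.extend_apply' _ _ _ hne]
      simp
  · intro n
    have := hfin (ε * n)
    let V := Submodule.comap (Subalgebra.toSubmodule C).subtype (adGrading K d (ε * n))
    have hV : FiniteDimensional K V := by
      let f : V →ₗ[K] ↥(Subalgebra.toSubmodule C ⊓ adGrading K d (ε * n)) :=
        LinearMap.codRestrict _ ((Subalgebra.toSubmodule C).subtype ∘ₗ V.subtype)
          fun v => ⟨v.1.2, v.2⟩
      refine FiniteDimensional.of_injective f fun a b hab => ?_
      have h1 : ((f a : ↥(Subalgebra.toSubmodule C ⊓ adGrading K d (ε * n))) : R) = f b :=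
        congrArg Subtype.val hab
      exact Subtype.ext (Subtype.ext h1)
    refine Submodule.finiteDimensional_of_le (S₂ := V.map (toClosure i C)) fun a ha => ?_
    obtain ⟨c, hc, rfl⟩ := (hiff n a).1 (Module.End.mem_eigenspace_iff.1 ha)
    exact ⟨c, hc, rfl⟩

variable [CompleteSpace S] [IsUltrametricDist S]

instance (C : Subalgebra K S) : CompleteSpace C.topologicalClosure :=
  (C.isClosed_topologicalClosure).completeSpace_coe

/-- Continuous projections onto the homogeneous parts. -/
lemma exists_closure_projections {C : Subalgebra K R} {δ : Module.End K (imageClosure i C)}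
    (hδ : IsWeightDerivation δ) :
    ∃ π : ℕ → imageClosure i C →L[K] imageClosure i C, (∀ n a, δ (π n a) = (n : K) • π n a) ∧
      ∀ (n m : ℕ) a, δ a = (n : K) • a → π m a = if m = n then a else 0 := by
  let δL : imageClosure i C →L[K] imageClosure i C := ⟨δ, hδ.continuous⟩
  obtain ⟨π, hπ⟩ := exists_weight_projections δL hδ.decomp
  refine ⟨π, fun n a => (hπ a).1 n, fun n m a ha => ?_⟩
  have h1 := (hπ a).2.sub (hasSum_ite_eq n a)
  rw [sub_self] at h1
  have h2 := eq_zero_of_hasSum_eigenvectors δL (fun m => ?_) h1 m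
  · exact sub_eq_zero.1 h2
  · rw [map_sub, (hπ a).1 m, smul_sub]
    congr 1
    split_ifs with hm
    · rw [hm]; exact ha
    · simp

end AdWeights

/-! ## Expansions along a triangular decomposition -/

section Expansion

variable {K : Type w} [NontriviallyNormedField K] [CompleteSpace K] [CharZero K]
  {R : Type u} [Ring R] [Algebra K R] {S : Type u} [NormedRing S] [NormedAlgebra K S]
  [CompleteSpace S] [IsUltrametricDist S] {i : R →ₐ[K] S} {d : R}

/-- The functionals `β` are the coordinates of the components of degree at most `n`. They are
continuous because the projections are and the graded pieces are finite dimensional. -/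
lemma exists_truncated_expansion (hi : Function.Injective i) {C : Subalgebra K R} {ε : ℤ}
    {δ : Module.End K (imageClosure i C)} (hδ : IsWeightDerivation δ)
    (hiff : ∀ (n : ℕ) a, δ a = (n : K) • a ↔
      ∃ c : C, (c : R) ∈ adGrading K d (ε * n) ∧ toClosure i C c = a) (n : ℕ) :
    ∃ (κ : Type) (_ : Fintype κ) (β : κ → imageClosure i C →L[K] K) (v : κ → C) (k : κ → ℕ),
      (∀ q, (v q : R) ∈ adGrading K d (ε * k q)) ∧
      ∀ (j : ℕ) (c : C), (c : R) ∈ adGrading K d (ε * j) →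
        ∑ q, β q (toClosure i C c) • v q = if j ≤ n then c else 0 := by
  classical
  obtain ⟨π, hπ, hπ'⟩ := exists_closure_projections hδ
  have hfin := hδ.finite
  let F : ℕ → Submodule K (imageClosure i C) := fun j => δ.eigenspace (j : K)
  let bs : ∀ j, Module.Basis (Fin (Module.finrank K (F j))) K (F j) := fun j => Module.finBasis K _
  have hv : ∀ (j : ℕ) l, ∃ c : C, (c : R) ∈ adGrading K d (ε * j) ∧
      toClosure i C c = (bs j l : imageClosure i C) := fun j l =>
    (hiff j _).1 (Module.End.mem_eigenspace_iff.1 (bs j l).2)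
  choose v hv hv' using hv
  let π' : ∀ j, imageClosure i C →L[K] F j := fun j =>
    (π j).codRestrict (F j) fun a => Module.End.mem_eigenspace_iff.2 (hπ j a)
  let coord : ∀ j (_ : Fin (Module.finrank K (F j))), F j →L[K] K := fun j l =>
    LinearMap.toContinuousLinearMap ((bs j).coord l)
  refine ⟨Σ j : Fin (n + 1), Fin (Module.finrank K (F j)), inferInstance,
    fun q => (coord q.1 q.2).comp (π' q.1), fun q => v q.1 q.2, fun q => q.1,
    fun q => hv _ _, fun j c hc => ?_⟩
  refine toClosure_injective hi C ?_
  have hx := (hiff j _).2 ⟨c, hc, rfl⟩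
  have hsum : ∀ j : ℕ, ∑ l, (bs j).repr (π' j (toClosure i C c)) l •
      (bs j l : imageClosure i C) = π j (toClosure i C c) := fun j => by
    have := congrArg Subtype.val ((bs j).sum_repr (π' j (toClosure i C c)))
    rw [Submodule.coe_sum] at this
    exact this
  rw [map_sum, Fintype.sum_sigma]
  have h1 : ∀ j' : Fin (n + 1), ∑ l, toClosure i C
      (((coord j' l).comp (π' j')) (toClosure i C c) • v j' l) =
        if (j' : ℕ) = j then toClosure i C c else 0 := fun j' => by
    rw [← hπ' j j' _ hx, ← hsum]
    refine Finset.sum_congr rfl fun l _ => ?_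
    rw [map_smul, hv']
    rfl
  rw [Finset.sum_congr rfl fun j' _ => h1 j', Fin.sum_univ_eq_sum_range
    (fun j' => if j' = j then toClosure i C c else 0), Finset.sum_ite_eq']
  simp only [Finset.mem_range, Nat.lt_succ_iff]
  split_ifs <;> simp

variable {A B H : Subalgebra K R} (hS : IsBanachTriangularDecomposition i A B H d)

include hS

lemma IsBanachTriangularDecomposition.exists_derivation_A :
    ∃ δ : Module.End K (imageClosure i A), (∀ a, (δ a : S) = i d * a - a * i d) ∧
      IsWeightDerivation δ ∧ (∀ (n : ℕ) a, δ a = (n : K) • a ↔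
        ∃ c : A, (c : R) ∈ adGrading K d n ∧ toClosure i A c = a) := by
  obtain ⟨δ, h1, h2, h3⟩ := exists_weightDerivation hS.injective (ε := 1) (by norm_num)
    (by simpa using hS.algebraic.graded_A) hS.algebraic.finite_A hS.weights_A
  exact ⟨δ, by simpa using h1, h2, by simpa using h3⟩

lemma IsBanachTriangularDecomposition.exists_derivation_B :
    ∃ δ : Module.End K (imageClosure i B),
      IsWeightDerivation δ ∧ (∀ (n : ℕ) a, δ a = (n : K) • a ↔
        ∃ c : B, (c : R) ∈ adGrading K d (-1 * (n : ℤ)) ∧ toClosure i B c = a) := by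
  obtain ⟨δ, h1, h2, h3⟩ := exists_weightDerivation hS.injective (ε := -1) (by norm_num)
    (by simpa using hS.algebraic.graded_B) hS.algebraic.finite_B hS.weights_B
  exact ⟨δ, h2, h3⟩

/-- Modulo the left ideal generated by the part of `B` of degree `< -n`, elements of `R` are
combinations of finitely many homogeneous elements, with coefficients in `A` that extend
continuously to `S`. -/
theorem IsBanachTriangularDecomposition.exists_expansion (n : ℕ) :
    ∃ (κ : Type) (_ : Fintype κ) (E : κ → S →L[K] imageClosure i A) (u : κ → R) (k : κ → ℕ),
      (∀ q, u q ∈ adGrading K d (-(k q : ℤ))) ∧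
      ∀ r : R, ∃ a : κ → A, (∀ q, E q (i r) = toClosure i A (a q)) ∧
        r - ∑ q, (a q : R) * u q ∈
          Ideal.span {b | b ∈ B ∧ ∃ k : ℕ, n < k ∧ b ∈ adGrading K d (-(k : ℤ))} := by
  obtain ⟨δ, hδ, hiff⟩ := hS.exists_derivation_B
  obtain ⟨κ₁, _, β, v, k, hv, hβ⟩ := exists_truncated_expansion hS.injective hδ hiff n
  have := hS.algebraic.finiteDimensional_H
  let e := H.equivMapOfInjective i hS.injective
  have : FiniteDimensional K (H.map i) := Module.Finite.equiv e.toLinearEquiv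
  let bs := Module.finBasis K H
  let γ : Fin (Module.finrank K H) → (H.map i) →L[K] K := fun s =>
    LinearMap.toContinuousLinearMap ((bs.coord s) ∘ₗ e.symm.toLinearEquiv.toLinearMap)
  -- Contracting `S = 𝒜 ⊗ H ⊗ ℬ` with a coordinate on `H` and a truncated coordinate on `ℬ` leaves a
  -- coefficient in `𝒜`.
  choose E hE using fun (s : Fin (Module.finrank K H)) (l : κ₁) =>
    exists_contraction hS.tensor (γ s) (β l)
  refine ⟨Fin (Module.finrank K H) × κ₁, inferInstance, fun q => E q.1 q.2,
    fun q => (bs q.1 : R) * v q.2, fun q => k q.2, fun q => ?_, fun r => ?_⟩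
  · have := mul_mem_adGrading (hS.algebraic.graded_H (bs q.1).2) (hv q.2)
    rwa [zero_add, neg_one_mul] at this
  · set L := Ideal.span {b | b ∈ B ∧ ∃ k : ℕ, n < k ∧ b ∈ adGrading K d (-(k : ℤ))}
    let P : R → Prop := fun r => ∃ a : Fin (Module.finrank K H) × κ₁ → A,
      (∀ q, E q.1 q.2 (i r) = toClosure i A (a q)) ∧
        r - ∑ q, (a q : R) * ((bs q.1 : R) * v q.2) ∈ L
    have hPz : P 0 := ⟨0, fun q => by simp, by simp⟩
    have hPadd : ∀ r r', P r → P r' → P (r + r') := by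
      rintro r r' ⟨a, ha, hr⟩ ⟨a', ha', hr'⟩
      refine ⟨a + a', fun q => by rw [map_add, map_add, ha, ha', Pi.add_apply, map_add], ?_⟩
      convert L.add_mem hr hr' using 1
      simp only [Pi.add_apply, Subalgebra.coe_add, add_mul, Finset.sum_add_distrib]
      abel
    have hPmul : ∀ a ∈ A, ∀ y ∈ H, ∀ b ∈ B, P (a * y * b) := by
      intro a ha y hy b hb
      have hb' : b ∈ ⨆ j : ℕ, Subalgebra.toSubmodule B ⊓ adGrading K d (-(j : ℤ)) := by
        rw [← hS.algebraic.graded_B]; exact hb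
      clear hb
      induction hb' using Submodule.iSup_induction' with
      | mem j b hb =>
        -- On `a y b` with `b` of degree `-j`, the expansion is exact if `j ≤ n`. Otherwise all
        -- coefficients vanish and `a y b` lies in the left ideal itself.
        have h1 := hβ j ⟨b, hb.1⟩ (by rw [neg_one_mul]; exact hb.2)
        have h2 := congrArg Subtype.val (bs.sum_repr ⟨y, hy⟩)
        rw [AddSubmonoidClass.coe_finsetSum] at h2
        refine ⟨fun q => (γ q.1 ⟨i y, y, hy, rfl⟩ * β q.2 (toClosure i B ⟨b, hb.1⟩)) • ⟨a, ha⟩,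
          fun q => ?_, ?_⟩
        · have := hE q.1 q.2 (toClosure i A ⟨a, ha⟩) ⟨i y, y, hy, rfl⟩ (toClosure i B ⟨b, hb.1⟩)
          rw [map_smul, ← this]
          refine congrArg (E q.1 q.2) ?_
          rw [map_mul, map_mul]
          rfl
        · have h3 : ∑ q : Fin (Module.finrank K H) × κ₁,
              (((γ q.1 ⟨i y, y, hy, rfl⟩ * β q.2 (toClosure i B ⟨b, hb.1⟩)) •
                (⟨a, ha⟩ : A) : A) : R) * ((bs q.1 : R) * v q.2) =
              a * y * ((if j ≤ n then ⟨b, hb.1⟩ else 0 : B) : R) := by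
            rw [← h1, AddSubmonoidClass.coe_finsetSum]
            have h4 : y = ∑ s, γ s ⟨i y, y, hy, rfl⟩ • (bs s : R) := by
              refine h2.symm.trans (Finset.sum_congr rfl fun s _ => ?_)
              have h5 : e.symm ⟨i y, y, hy, rfl⟩ = ⟨y, hy⟩ := by
                rw [AlgEquiv.symm_apply_eq]; rfl
              change _ = (bs.repr (e.symm ⟨i y, y, hy, rfl⟩)) s • (bs s : R)
              rw [h5]
              rfl
            conv_rhs => rw [h4]
            rw [Fintype.sum_prod_type, Finset.sum_comm, Finset.mul_sum]
            refine Finset.sum_congr rfl fun l _ => ?_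
            rw [Finset.mul_sum, Finset.sum_mul]
            refine Finset.sum_congr rfl fun s _ => ?_
            change (γ s _ * β l _) • a * ((bs s : R) * v l) =
              a * (γ s _ • (bs s : R)) * (β l _ • (v l : R))
            simp only [smul_mul_assoc, mul_smul_comm, smul_smul, mul_assoc]
            rw [mul_comm]
          rw [h3]
          split_ifs with hj
          · simp
          · rw [ZeroMemClass.coe_zero, mul_zero, sub_zero]
            exact L.mul_mem_left _ (Ideal.subset_span ⟨hb.1, j, by omega, hb.2⟩)
      | zero => rw [mul_zero]; exact hPz
      | add b b' _ _ h h' => rw [mul_add]; exact hPadd _ _ h h'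
    have hr : r ∈ Subalgebra.toSubmodule A * Subalgebra.toSubmodule H *
        Subalgebra.toSubmodule B := by rw [hS.algebraic.mul_eq_top]; trivial
    change P r
    induction hr using Submodule.mul_induction_on' with
    | mem_mul_mem x hx b hb =>
      induction hx using Submodule.mul_induction_on' with
      | mem_mul_mem a ha y hy => exact hPmul a ha y hy b hb
      | add x _ x' _ h h' => rw [add_mul]; exact hPadd _ _ h h'
    | add x _ x' _ h h' => exact hPadd _ _ h h'

end Expansion

/-! ## Category `𝒪` for a Banach algebra -/

section LocallyNilpotent

variable {K : Type w} [Field K] {R : Type u} [Ring R] [Algebra K R]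

/-- Elements of large negative degree of `B` act by zero on every element of `N`. -/
def IsLocallyNilpotent (B : Subalgebra K R) (d : R) (N : Type v) [AddCommGroup N] [Module R N] :
    Prop :=
  ∀ x : N, ∃ n : ℕ, ∀ k : ℕ, n < k → ∀ b ∈ B, b ∈ adGrading K d (-(k : ℤ)) → b • x = 0

lemma smul_mem_maxGenEigenspace_of_mem_adGrading {N : Type*} [AddCommGroup N] [Module R N]
    [Module K N] [IsScalarTower K R N] {d r : R} {n : ℤ} (hr : r ∈ adGrading K d n) {l : K} {x : N}
    (hx : x ∈ (Algebra.lsmul K K N d).maxGenEigenspace l) :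
    r • x ∈ (Algebra.lsmul K K N d).maxGenEigenspace (l + n) := by
  refine map_mem_maxGenEigenspace (DistribSMul.toAddMonoidHom N r) (fun m => ?_) hx
  have h1 : d * r - r * d = n • r := hr
  simp only [Algebra.lsmul_coe, DistribSMul.toAddMonoidHom_apply]
  have h2 : d • r • m = r • d • m + n • r • m := by
    rw [← mul_smul, sub_eq_iff_eq_add.1 h1, add_smul, smul_assoc, mul_smul, add_comm]
  rw [h2, add_smul, Int.cast_smul_eq_zsmul, smul_sub, smul_algebra_smul_comm l r m]
  abel

end LocallyNilpotent

/-! ### Extension of scalars from `𝒪` to a Banach level: finiteness and injectivity -/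

section BanachCategoryO

variable {K : Type w} [NontriviallyNormedField K] [CompleteSpace K] [CharZero K]
  [IsUltrametricDist K] {R : Type u} [Ring R] [Algebra K R] {S : Type u} [NormedRing S]
  [NormedAlgebra K S] [CompleteSpace S] [IsUltrametricDist S] {i : R →ₐ[K] S} {d : R}
  {A B H : Subalgebra K R}

lemma leibniz_lsmul {δ : Module.End K (imageClosure i A)}
    (hδ : ∀ a, (δ a : S) = i d * a - a * i d) {P : Type*} [AddCommGroup P] [Module S P]
    [Module K P] [IsScalarTower K S P] (a : imageClosure i A) (m : P) :
    Algebra.lsmul K K P (i d) (a • m) = δ a • m + a • Algebra.lsmul K K P (i d) m := by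
  simp only [Algebra.lsmul_coe, Subalgebra.smul_def, hδ, sub_smul, mul_smul]
  abel

instance isScalarTower_imageClosure (C : Subalgebra K S) {P : Type*} [AddCommGroup P] [Module S P]
    [Module K P] [IsScalarTower K S P] : IsScalarTower K C P :=
  ⟨fun c a m => by rw [Subalgebra.smul_def, Subalgebra.smul_def, Subalgebra.coe_smul, smul_assoc]⟩

variable (hS : IsBanachTriangularDecomposition i A B H d)

include hS

namespace IsBanachTriangularDecomposition

section Extension

variable {N : Type u} [AddCommGroup N] [Module R N] [Module K N] [IsScalarTower K R N]
  (hN : IsLocallyNilpotent B d N) {P : Type v} [AddCommGroup P] [Module S P] [Module K P]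
  [IsScalarTower K S P] {j : N →+ P} (hj : IsScalarExtension i.toRingHom j)

include hN hj

/-- The extension of scalars of an object of `𝒪` is generated over `𝒜` by weight vectors. -/
theorem exists_weight_generators [Module.Finite R N] :
    ∃ (ι : Type u) (_ : Fintype ι) (f : ι → N) (wt : ι → K),
      (∀ q, f q ∈ (Algebra.lsmul K K N d).maxGenEigenspace (wt q)) ∧
      Submodule.span (imageClosure i A) (Set.range (j ∘ f)) = ⊤ := by
  have hw : Submodule.span R (weightPart (Algebra.lsmul K K N d) : Set N) = ⊤ := by
    rw [hS.algebraic.weightPart_eq_top hN, Submodule.top_coe, Submodule.span_univ]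
  obtain ⟨s, wt, hs, hspan⟩ := _root_.exists_weight_generators hw
  choose n hn using hN
  choose κ hκ E u k hu hE using fun t : s => hS.exists_expansion (n t)
  have hjs : Submodule.span S (Set.range fun t : s => j t) = ⊤ := by
    rw [eq_top_iff, ← hj.span_range, Submodule.span_le]
    rintro _ ⟨m, rfl⟩
    have hm : m ∈ Submodule.span R (Set.range fun t : s => (t : N)) := hspan ▸ Submodule.mem_top
    obtain ⟨c, rfl⟩ := (Submodule.mem_span_range_iff_exists_fun R).1 hm
    rw [map_sum]
    refine Submodule.sum_mem _ fun t _ => ?_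
    rw [hj.smul]
    exact Submodule.smul_mem _ _ (Submodule.subset_span ⟨t, rfl⟩)
  have hfin : Module.Finite S P :=
    Module.finite_def.2 (Submodule.fg_def.2 ⟨_, Set.finite_range _, hjs⟩)
  have hnoeth := hS.noetherian
  let τ : TopologicalSpace P := moduleTopology S P
  have hτ : IsModuleTopology S P := ⟨rfl⟩
  have hT2 : T2Space P := t2Space_of_finite K S
  have hadd := IsModuleTopology.topologicalAddGroup S P
  -- Both sides are continuous in `x` with values in a Hausdorff module, so the density of `R`
  -- suffices. For `x` in `R` the identity is the expansion, whose error term annihilates `t`. It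
  -- exhibits the `u t q • t` as generators over `𝒜`.
  have key : ∀ (t : s) (x : S), x • j t = ∑ q, (E t q x) • j (u t q • (t : N)) := by
    intro t
    have hc : Continuous fun x : S => x • j t := by fun_prop
    have hc' : Continuous fun x : S => ∑ q, (E t q x) • j (u t q • (t : N)) := by
      refine continuous_finsetSum _ fun q _ => ?_
      simp only [Subalgebra.smul_def]
      exact (continuous_subtype_val.comp (E t q).continuous).smul continuous_const
    refine congrFun (hS.denseRange.equalizer hc hc' ?_)
    funext r
    obtain ⟨a, ha, hr⟩ := hE t r
    have h0 : (r - ∑ q, (a q : R) * u t q) • (t : N) = 0 := by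
      have hle : Ideal.span {b | b ∈ B ∧ ∃ k : ℕ, n t < k ∧ b ∈ adGrading K d (-(k : ℤ))} ≤
          LinearMap.ker (LinearMap.toSpanSingleton R N (t : N)) := by
        rw [Ideal.span, Submodule.span_le]
        rintro b ⟨hb, k, hk, hbk⟩
        exact hn t k hk b hb hbk
      exact hle hr
    rw [sub_smul, sub_eq_zero] at h0
    have h1 : i r • j t = j (r • (t : N)) := (hj.smul r t).symm
    simp only [Function.comp_apply]
    rw [h1, h0, Finset.sum_smul, map_sum]
    refine Finset.sum_congr rfl fun q _ => ?_
    rw [mul_smul, ha, Subalgebra.smul_def, coe_toClosure]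
    exact hj.smul _ _
  refine ⟨ULift (Σ t : s, κ t), inferInstance, fun q => u q.down.1 q.down.2 • (q.down.1 : N),
    fun q => wt q.down.1 + ((-(k q.down.1 q.down.2 : ℤ) : ℤ) : K), fun q =>
      smul_mem_maxGenEigenspace_of_mem_adGrading (hu _ _) (hs _), ?_⟩
  rw [eq_top_iff]
  intro p _
  have hp : p ∈ Submodule.span S (Set.range fun t : s => j t) := hjs ▸ Submodule.mem_top
  obtain ⟨c, rfl⟩ := (Submodule.mem_span_range_iff_exists_fun S).1 hp
  refine Submodule.sum_mem _ fun t _ => ?_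
  rw [key]
  exact Submodule.sum_mem _ fun q _ =>
    Submodule.smul_mem _ _ (Submodule.subset_span ⟨⟨⟨t, q⟩⟩, rfl⟩)

end Extension

section Injective

variable {N : Type u} [AddCommGroup N] [Module R N] [Module K N] [IsScalarTower K R N]

/-- Functionals supported on one weight space extend continuously along orbits of `A`. -/
lemma exists_functional_closure {l ν : K} {g : N →ₗ[K] K}
    (hg : ∀ μ, μ ≠ l → ∀ x ∈ (Algebra.lsmul K K N d).maxGenEigenspace μ, g x = 0) {y : N}
    (hy : y ∈ (Algebra.lsmul K K N d).maxGenEigenspace ν) :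
    ∃ ψ : imageClosure i A →L[K] K, ∀ a : A, ψ (toClosure i A a) = g ((a : R) • y) := by
  classical
  obtain ⟨δ, -, hδ, hiff⟩ := hS.exists_derivation_A
  obtain ⟨π, hπ, hπ'⟩ := exists_closure_projections hδ
  have ind : ∀ ψ : imageClosure i A →L[K] K, (∀ (n : ℕ) (a : A), (a : R) ∈ adGrading K d n →
      ψ (toClosure i A a) = g ((a : R) • y)) → ∀ a : A, ψ (toClosure i A a) = g ((a : R) • y) := by
    rintro ψ hψ ⟨a, ha⟩
    have ha' : a ∈ ⨆ n : ℕ, Subalgebra.toSubmodule A ⊓ adGrading K d (n : ℤ) :=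
      hS.algebraic.graded_A ▸ ha
    have hle : ∀ x ∈ ⨆ n : ℕ, Subalgebra.toSubmodule A ⊓ adGrading K d (n : ℤ), x ∈ A := by
      intro x hx
      rw [← hS.algebraic.graded_A] at hx
      exact hx
    suffices H : ∀ x (hx : x ∈ ⨆ n : ℕ, Subalgebra.toSubmodule A ⊓ adGrading K d (n : ℤ)),
        ψ (toClosure i A ⟨x, hle x hx⟩) = g (x • y) from H a ha'
    intro x hx
    induction hx using Submodule.iSup_induction' with
    | mem n x hx => exact hψ n ⟨x, hx.1⟩ hx.2
    | zero =>
      rw [zero_smul, map_zero]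
      exact (congrArg ψ (map_zero (toClosure i A))).trans (map_zero ψ)
    | add x x' hx hx' h1 h2 =>
      rw [add_smul, map_add, ← h1, ← h2, ← map_add, ← map_add]
      rfl
  -- Only elements of degree `c = l - ν` can move `y` into weight `l`. So the functional factors
  -- through the projection to one finite dimensional graded piece, or is zero if there is no such
  -- degree.
  by_cases hc : ∃ c : ℕ, ν + c = l
  · obtain ⟨c, hc⟩ := hc
    have hfd := hδ.finite c
    have hinj := toClosure_injective hS.injective A
    let e := LinearEquiv.ofInjective (toClosure i A) hinj
    have hmem : ∀ a ∈ δ.eigenspace (c : K), a ∈ LinearMap.range (toClosure i A) := fun a ha => by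
      obtain ⟨x, -, hx⟩ := (hiff c a).1 (Module.End.mem_eigenspace_iff.1 ha)
      exact ⟨x, hx⟩
    let φ : δ.eigenspace (c : K) →ₗ[K] K := g ∘ₗ
      (LinearMap.toSpanSingleton R N y).restrictScalars K ∘ₗ A.val.toLinearMap ∘ₗ
      e.symm.toLinearMap ∘ₗ Submodule.inclusion hmem
    have hφ : ∀ (a : A) (ha : toClosure i A a ∈ δ.eigenspace (c : K)),
        φ ⟨_, ha⟩ = g ((a : R) • y) := by
      intro a ha
      have : e.symm (Submodule.inclusion hmem ⟨_, ha⟩) = a := by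
        rw [LinearEquiv.symm_apply_eq]
        rfl
      change g ((e.symm (Submodule.inclusion hmem ⟨_, ha⟩) : R) • y) = _
      rw [this]
    let πc : imageClosure i A →L[K] δ.eigenspace (c : K) :=
      (π c).codRestrict _ fun a => Module.End.mem_eigenspace_iff.2 (hπ c a)
    refine ⟨(LinearMap.toContinuousLinearMap φ).comp πc, ind _ fun n a ha => ?_⟩
    have hδa : δ (toClosure i A a) = (n : K) • toClosure i A a := (hiff n _).2 ⟨a, ha, rfl⟩
    have h1 := hπ' n c _ hδa
    split_ifs at h1 with hcn
    · subst hcn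
      have h2 : πc (toClosure i A a) = ⟨_, Module.End.mem_eigenspace_iff.2 hδa⟩ := Subtype.ext h1
      change φ (πc (toClosure i A a)) = _
      rw [h2, hφ]
    · have h2 : πc (toClosure i A a) = 0 := Subtype.ext h1
      change φ (πc (toClosure i A a)) = _
      rw [h2, map_zero]
      refine (hg _ ?_ _ (smul_mem_maxGenEigenspace_of_mem_adGrading ha hy)).symm
      rw [← hc, Int.cast_natCast]
      intro h
      exact hcn (by exact_mod_cast (add_left_cancel h).symm)
  · refine ⟨0, ind _ fun n a ha => ?_⟩
    refine (hg _ ?_ _ (smul_mem_maxGenEigenspace_of_mem_adGrading ha hy)).symm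
    rw [Int.cast_natCast]
    exact fun h => hc ⟨n, h⟩

variable (hN : IsLocallyNilpotent B d N)

include hN

/-- The expansion of `r` reduces `g (r • m)` to finitely many functionals on `𝒜` evaluated at
coefficients continuous in `r`. This gives a linear form on `S` that will detect the element `1 ⊗
m`. -/
lemma exists_functional {l : K} {g : N →ₗ[K] K}
    (hg : ∀ μ, μ ≠ l → ∀ x ∈ (Algebra.lsmul K K N d).maxGenEigenspace μ, g x = 0) (m : N) :
    ∃ θ : S →L[K] K, ∀ r : R, θ (i r) = g (r • m) := by
  have hm : m ∈ weightPart (Algebra.lsmul K K N d) :=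
    hS.algebraic.weightPart_eq_top hN ▸ Submodule.mem_top
  rw [weightPart] at hm
  induction hm using Submodule.iSup_induction' with
  | mem μ m hm =>
    obtain ⟨n, hn⟩ := hN m
    obtain ⟨κ, _, E, u, k, hu, hE⟩ := hS.exists_expansion n
    choose ψ hψ using fun q => hS.exists_functional_closure hg
      (smul_mem_maxGenEigenspace_of_mem_adGrading (hu q) hm)
    refine ⟨∑ q, (ψ q).comp (E q), fun r => ?_⟩
    obtain ⟨a, ha, hr⟩ := hE r
    have h0 : (r - ∑ q, (a q : R) * u q) • m = 0 := by
      have hle : Ideal.span {b | b ∈ B ∧ ∃ k : ℕ, n < k ∧ b ∈ adGrading K d (-(k : ℤ))} ≤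
          LinearMap.ker (LinearMap.toSpanSingleton R N m) := by
        rw [Ideal.span, Submodule.span_le]
        rintro b ⟨hb, k, hk, hbk⟩
        exact hn k hk b hb hbk
      exact hle hr
    rw [sub_smul, sub_eq_zero] at h0
    rw [h0, Finset.sum_smul, map_sum, sum_apply]
    refine Finset.sum_congr rfl fun q _ => ?_
    rw [ContinuousLinearMap.comp_apply, ha, hψ, mul_smul]
  | zero => exact ⟨0, fun r => by simp⟩
  | add x y _ _ hx hy =>
    obtain ⟨θ, hθ⟩ := hx
    obtain ⟨θ', hθ'⟩ := hy
    exact ⟨θ + θ', fun r => by rw [add_apply, hθ, hθ', smul_add, map_add]⟩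

/-- Locally nilpotent modules embed in their extension of scalars. -/
theorem injective_of_isScalarExtension {P : Type v} [AddCommGroup P] [Module S P] {j : N →+ P}
    (hj : IsScalarExtension i.toRingHom j) : Function.Injective j := by
  classical
  set D := Algebra.lsmul K K N d with hD
  have main : ∀ (l : K), ∀ x ∈ D.maxGenEigenspace l, j x = 0 → x = 0 := by
    intro l x hx hjx
    by_contra hx0
    -- Independence of the weight spaces yields a linear form that is nonzero at `x` and vanishes on
    -- all weights other than `l`.
    let W : Submodule K N := ⨆ μ, ⨆ (_ : μ ≠ l), D.maxGenEigenspace μ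
    have hxW : x ∉ W := fun h => hx0 <|
      Submodule.disjoint_def.1 (D.independent_maxGenEigenspace l) x hx h
    obtain ⟨g, hgx, hgW⟩ := Submodule.exists_le_ker_of_notMem hxW
    have hg : ∀ μ, μ ≠ l → ∀ y ∈ D.maxGenEigenspace μ, g y = 0 := fun μ hμ y hy =>
      hgW (Submodule.mem_iSup_of_mem μ (Submodule.mem_iSup_of_mem hμ hy))
    choose θ hθ using hS.exists_functional hN hg
    have ext : ∀ f f' : S → K, Continuous f → Continuous f' → (∀ r, f (i r) = f' (i r)) → f = f' :=
      fun f f' hf hf' h => hS.denseRange.equalizer hf hf' (funext h)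
    have hadd : ∀ m m' s, θ (m + m') s = θ m s + θ m' s := fun m m' => congrFun <|
      ext _ _ (θ _).continuous ((θ m).continuous.add (θ m').continuous) fun r => by
        simp only [hθ, smul_add, map_add]
    -- The forms `θ m` assemble to a pairing of `S` and `N`, balanced over `R` by density. On the
    -- tensor product it sends `1 ⊗ x` to `g x ≠ 0`.
    let φ : S →+ N →+ K := AddMonoidHom.mk' (fun s => AddMonoidHom.mk' (fun m => θ m s)
      fun m m' => hadd m m' s) fun s s' => by
        ext m
        exact map_add (θ m) s s'
    have hφ : ∀ s r m, φ (s * i.toRingHom r) m = φ s (r • m) := fun s r m => congrFun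
      (ext (fun s => θ m (s * i r)) (θ (r • m)) ((θ m).continuous.comp (continuous_mul_const _))
        (θ (r • m)).continuous fun r' => by
          rw [← map_mul, hθ, hθ, mul_smul]) s
    have h1 : BaseChange.unit i.toRingHom N x = 0 := by
      rw [← hj.equiv_symm, hjx, map_zero]
    have h2 : BaseChange.liftAdd i.toRingHom φ hφ (BaseChange.unit i.toRingHom N x) = g x := by
      change θ x 1 = g x
      rw [← map_one i, hθ, one_smul]
    rw [h1, map_zero] at h2
    exact hgx h2.symm
  rw [injective_iff_map_eq_zero]
  -- The kernel is a locally nilpotent `R`-module without weight vectors. Being the sum of its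
  -- weight spaces, it is zero.
  let N' : Submodule R N :=
    { carrier := {x | j x = 0}
      add_mem' := fun {x y} hx hy => by
        simp only [Set.mem_ofPred_eq] at hx hy ⊢
        rw [map_add, hx, hy, add_zero]
      zero_mem' := map_zero j
      smul_mem' := fun r x hx => by
        simp only [Set.mem_ofPred_eq] at hx ⊢
        rw [hj.smul, hx, smul_zero] }
  have hN' : IsLocallyNilpotent B d N' := fun x => by
    obtain ⟨n, hn⟩ := hN x
    exact ⟨n, fun k hk b hb hbk => Subtype.ext (hn k hk b hb hbk)⟩
  have htop : weightPart (Algebra.lsmul K K N' d) = ⊤ := hS.algebraic.weightPart_eq_top hN'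
  have hbot : weightPart (Algebra.lsmul K K N' d) = ⊥ := by
    rw [weightPart, iSup_eq_bot]
    intro l
    rw [eq_bot_iff]
    intro x hx
    have hx' : (x : N) ∈ D.maxGenEigenspace l :=
      map_mem_maxGenEigenspace_of_comm (N'.subtype.restrictScalars K) (fun m => rfl) hx
    exact Subtype.ext (main l x hx' x.2)
  intro x hx
  have : (⟨x, hx⟩ : N') ∈ (⊥ : Submodule K N') := hbot ▸ htop ▸ Submodule.mem_top
  exact congrArg Subtype.val ((Submodule.mem_bot K).1 this)

end Injective

end IsBanachTriangularDecomposition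

end BanachCategoryO

/-! ### Weight part and extension of scalars as inverse operations at a Banach level -/

section BanachEquivalence

variable {K : Type w} [NontriviallyNormedField K] [CompleteSpace K] [CharZero K]
  [IsUltrametricDist K] {R : Type u} [Ring R] [Algebra K R] {S : Type u} [NormedRing S]
  [NormedAlgebra K S] [CompleteSpace S] [IsUltrametricDist S] {i : R →ₐ[K] S} {d : R}
  {A B H : Subalgebra K R}

/-- The span of the weight vectors over the closure of `A` is closed, as any submodule of a finitely
generated module, so it contains all convergent sums of weight vectors. -/
lemma IsWeightDerivation.span_weightPart_eq_top [IsNoetherianRing S]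
    [IsNoetherianRing (imageClosure i A)] {M : Type*} [AddCommGroup M] [Module S M] [Module K M]
    [IsScalarTower K S M] [Module.Finite S M] [Module.Finite (imageClosure i A) M]
    {D : Module.End K M}
    (h : @HasWeightDecomposition K M _ _ _ (moduleTopology S M) D) :
    Submodule.span (imageClosure i A) (weightPart D : Set M) = ⊤ := by
  let τ : TopologicalSpace M := moduleTopology S M
  have hτ : IsModuleTopology S M := ⟨rfl⟩
  have hA : IsModuleTopology (imageClosure i A) M :=
    isModuleTopology_of_finite K (S := S) (imageClosure i A).val continuous_subtype_val
      fun a m => rfl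
  obtain ⟨I, hI⟩ := h
  rw [eq_top_iff]
  intro v _
  obtain ⟨x, hx, hs⟩ := hI.exists_hasSum v
  refine (isClosed_submodule K (Submodule.span (imageClosure i A)
    (weightPart D : Set M))).mem_of_tendsto hs (Filter.Eventually.of_forall fun s => ?_)
  exact Submodule.sum_mem _ fun l _ => Submodule.subset_span
    (Submodule.mem_iSup_of_mem (l : K) (hx l))

lemma hasFiniteTypeWeightDecomposition_of_hasSum {V : Type*} [AddCommGroup V] [Module K V]
    [TopologicalSpace V] {D : Module.End K V}
    (h : ∀ v, ∃ x : K → V, (∀ l, x l ∈ D.maxGenEigenspace l) ∧ HasSum x v)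
    (hF : ∃ F : Finset K, ∀ l ∈ weightSet D, ∃ m ∈ F, ∃ k : ℕ, l = m + (k : K))
    (hfin : ∀ l, FiniteDimensional K (D.maxGenEigenspace l)) :
    HasFiniteTypeWeightDecomposition D := by
  refine ⟨weightSet D, ⟨le_rfl, fun v => ?_⟩, ?_, fun l _ => hfin l⟩
  · obtain ⟨x, hx, hs⟩ := h v
    refine ⟨fun l => x l, fun l => hx l, (hasSum_subtype_iff_of_support_subset fun l hl => ?_).2 hs⟩
    intro hbot
    have := hx l
    rw [hbot, Submodule.mem_bot] at this
    exact hl this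
  · obtain ⟨F, hF⟩ := hF
    refine ⟨F, fun l hl => ?_⟩
    obtain ⟨m, hm, k, rfl⟩ := hF l hl
    exact ⟨m, hm, k, by simp⟩

variable (hS : IsBanachTriangularDecomposition i A B H d)

include hS

namespace IsBanachTriangularDecomposition

section Modules

variable [IsNoetherianRing (imageClosure i A)] {M : Type v} [AddCommGroup M] [Module S M]
  [Module K M] [IsScalarTower K S M] [Module.Finite (imageClosure i A) M]
  (hM : Submodule.span (imageClosure i A)
    (weightPart (Algebra.lsmul K K M (i d)) : Set M) = ⊤)

include hM

theorem finite_weightSpace (l : K) :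
    FiniteDimensional K ((Algebra.lsmul K K M (i d)).maxGenEigenspace l) := by
  obtain ⟨δ, hδi, hδ, -⟩ := hS.exists_derivation_A
  exact finiteDimensional_maxGenEigenspace hδ (leibniz_lsmul hδi) hM l

theorem exists_finite_cosets : ∃ F : Finset K, ∀ l ∈ weightSet (Algebra.lsmul K K M (i d)),
    ∃ m ∈ F, ∃ k : ℕ, l = m + (k : K) := by
  obtain ⟨δ, hδi, hδ, -⟩ := hS.exists_derivation_A
  exact exists_weights_finite_cosets hδ (leibniz_lsmul hδi) hM

theorem exists_hasSum_weightSpaces [Module.Finite S M] [TopologicalSpace M] [IsModuleTopology S M]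
    (v : M) : ∃ x : K → M, (∀ l, x l ∈ (Algebra.lsmul K K M (i d)).maxGenEigenspace l) ∧
      HasSum x v := by
  obtain ⟨δ, hδi, hδ, -⟩ := hS.exists_derivation_A
  have := hS.noetherian
  have hA : IsModuleTopology (imageClosure i A) M :=
    isModuleTopology_of_finite K (S := S) (imageClosure i A).val continuous_subtype_val
      fun a m => rfl
  exact exists_hasSum_weights hδ hM (leibniz_lsmul hδi) v

theorem weightSum_unique [Module.Finite S M] [TopologicalSpace M] [IsModuleTopology S M]
    {x y : K → M} (hx : ∀ l, x l ∈ (Algebra.lsmul K K M (i d)).maxGenEigenspace l)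
    (hy : ∀ l, y l ∈ (Algebra.lsmul K K M (i d)).maxGenEigenspace l) {v : M} (hs : HasSum x v)
    (hs' : HasSum y v) : x = y := by
  obtain ⟨δ, hδi, hδ, -⟩ := hS.exists_derivation_A
  have := hS.noetherian
  have hA : IsModuleTopology (imageClosure i A) M :=
    isModuleTopology_of_finite K (S := S) (imageClosure i A).val continuous_subtype_val
      fun a m => rfl
  have := IsModuleTopology.topologicalAddGroup S M
  have h := hs.sub hs'
  rw [sub_self] at h
  exact sub_eq_zero.1 (weight_sum_unique hδ (leibniz_lsmul hδi) hM
    (x := x - y) (fun l => Submodule.sub_mem _ (hx l) (hy l)) h)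

theorem weightComponent_mem [Module.Finite S M] [TopologicalSpace M] [IsModuleTopology S M]
    (N : Submodule S M) {v : M} (hv : v ∈ N) {x : K → M}
    (hx : ∀ l, x l ∈ (Algebra.lsmul K K M (i d)).maxGenEigenspace l) (hs : HasSum x v) (l : K) :
    x l ∈ N := by
  obtain ⟨δ, hδi, hδ, -⟩ := hS.exists_derivation_A
  have := hS.noetherian
  have hA : IsModuleTopology (imageClosure i A) M :=
    isModuleTopology_of_finite K (S := S) (imageClosure i A).val continuous_subtype_val
      fun a m => rfl
  exact weight_component_mem hδ (leibniz_lsmul hδi) hM (N.restrictScalars (imageClosure i A))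
    (fun m hm => N.smul_mem (i d) hm) hv hx hs l

theorem injective_of_weights {M' : Type*} [AddCommGroup M'] [Module S M'] (f : M →ₗ[S] M')
    (hinj : ∀ l, ∀ m ∈ (Algebra.lsmul K K M (i d)).maxGenEigenspace l, f m = 0 → m = 0) :
    Function.Injective f := by
  obtain ⟨δ, hδi, hδ, -⟩ := hS.exists_derivation_A
  refine injective_of_injective_on_weights hδ (leibniz_lsmul hδi) hM
    (f.restrictScalars (imageClosure i A)) (fun m hm => ?_) hinj
  change f (i d • m) = 0
  change f m = 0 at hm
  rw [map_smul, hm, smul_zero]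

end Modules

section Extension

variable [IsNoetherianRing (imageClosure i A)] {N : Type u} [AddCommGroup N] [Module R N]
  [Module K N] [IsScalarTower K R N]
  [Module.Finite R N] (hN : IsLocallyNilpotent B d N)
  {P : Type v} [AddCommGroup P] [Module S P] [Module K P]
  [IsScalarTower K S P] {j : N →+ P} (hj : IsScalarExtension i.toRingHom j)

include hj

omit hS [IsNoetherianRing (imageClosure i A)] [Module.Finite R N] [CompleteSpace K]
  [CharZero K] [IsUltrametricDist K] [CompleteSpace S] [IsUltrametricDist S] in
lemma map_smul_field (c : K) (n : N) : j (c • n) = c • j n := by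
  have h := hj.smul (algebraMap K R c) n
  rw [algebraMap_smul] at h
  rw [h]
  change i (algebraMap K R c) • j n = c • j n
  rw [AlgHom.commutes, algebraMap_smul]

omit hS [IsNoetherianRing (imageClosure i A)] [Module.Finite R N] [CompleteSpace K]
  [CharZero K] [IsUltrametricDist K] [CompleteSpace S] [IsUltrametricDist S] in
lemma map_mem_weightSpace {l : K} {n : N}
    (hn : n ∈ (Algebra.lsmul K K N d).maxGenEigenspace l) :
    j n ∈ (Algebra.lsmul K K P (i d)).maxGenEigenspace l := by
  refine map_mem_maxGenEigenspace j (fun m => ?_) hn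
  rw [map_sub, map_smul_field hj]
  congr 1
  exact (hj.smul d m).symm

include hN

theorem finite_extension : Module.Finite (imageClosure i A) P := by
  obtain ⟨ι, _, f, wt, -, h⟩ := hS.exists_weight_generators hN hj
  exact Module.finite_def.2 (Submodule.fg_def.2 ⟨_, Set.finite_range _, h⟩)

theorem span_weightPart_extension :
    Submodule.span (imageClosure i A)
      (weightPart (Algebra.lsmul K K P (i d)) : Set P) = ⊤ := by
  obtain ⟨ι, _, f, wt, hf, h⟩ := hS.exists_weight_generators hN hj
  exact span_weightPart_of_generators (fun q => map_mem_weightSpace hj (hf q)) h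

/-- Weight vectors of the extension of scalars come from the original module. -/
theorem exists_weight_preimage {l : K} {x : P}
    (hx : x ∈ (Algebra.lsmul K K P (i d)).maxGenEigenspace l) :
    ∃ n ∈ (Algebra.lsmul K K N d).maxGenEigenspace l, j n = x := by
  obtain ⟨δ, hδi, hδ, hiff⟩ := hS.exists_derivation_A
  obtain ⟨ι, _, f, wt, hf, h⟩ := hS.exists_weight_generators hN hj
  have hfin := hS.finite_extension hN hj
  rw [maxGenEigenspace_eq_weightSpan hδ (leibniz_lsmul hδi)
    (fun q => map_mem_weightSpace hj (hf q)) h, weightSpan] at hx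
  let jK : N →ₗ[K] P := { j with map_smul' := map_smul_field hj }
  suffices hle : (⨆ q, ⨆ n : {n : ℕ // wt q + n = l}, (δ.eigenspace (n.1 : K)).map
      ((LinearMap.toSpanSingleton (imageClosure i A) P (j (f q))).restrictScalars K)) ≤
      ((Algebra.lsmul K K N d).maxGenEigenspace l).map jK by
    obtain ⟨n, hn, rfl⟩ := hle hx
    exact ⟨n, hn, rfl⟩
  refine iSup_le fun q => iSup_le fun ⟨n, hn⟩ => ?_
  rintro _ ⟨a, ha, rfl⟩
  obtain ⟨c, hc, rfl⟩ := (hiff n a).1 (Module.End.mem_eigenspace_iff.1 ha)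
  refine ⟨(c : R) • f q, ?_, hj.smul _ _⟩
  have := smul_mem_maxGenEigenspace_of_mem_adGrading hc (hf q)
  rwa [Int.cast_natCast, hn] at this

theorem hasWeightDecomposition_extension :
    @HasWeightDecomposition K P _ _ _ (moduleTopology S P) (Algebra.lsmul K K P (i d)) := by
  have hfin := hS.finite_extension hN hj
  have hfinS : Module.Finite S P := Module.Finite.of_restrictScalars_finite (imageClosure i A) S P
  let τ : TopologicalSpace P := moduleTopology S P
  have hτ : IsModuleTopology S P := ⟨rfl⟩
  have hM := hS.span_weightPart_extension hN hj
  obtain ⟨I, hI, -⟩ := hasFiniteTypeWeightDecomposition_of_hasSum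
    (hS.exists_hasSum_weightSpaces hM) (hS.exists_finite_cosets hM) (hS.finite_weightSpace hM)
  exact ⟨I, hI⟩

/-- Extension of scalars is exact on category `𝒪`. -/
theorem injective_extension {N' : Type u} [AddCommGroup N'] [Module R N'] [Module K N']
    [IsScalarTower K R N'] (hN' : IsLocallyNilpotent B d N') {P' : Type*} [AddCommGroup P']
    [Module S P'] {j' : N' →+ P'}
    (hj' : IsScalarExtension i.toRingHom j') (g : N →ₗ[R] N') (hg : Function.Injective g)
    (G : P →ₗ[S] P') (hG : ∀ n, G (j n) = j' (g n)) : Function.Injective G := by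
  have := hS.finite_extension hN hj
  refine hS.injective_of_weights (hS.span_weightPart_extension hN hj) G fun l m hm h0 => ?_
  -- A weight vector of the extension comes from `N`, and on `N` injectivity follows from that of
  -- `g` and from the embedding of `N'` in its extension.
  obtain ⟨n, -, rfl⟩ := hS.exists_weight_preimage hN hj hm
  rw [hG] at h0
  have h1 := hS.injective_of_isScalarExtension hN' hj' (h0.trans (map_zero j').symm)
  rw [hg (h1.trans (map_zero g).symm), map_zero]

end Extension

section WeightPart

variable [IsNoetherianRing (imageClosure i A)] {N : Type u} [AddCommGroup N] [Module R N]
  [Module K N] [IsScalarTower K R N] {M : Type v} [AddCommGroup M] [Module S M] [Module K M]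
  [IsScalarTower K S M] [Module.Finite (imageClosure i A) M]
  (hM : Submodule.span (imageClosure i A)
    (weightPart (Algebra.lsmul K K M (i d)) : Set M) = ⊤)
  {j : N →+ M} (hj : ∀ (r : R) n, j (r • n) = i r • j n) (hinj : Function.Injective j)
  (hrange : ∀ x, x ∈ weightPart (Algebra.lsmul K K M (i d)) ↔ ∃ n, j n = x)

include hM hj hinj hrange

/-- The weight part of a module in `𝒪̂` is finitely generated. -/
theorem finite_weightPart : Module.Finite R N := by
  obtain ⟨δ, hδi, hδ, hiff⟩ := hS.exists_derivation_A
  obtain ⟨s, wt, hs, hspan⟩ := _root_.exists_weight_generators hM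
  choose n hn using fun t : s => (hrange t).1 (Submodule.mem_iSup_of_mem _ (hs t))
  have hle : weightPart (Algebra.lsmul K K M (i d)) ≤
      { carrier := {x | ∃ y ∈ Submodule.span R (Set.range n), j y = x}
        add_mem' := by
          rintro _ _ ⟨x, hx, rfl⟩ ⟨y, hy, rfl⟩
          exact ⟨x + y, add_mem hx hy, map_add j x y⟩
        zero_mem' := ⟨0, zero_mem _, map_zero j⟩
        smul_mem' := by
          rintro c _ ⟨x, hx, rfl⟩
          refine ⟨algebraMap K R c • x, Submodule.smul_mem _ _ hx, ?_⟩
          rw [hj, AlgHom.commutes, algebraMap_smul] } := by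
    refine iSup_le fun l => ?_
    rw [maxGenEigenspace_eq_weightSpan hδ (leibniz_lsmul hδi) hs hspan, weightSpan]
    refine iSup_le fun q => iSup_le fun ⟨k, hk⟩ => ?_
    rintro _ ⟨a, ha, rfl⟩
    obtain ⟨c, hc, rfl⟩ := (hiff k a).1 (Module.End.mem_eigenspace_iff.1 ha)
    refine ⟨(c : R) • n q, Submodule.smul_mem _ _ (Submodule.subset_span ⟨q, rfl⟩), ?_⟩
    rw [hj, hn]
    rfl
  refine Module.finite_def.2 (Submodule.fg_def.2 ⟨_, Set.finite_range n, ?_⟩)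
  rw [eq_top_iff]
  intro x _
  obtain ⟨y, hy, hxy⟩ := hle ((hrange (j x)).2 ⟨x, rfl⟩)
  exact hinj hxy ▸ hy

/-- The algebra `B` acts locally nilpotently on the weight part of a module in `𝒪̂`. -/
theorem isLocallyNilpotent_weightPart : IsLocallyNilpotent B d N := by
  classical
  obtain ⟨F, hF⟩ := hS.exists_finite_cosets hM
  have key : ∀ x ∈ weightPart (Algebra.lsmul K K M (i d)), ∃ n : ℕ, ∀ k : ℕ, n < k → ∀ b ∈ B,
      b ∈ adGrading K d (-(k : ℤ)) → i b • x = 0 := by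
    intro x hx
    rw [weightPart] at hx
    induction hx using Submodule.iSup_induction' with
    | mem l x hx =>
      -- `B_{-k}` lowers the weight `l` by `k`, but the weights lie in finitely many sets `m + ℕ`.
      -- In characteristic zero `k + k' = l - m` is determined, so `k` is bounded for each `m`.
      have hz : ∀ m : K, ∃ z : ℕ, ∀ k k' : ℕ, l - k = m + k' → k ≤ z := by
        intro m
        by_cases h : ∃ k k' : ℕ, l - k = m + k'
        · obtain ⟨k, k', h⟩ := h
          refine ⟨k + k', fun q q' hq => ?_⟩
          have : ((k + k' : ℕ) : K) = ((q + q' : ℕ) : K) := by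
            push_cast
            linear_combination hq - h
          have : k + k' = q + q' := by exact_mod_cast this
          omega
        · exact ⟨0, fun k k' hk => (h ⟨k, k', hk⟩).elim⟩
      choose z hz using hz
      refine ⟨F.sup z, fun k hk b _ hbk => ?_⟩
      have hib : i b ∈ adGrading K (i d) (-(k : ℤ)) := by
        change i d * i b - i b * i d = _
        rw [← map_mul, ← map_mul, ← map_sub, mem_adGrading.1 hbk, map_zsmul]
      have hy := smul_mem_maxGenEigenspace_of_mem_adGrading hib hx
      by_contra hne
      have hl : l + ((-(k : ℤ) : ℤ) : K) ∈ weightSet (Algebra.lsmul K K M (i d)) := by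
        intro hbot
        rw [hbot, Submodule.mem_bot] at hy
        exact hne hy
      obtain ⟨m, hm, k', hk'⟩ := hF _ hl
      have := hz m k k' (by rw [← hk']; push_cast; ring)
      exact absurd (Finset.le_sup (f := z) hm) (by omega)
    | zero => exact ⟨0, fun k _ b _ _ => smul_zero _⟩
    | add x y _ _ hx hy =>
      obtain ⟨n, hn⟩ := hx
      obtain ⟨n', hn'⟩ := hy
      refine ⟨max n n', fun k hk b hb hbk => ?_⟩
      rw [smul_add, hn k (by omega) b hb hbk, hn' k (by omega) b hb hbk, add_zero]
  intro x
  obtain ⟨n, hn⟩ := key (j x) ((hrange (j x)).2 ⟨x, rfl⟩)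
  refine ⟨n, fun k hk b hb hbk => hinj ?_⟩
  rw [hj, hn k hk b hb hbk, map_zero]

/-- A module in `𝒪̂` is the extension of scalars of its weight part. -/
theorem isScalarExtension_weightPart : IsScalarExtension i.toRingHom j := by
  have hfin := hS.finite_weightPart hM hj hinj hrange
  have hN := hS.isLocallyNilpotent_weightPart hM hj hinj hrange
  refine ⟨hj, ?_, ?_⟩
  -- Injectivity is tested on weight vectors of `S ⊗ N`. These come from `N`, which injects into
  -- `M`.
  · have hu := IsScalarExtension.unit i.toRingHom N
    have := hS.finite_extension hN hu
    refine hS.injective_of_weights (hS.span_weightPart_extension hN hu) _ fun l m hm h0 => ?_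
    obtain ⟨n, -, rfl⟩ := hS.exists_weight_preimage hN hu hm
    rw [BaseChange.lift_unit] at h0
    rw [hinj (h0.trans (map_zero j).symm), map_zero]
  · rw [← LinearMap.range_eq_top, eq_top_iff]
    intro x _
    have hx : x ∈ Submodule.span (imageClosure i A)
        (weightPart (Algebra.lsmul K K M (i d)) : Set M) := hM ▸ Submodule.mem_top
    refine (Submodule.span_le (p := (LinearMap.range (BaseChange.lift i.toRingHom j
      hj)).restrictScalars (imageClosure i A))).2 ?_ hx
    intro y hy
    obtain ⟨n, rfl⟩ := (hrange y).1 hy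
    exact ⟨BaseChange.unit _ _ n, BaseChange.lift_unit _ _ _ _⟩

end WeightPart

end IsBanachTriangularDecomposition

end BanachEquivalence

/-! ## Inverse limits along dense transition maps -/

section MittagLeffler

open Filter Topology

variable {E : ℕ → Type*} [∀ n, NormedAddCommGroup (E n)] (f : ∀ n, E (n + 1) →+ E n)

/-- The maximum of the norms of the images in all lower stages. -/
def towerNorm : ∀ n, E n → ℝ
  | 0 => fun x => ‖x‖
  | n + 1 => fun x => max ‖x‖ (towerNorm n (f n x))

lemma norm_le_towerNorm (n : ℕ) (x : E n) : ‖x‖ ≤ towerNorm f n x := by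
  cases n with
  | zero => exact le_rfl
  | succ n => exact le_max_left _ _

/-- The reason for including the lower stages in the norm: the transition maps become nonexpanding,
so geometric bounds survive being pushed down the tower. -/
lemma towerNorm_map_le (n : ℕ) (x : E (n + 1)) : towerNorm f n (f n x) ≤ towerNorm f (n + 1) x :=
  le_max_right _ _

lemma towerNorm_zero (n : ℕ) : towerNorm f n 0 = 0 := by
  induction n with
  | zero => exact norm_zero
  | succ n ih => simp [towerNorm, ih]

lemma continuous_towerNorm (hf : ∀ n, Continuous (f n)) (n : ℕ) : Continuous (towerNorm f n) := by
  induction n with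
  | zero => exact continuous_norm
  | succ n ih => exact continuous_norm.max (ih.comp (hf n))

/-- Along transition maps with dense image, the first derived limit vanishes. -/
theorem exists_map_sub_eq [∀ n, CompleteSpace (E n)] (hf : ∀ n, Continuous (f n))
    (hd : ∀ n, DenseRange (f n)) (y : ∀ n, E n) : ∃ w : ∀ n, E n, ∀ n, f n (w (n + 1)) - w n = y n := by
  have step : ∀ n (a : E n), ∃ b : E (n + 1), towerNorm f n (f n b - a) < (1 / 2) ^ n := by
    intro n a
    have ho : IsOpen {x : E n | towerNorm f n (x - a) < (1 / 2) ^ n} :=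
      isOpen_lt ((continuous_towerNorm f hf n).comp (continuous_sub_right a)) continuous_const
    obtain ⟨b, hb⟩ := (hd n).exists_mem_open ho ⟨a, by simp [towerNorm_zero]⟩
    exact ⟨b, hb⟩
  choose g hg using step
  -- An approximate solution: `f n (u (n + 1))` is within `2 ^ (-n)` of `u n + y n`, and `e n` is
  -- the error.
  let u : ∀ n, E n := fun n => Nat.rec 0 (fun n a => g n (a + y n)) n
  have hu : ∀ n, u (n + 1) = g n (u n + y n) := fun n => rfl
  let e : ∀ n, E n := fun n => f n (u (n + 1)) - (u n + y n)
  have he : ∀ n, towerNorm f n (e n) ≤ (1 / 2) ^ n := fun n => by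
    have := hg n (u n + y n)
    rw [← hu] at this
    exact this.le
  -- Partial sums of the series of the images in `E n` of the errors at all higher stages. The limit
  -- satisfies `v n = e n + f n (v (n + 1))`, and `u + v` is an exact solution.
  let s : ℕ → ∀ n, E n := fun k => Nat.rec (fun n => 0) (fun _ a n => e n + f n (a (n + 1))) k
  have hs : ∀ k n, s (k + 1) n = e n + f n (s k (n + 1)) := fun k n => rfl
  have hdiff : ∀ k n, towerNorm f n (s (k + 1) n - s k n) ≤ (1 / 2) ^ (n + k) := by
    intro k
    induction k with
    | zero =>
      intro n
      have : s 1 n - s 0 n = e n := by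
        change e n + f n 0 - 0 = e n
        rw [map_zero, add_zero, sub_zero]
      rw [zero_add, this]
      exact he n
    | succ k ih =>
      intro n
      rw [hs (k + 1), hs k, add_sub_add_left_eq_sub, ← map_sub]
      refine (towerNorm_map_le f n _).trans ((ih (n + 1)).trans_eq ?_)
      congr 1
      omega
  have hc : ∀ n, CauchySeq fun k => s k n := fun n => by
    refine cauchySeq_of_le_geometric (1 / 2) ((1 / 2) ^ n) (by norm_num) fun k => ?_
    rw [dist_comm, dist_eq_norm, ← pow_add]
    exact (norm_le_towerNorm f n _).trans (hdiff k n)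
  choose v hv using fun n => cauchySeq_tendsto_of_complete (hc n)
  have hve : ∀ n, v n = e n + f n (v (n + 1)) := fun n => by
    refine tendsto_nhds_unique ((tendsto_add_atTop_iff_nat 1).2 (hv n)) ?_
    simp only [hs]
    exact tendsto_const_nhds.add (((hf n).tendsto _).comp (hv (n + 1)))
  refine ⟨fun n => u n + v n, fun n => ?_⟩
  have h1 : f n (u (n + 1)) = e n + (u n + y n) := (sub_add_cancel _ _).symm
  simp only [map_add, h1]
  rw [hve n]
  abel

end MittagLeffler

/-! ### Exactness of scalar extension on free modules and for flat homomorphisms -/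

section Exactness

lemma IsScalarExtension.pi {R S : Type u} [Ring R] [Ring S] (f : R →+* S) (r : ℕ) :
    IsScalarExtension f (f.toAddMonoidHom.compLeft (Fin r)) where
  smul a v := funext fun t => map_mul f a (v t)
  bijective := by
    set j := f.toAddMonoidHom.compLeft (Fin r)
    have hj : ∀ (a : R) v, j (a • v) = f a • j v := fun a v => funext fun t => map_mul f a (v t)
    -- The inverse isomorphism, `z ↦ ∑ z_t ⊗ e_t`.
    let G : (Fin r → S) →+ BaseChange f (Fin r → R) :=
      { toFun := fun z => ∑ t, BaseChange.tmul f (z t) (Pi.single t 1)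
        map_zero' := by simp [BaseChange.zero_tmul]
        map_add' := fun z z' => by
          simp [BaseChange.add_tmul, Finset.sum_add_distrib] }
    refine Function.bijective_iff_has_inverse.2 ⟨G, fun x => ?_, fun z => ?_⟩
    · induction x using BaseChange.induction_on with
      | zero => rw [map_zero, map_zero]
      | add x y hx hy => rw [map_add, map_add, hx, hy]
      | tmul s m =>
        change ∑ t, BaseChange.tmul f ((s • j m) t) (Pi.single t 1) = _
        have : ∀ t, BaseChange.tmul f ((s • j m) t) (Pi.single t 1 : Fin r → R) =
            BaseChange.tmul f s (Pi.single t (m t) : Fin r → R) := fun t => by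
          have h1 : (Pi.single t (m t) : Fin r → R) = m t • Pi.single t 1 := by
            rw [← Pi.single_smul, smul_eq_mul, mul_one]
          rw [h1, BaseChange.tmul_smul]
          rfl
        simp only [this]
        have h2 : ∀ (v : Fin r → Fin r → R), ∑ t, BaseChange.tmul f s (v t) =
            BaseChange.tmul f s (∑ t, v t) := fun v => by
          simp only [← BaseChange.smul_unit, map_sum, Finset.smul_sum]
        rw [h2, Finset.univ_sum_single]
    · change BaseChange.lift f j hj (∑ t, BaseChange.tmul f (z t) (Pi.single t 1)) = z
      rw [map_sum]
      have : ∀ t, BaseChange.lift f j hj (BaseChange.tmul f (z t) (Pi.single t 1)) =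
          Pi.single t (z t) := fun t => by
        rw [← BaseChange.smul_unit, map_smul, BaseChange.lift_unit]
        ext t'
        by_cases h : t' = t
        · subst h
          simp [j]
        · simp [j, h]
      simp only [this]
      exact Finset.univ_sum_single z

/-- Factor `g` through its image. Flatness makes the second factor injective after extension of
scalars, and right exactness computes the kernel of the first. -/
lemma IsRightFlat.ker_le {R S : Type u} [Ring R] [Ring S] {f : R →+* S} (hf : IsRightFlat f)
    {M N : Type u} [AddCommGroup M] [Module R M] [AddCommGroup N] [Module R N]
    {P Q : Type*} [AddCommGroup P] [Module S P] [AddCommGroup Q] [Module S Q] {j : M →+ P}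
    {k : N →+ Q} (hj : IsScalarExtension f j) (hk : IsScalarExtension f k) (g : M →ₗ[R] N)
    (G : P →ₗ[S] Q) (hG : ∀ m, G (j m) = k (g m)) :
    LinearMap.ker G ≤ Submodule.span S (j '' (LinearMap.ker g : Set M)) := by
  have hu := IsScalarExtension.unit f (LinearMap.range g)
  let G₁ : P →ₗ[S] BaseChange f (LinearMap.range g) :=
    hj.desc ((BaseChange.unit f _).comp g.rangeRestrict.toAddMonoidHom) fun r m => by
      change BaseChange.unit f _ (g.rangeRestrict (r • m)) = _
      rw [map_smul, BaseChange.unit_smul]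
      rfl
  have hG₁ : ∀ m, G₁ (j m) = BaseChange.unit f _ (g.rangeRestrict m) := hj.desc_apply _ _
  let G₂ : BaseChange f (LinearMap.range g) →ₗ[S] Q :=
    BaseChange.lift f (k.comp (LinearMap.range g).subtype.toAddMonoidHom) fun r m => hk.smul r m.1
  have hG₂ : ∀ m, G₂ (BaseChange.unit f _ m) = k m.1 := BaseChange.lift_unit f _ _
  have h2 : Function.Injective G₂ := hf.injective_of_isScalarExtension hu hk
    (LinearMap.range g).subtype Subtype.val_injective G₂ hG₂
  have hcomp : G = G₂.comp G₁ := hj.hom_ext fun m => by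
    rw [LinearMap.comp_apply, hG₁, hG₂, hG]
    rfl
  have hle := hj.ker_le hu g.rangeRestrict g.surjective_rangeRestrict G₁ hG₁
  rw [LinearMap.ker_rangeRestrict] at hle
  refine le_trans (fun x hx => ?_) hle
  rw [LinearMap.mem_ker, hcomp, LinearMap.comp_apply] at hx
  exact h2 (hx.trans (map_zero G₂).symm)

end Exactness

/-! ### The Mittag-Leffler argument for submodules of free modules over a Fréchet-Stein algebra -/

section DenseTransitions

/-- A version of the vanishing of the first derived limit for closed subgroups. -/
theorem exists_map_sub_eq_of_isClosed {E : ℕ → Type*} [∀ n, NormedAddCommGroup (E n)]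
    [∀ n, CompleteSpace (E n)] (f : ∀ n, E (n + 1) →+ E n) (hf : ∀ n, Continuous (f n))
    (J : ∀ n, AddSubgroup (E n)) (hJ : ∀ n, IsClosed (J n : Set (E n)))
    (hfJ : ∀ n, ∀ x ∈ J (n + 1), f n x ∈ J n)
    (hd : ∀ n, ∀ x ∈ J n, x ∈ closure (f n '' (J (n + 1) : Set (E (n + 1)))))
    (y : ∀ n, E n) (hy : ∀ n, y n ∈ J n) :
    ∃ w : ∀ n, E n, (∀ n, w n ∈ J n) ∧ ∀ n, f n (w (n + 1)) - w n = y n := by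
  have : ∀ n, CompleteSpace (J n) := fun n => (hJ n).completeSpace_coe
  let g : ∀ n, J (n + 1) →+ J n := fun n =>
    ((f n).comp (J (n + 1)).subtype).codRestrict (J n) fun x => hfJ n x.1 x.2
  have hgc : ∀ n, Continuous (g n) := fun n =>
    ((hf n).comp continuous_subtype_val).subtype_mk _
  have hgd : ∀ n, DenseRange (g n) := fun n y => by
    rw [Topology.IsInducing.subtypeVal.closure_eq_preimage_closure_image, ← Set.range_comp]
    refine closure_mono ?_ (hd n y.1 y.2)
    rintro _ ⟨x, hx, rfl⟩
    exact ⟨⟨x, hx⟩, rfl⟩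
  obtain ⟨w, hw⟩ := exists_map_sub_eq (E := fun n => J n) g hgc hgd fun n => ⟨y n, hy n⟩
  exact ⟨fun n => (w n).1, fun n => (w n).2, fun n => congrArg Subtype.val (hw n)⟩

variable {K : Type w} [NontriviallyNormedField K] {𝓢 : ℕ → Type u} [∀ n, NormedRing (𝓢 n)]
  [∀ n, NormedAlgebra K (𝓢 n)] [∀ n, CompleteSpace (𝓢 n)] {ρ : ∀ n, 𝓢 (n + 1) →ₐ[K] 𝓢 n}

/-- Compatible cosets of submodules with dense transition maps have a common section. -/
theorem exists_section_of_cosets (hρ : IsFrechetStein ρ) {r : ℕ}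
    (J : ∀ n, Submodule (𝓢 n) (Fin r → 𝓢 n))
    (hJ : ∀ n, ∀ x ∈ J (n + 1), (ρ n) ∘ x ∈ J n)
    (hspan : ∀ n, J n ≤ Submodule.span (𝓢 n) ((fun x => (ρ n) ∘ x) '' (J (n + 1) : Set _)))
    (x : ∀ n, Fin r → 𝓢 n) (hx : ∀ n, (ρ n) ∘ x (n + 1) - x n ∈ J n) :
    ∃ z : Fin r → inverseLimit ρ, ∀ n, (fun t => (z t).1 n) - x n ∈ J n := by
  let F : ∀ n, (Fin r → 𝓢 (n + 1)) →+ (Fin r → 𝓢 n) := fun n =>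
    (ρ n : 𝓢 (n + 1) →+ 𝓢 n).compLeft (Fin r)
  have hF : ∀ n x, F n x = ρ n ∘ x := fun n x => rfl
  have hFc : ∀ n, Continuous (F n) := fun n =>
    continuous_pi fun t => (hρ.continuous n).comp (continuous_apply t)
  -- The `J n` are closed by noetherianity. The image of `J (n + 1)` is dense in `J n`: it generates
  -- `J n`, and the coefficients can be approximated from `𝓢 (n + 1)`.
  obtain ⟨w, hwJ, hw⟩ := exists_map_sub_eq_of_isClosed F hFc (fun n => (J n).toAddSubgroup)
    (fun n => by
      have := hρ.noetherian n
      exact isClosed_submodule_pi K (J n))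
    hJ (fun n z hz => by
      have hz' := hspan n hz
      clear hz
      induction hz' using Submodule.span_induction with
      | mem z hz => exact subset_closure hz
      | zero => exact subset_closure ⟨0, zero_mem _, map_zero _⟩
      | add a b _ _ ha hb =>
        refine map_mem_closure₂ continuous_add ha hb ?_
        rintro _ ⟨a, ha, rfl⟩ _ ⟨b, hb, rfl⟩
        exact ⟨a + b, add_mem ha hb, map_add _ _ _⟩
      | smul c a _ ha =>
        refine map_mem_closure₂ continuous_smul (hρ.denseRange n c) ha ?_
        rintro _ ⟨b, rfl⟩ _ ⟨t, ht, rfl⟩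
        exact ⟨b • t, (J (n + 1)).smul_mem b ht, funext fun q => map_mul (ρ n) b (t q)⟩)
    (fun n => x n - ρ n ∘ x (n + 1)) (fun n => by
      rw [← neg_sub]
      exact (J n).neg_mem (hx n))
  have hw' : ∀ n t, ρ n (w (n + 1) t) - w n t = x n t - ρ n (x (n + 1) t) :=
    fun n t => congrFun (hw n) t
  refine ⟨fun t => ⟨fun n => x n t + w n t, fun n => ?_⟩, fun n => ?_⟩
  · have := hw' n t
    rw [sub_eq_iff_eq_add] at this
    change ρ n (x (n + 1) t + w (n + 1) t) = x n t + w n t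
    rw [map_add, this]
    abel
  · have h : (fun t => x n t + w n t) - x n = w n := by
      ext t
      simp
    change (fun t => x n t + w n t) - x n ∈ J n
    rw [h]
    exact hwJ n

end DenseTransitions

/-! ## Extension of scalars to a Fréchet-Stein algebra -/

namespace ModuleSystem

variable {K : Type w} [Field K] {𝓢 : ℕ → Type u} [∀ n, Ring (𝓢 n)] [∀ n, Algebra K (𝓢 n)]
  {ρ : ∀ n, 𝓢 (n + 1) →ₐ[K] 𝓢 n}

/-- The transition maps as homomorphisms of groups. -/
def transHom (X : ModuleSystem ρ) (n : ℕ) : X.obj (n + 1) →+ X.obj n where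
  toFun := X.trans n
  map_zero' := X.trans_zero n
  map_add' := X.trans_add n

lemma isScalarExtension_transHom (X : ModuleSystem ρ) (n : ℕ) :
    IsScalarExtension (ρ n).toRingHom (X.transHom n) where
  smul := X.trans_smul n
  bijective := by
    have hs : ∀ r m, X.transHom n (r • m) = (ρ n).toRingHom r • X.transHom n m := X.trans_smul n
    have h : BaseChange.lift (ρ n).toRingHom (X.transHom n) hs =
        (X.iso n).hom.hom := BaseChange.hom_ext fun s m => by
      rw [← BaseChange.smul_unit, map_smul, BaseChange.lift_unit]
      exact (map_smul (X.iso n).hom.hom s (BaseChange.unit (ρ n).toRingHom _ m)).symm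
    rw [h]
    exact ConcreteCategory.bijective_of_isIso (X.iso n).hom

/-- The inverse limit of a system of modules. -/
def lim (X : ModuleSystem ρ) : ModuleCat.{u} (inverseLimit ρ) := (limitFunctor ρ).obj X

/-- The projection of the inverse limit to a level. -/
def eval (X : ModuleSystem ρ) (n : ℕ) : X.lim →+ X.obj n where
  toFun := fun x : X.sections => x.1 n
  map_zero' := rfl
  map_add' _ _ := rfl

lemma transHom_eval (X : ModuleSystem ρ) (n : ℕ) (x : X.lim) :
    X.transHom n (X.eval (n + 1) x) = X.eval n x := (show X.sections from x).2 n

/-- Compatible families are elements of the limit. -/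
lemma exists_lim (X : ModuleSystem ρ) (x : ∀ n, X.obj n)
    (hx : ∀ n, X.transHom n (x (n + 1)) = x n) : ∃ y : X.lim, ∀ n, X.eval n y = x n :=
  ⟨(⟨x, hx⟩ : X.sections), fun _ => rfl⟩

lemma eval_smul (X : ModuleSystem ρ) (n : ℕ) (r : inverseLimit ρ) (x : X.lim) :
    X.eval n (r • x) = r.1 n • X.eval n x := rfl

lemma lim_ext {X : ModuleSystem ρ} {x y : X.lim} (h : ∀ n, X.eval n x = X.eval n y) : x = y :=
  show (show X.sections from x) = (show X.sections from y) from Subtype.ext (funext h)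

end ModuleSystem

/-- The composition of a homomorphism into an inverse limit with the projection to a level. -/
def levelHom {K : Type w} [Field K] {𝓢 : ℕ → Type u} [∀ n, Ring (𝓢 n)] [∀ n, Algebra K (𝓢 n)]
    {ρ : ∀ n, 𝓢 (n + 1) →ₐ[K] 𝓢 n} {R : Type u} [Ring R] (f : R →+* inverseLimit ρ) (n : ℕ) :
    R →+* 𝓢 n :=
  (Pi.evalRingHom 𝓢 n).comp ((inverseLimit ρ).val.toRingHom.comp f)

section FrechetExtension

variable {K : Type w} [NontriviallyNormedField K] {𝓢 : ℕ → Type u} [∀ n, NormedRing (𝓢 n)]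
  [∀ n, NormedAlgebra K (𝓢 n)] [∀ n, CompleteSpace (𝓢 n)] {ρ : ∀ n, 𝓢 (n + 1) →ₐ[K] 𝓢 n}
  (hρ : IsFrechetStein ρ) {R : Type u} [Ring R] [IsNoetherianRing R] (f : R →+* inverseLimit ρ)

omit [∀ n, CompleteSpace (𝓢 n)] [IsNoetherianRing R] in
lemma levelHom_trans (n : ℕ) (r : R) : ρ n (levelHom f (n + 1) r) = levelHom f n r := (f r).2 n

include hρ

/-- Every compatible family of elements in the submodules generated by finitely many vectors of
`R^r` is a combination of these vectors with coefficients in the limit. -/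
lemma exists_combination_of_levels {r s : ℕ} (k : Fin s → Fin r → R) (z : Fin r → inverseLimit ρ)
    (hz : ∀ n, ∃ c : Fin s → 𝓢 n, ∀ t, (z t).1 n = ∑ q, c q * levelHom f n (k q t)) :
    ∃ c : Fin s → inverseLimit ρ, ∀ t, z t = ∑ q, c q * f (k q t) := by
  let p : ∀ n, (Fin s → 𝓢 n) →ₗ[𝓢 n] (Fin r → 𝓢 n) := fun n =>
    { toFun := fun c t => ∑ q, c q * levelHom f n (k q t)
      map_add' := fun c c' => by
        ext t
        simp [add_mul, Finset.sum_add_distrib]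
      map_smul' := fun a c => by
        ext t
        simp [mul_assoc, Finset.mul_sum] }
  have hp : ∀ n c t, p n c t = ∑ q, c q * levelHom f n (k q t) := fun n c t => rfl
  have hpρ : ∀ n c, p n (ρ n ∘ c) = ρ n ∘ p (n + 1) c := fun n c => by
    ext t
    simp only [Function.comp_apply, hp, map_sum, map_mul, levelHom_trans]
  choose c hc using hz
  have hc' : ∀ n, p n (c n) = fun t => (z t).1 n := fun n => funext fun t => (hc n t).symm
  -- The coefficients chosen at the various levels are compatible only modulo the relations `ker (p
  -- n)`. By flatness the relations at level `n` are generated by those at level `n + 1`, so the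
  -- choices can be corrected.
  obtain ⟨c', hc''⟩ := exists_section_of_cosets hρ (fun n => LinearMap.ker (p n))
    (fun n x hx => by
      rw [LinearMap.mem_ker] at hx ⊢
      rw [hpρ, hx]
      ext t
      exact map_zero (ρ n))
    (fun n => (hρ.flat n).ker_le (IsScalarExtension.pi (ρ n).toRingHom s)
      (IsScalarExtension.pi (ρ n).toRingHom r) (p (n + 1)) (p n) (hpρ n)) c
    (fun n => by
      rw [LinearMap.mem_ker, map_sub, hpρ, hc', hc', sub_eq_zero]
      ext t
      exact (z t).2 n)
  refine ⟨c', fun t => Subtype.ext (funext fun n => ?_)⟩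
  have h1 := hc'' n
  rw [LinearMap.mem_ker, map_sub, hc', sub_eq_zero] at h1
  have h2 := congrFun h1 t
  rw [hp] at h2
  rw [← h2]
  simp only [AddSubmonoidClass.coe_finsetSum, Finset.sum_apply]
  rfl

/-- A finitely presented module commutes with the inverse limit. -/
theorem isScalarExtension_lim {X : ModuleSystem ρ} {N : Type u} [AddCommGroup N] [Module R N]
    [Module.Finite R N] {j : N →+ X.lim}
    (hj : ∀ n, IsScalarExtension (levelHom f n) ((X.eval n).comp j)) :
    IsScalarExtension f j := by
  have hsmul : ∀ (r : R) m, j (r • m) = f r • j m := fun r m =>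
    ModuleSystem.lim_ext fun n => (hj n).smul r m
  obtain ⟨r, q, hq⟩ := Module.Finite.exists_fin' R N
  let e : Fin r → N := fun t => q (Pi.single t 1)
  have hqe : ∀ v, q v = ∑ t, v t • e t := fun v => by
    have : v = ∑ t, v t • (Pi.single t 1 : Fin r → R) := by
      conv_lhs => rw [← Finset.univ_sum_single v]
      refine Finset.sum_congr rfl fun t _ => ?_
      rw [← Pi.single_smul, smul_eq_mul, mul_one]
    conv_lhs => rw [this]
    rw [map_sum]
    exact Finset.sum_congr rfl fun t _ => map_smul _ _ _
  let Q : ∀ n, (Fin r → 𝓢 n) →ₗ[𝓢 n] X.obj n := fun n =>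
    Fintype.linearCombination (𝓢 n) fun t => X.eval n (j (e t))
  have hQ : ∀ n z, Q n z = ∑ t, z t • X.eval n (j (e t)) := fun n z => rfl
  have hQq : ∀ n v, Q n ((levelHom f n).toAddMonoidHom.compLeft (Fin r) v) =
      X.eval n (j (q v)) := fun n v => by
    rw [hQ, hqe, map_sum, map_sum]
    exact Finset.sum_congr rfl fun t _ => ((hj n).smul _ _).symm
  have hQρ : ∀ n z, Q n (ρ n ∘ z) = X.transHom n (Q (n + 1) z) := fun n z => by
    rw [hQ, hQ, map_sum]
    refine Finset.sum_congr rfl fun t _ => ?_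
    rw [← ModuleSystem.transHom_eval]
    exact (X.trans_smul n _ _).symm
  -- Right exactness: the relations of the generators `e t` at every level are generated by their
  -- relations over `R`.
  have hker : ∀ n, LinearMap.ker (Q n) ≤ Submodule.span (𝓢 n)
      ((levelHom f n).toAddMonoidHom.compLeft (Fin r) '' (LinearMap.ker q : Set _)) := fun n =>
    (IsScalarExtension.pi (levelHom f n) r).ker_le (hj n) q hq (Q n) (hQq n)
  refine ⟨hsmul, (injective_iff_map_eq_zero _).2 fun x hx => ?_, fun x => ?_⟩
  · obtain ⟨x, rfl⟩ := BaseChange.map_surjective f hq x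
    obtain ⟨z, rfl⟩ := (IsScalarExtension.pi f r).equiv.symm.surjective x
    have hval : BaseChange.map f q ((IsScalarExtension.pi f r).equiv.symm z) =
        ∑ t, z t • BaseChange.unit f N (e t) := by
      have hz : z = ∑ t, z t • f.toAddMonoidHom.compLeft (Fin r) (Pi.single t 1) := by
        ext t : 1
        rw [Finset.sum_apply, Finset.sum_eq_single t]
        · simp
        · intro t' _ h
          simp [Pi.single_eq_of_ne h.symm]
        · simp
      conv_lhs => rw [hz]
      rw [map_sum, map_sum]
      refine Finset.sum_congr rfl fun t _ => ?_
      rw [map_smul, map_smul, IsScalarExtension.equiv_symm, BaseChange.map_unit]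
    rw [hval] at hx ⊢
    rw [map_sum] at hx
    simp only [map_smul, BaseChange.lift_unit] at hx
    -- Since `R` is noetherian, finitely many relations `k` suffice. A relation `z` over the limit
    -- is levelwise a combination of them, hence a combination over the limit, and so is zero in the
    -- tensor product.
    obtain ⟨s, k, hk⟩ := (Submodule.fg_iff_exists_fin_generating_family).1
      (IsNoetherian.noetherian (LinearMap.ker q))
    have hkq : ∀ t, q (k t) = 0 := fun t => by
      have : k t ∈ LinearMap.ker q := hk ▸ Submodule.subset_span ⟨t, rfl⟩
      exact this
    obtain ⟨c, hc⟩ := exists_combination_of_levels hρ f k z fun n => by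
      have h1 : (fun t => (z t).1 n) ∈ LinearMap.ker (Q n) := by
        rw [LinearMap.mem_ker, hQ]
        have := congrArg (X.eval n) hx
        rw [map_sum, map_zero] at this
        exact this
      have h2 : Submodule.span (𝓢 n)
          ((levelHom f n).toAddMonoidHom.compLeft (Fin r) '' (LinearMap.ker q : Set _)) ≤
          Submodule.span (𝓢 n) (Set.range fun t =>
            (levelHom f n).toAddMonoidHom.compLeft (Fin r) (k t)) := by
        rw [Submodule.span_le]
        rintro _ ⟨v, hv, rfl⟩
        have hv' : v ∈ Submodule.span R (Set.range k) := hk ▸ hv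
        obtain ⟨c, rfl⟩ := (Submodule.mem_span_range_iff_exists_fun R).1 hv'
        rw [map_sum]
        refine Submodule.sum_mem _ fun t _ => ?_
        rw [(IsScalarExtension.pi (levelHom f n) r).smul]
        exact Submodule.smul_mem _ _ (Submodule.subset_span ⟨t, rfl⟩)
      obtain ⟨c, hc⟩ := (Submodule.mem_span_range_iff_exists_fun (𝓢 n)).1 (h2 (hker n h1))
      refine ⟨c, fun t => ?_⟩
      rw [← congrFun hc t, Finset.sum_apply]
      rfl
    simp only [hc, Finset.sum_smul]
    rw [Finset.sum_comm]
    refine Finset.sum_eq_zero fun a _ => ?_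
    simp only [mul_smul, ← BaseChange.unit_smul]
    rw [← Finset.smul_sum, ← map_sum, ← hqe, hkq, map_zero, smul_zero]
  · have hsurj : ∀ n, Function.Surjective (Q n) := fun n => by
      rw [← LinearMap.range_eq_top, eq_top_iff, ← (hj n).span_range, Submodule.span_le]
      rintro _ ⟨m, rfl⟩
      obtain ⟨v, rfl⟩ := hq m
      exact ⟨_, hQq n v⟩
    -- Coefficient vectors chosen level by level are compatible modulo `ker (Q n)`; these kernels
    -- come from `R`, so the cosets have a common section over the limit.
    choose y hy using fun n => hsurj n (X.eval n x)
    obtain ⟨z, hz⟩ := exists_section_of_cosets hρ (fun n => LinearMap.ker (Q n))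
      (fun n v hv => by
        rw [LinearMap.mem_ker] at hv ⊢
        rw [hQρ, hv, map_zero])
      (fun n => (hker n).trans (Submodule.span_mono (by
        rintro _ ⟨v, hv, rfl⟩
        refine ⟨(levelHom f (n + 1)).toAddMonoidHom.compLeft (Fin r) v, ?_, ?_⟩
        · change Q (n + 1) _ = 0
          rw [hQq]
          rw [SetLike.mem_coe, LinearMap.mem_ker] at hv
          rw [hv, map_zero, map_zero]
        · ext t
          exact levelHom_trans f n (v t)))) y
      (fun n => by
        rw [LinearMap.mem_ker, map_sub, hQρ, hy, hy, ModuleSystem.transHom_eval, sub_self])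
    refine ⟨∑ t, z t • BaseChange.unit f N (e t), ModuleSystem.lim_ext fun n => ?_⟩
    rw [map_sum, map_sum]
    simp only [map_smul, BaseChange.lift_unit, ModuleSystem.eval_smul]
    have h1 := hz n
    rw [LinearMap.mem_ker, map_sub, hy, sub_eq_zero] at h1
    exact h1

end FrechetExtension

/-! ## Weight spaces of inverse limits -/

section WeightModule

variable {K : Type w} [Field K] {R : Type u} [Ring R] [Algebra K R] {S : Type v} [Ring S]
  [Algebra K S] (i : R →ₐ[K] S) {d : R}

lemma map_mem_adGrading {r : R} {n : ℤ} (hr : r ∈ adGrading K d n) :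
    i r ∈ adGrading K (i d) n := by
  rw [mem_adGrading] at hr ⊢
  rw [← map_mul, ← map_mul, ← map_sub, hr, map_zsmul]

/-- The weight part of an `S`-module is an `R`-module. -/
lemma exists_weightPart_module (hd : DirectSum.IsInternal (adGrading K d)) (M : Type u)
    [AddCommGroup M] [Module S M] [Module K M] [IsScalarTower K S M] :
    ∃ (N : Type u) (_ : AddCommGroup N) (_ : Module R N) (_ : Module K N)
      (_ : IsScalarTower K R N) (j : N →+ M), (∀ (r : R) n, j (r • n) = i r • j n) ∧
      Function.Injective j ∧
      ∀ x, x ∈ weightPart (Algebra.lsmul K K M (i d)) ↔ ∃ n, j n = x := by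
  let _ : Module R M := Module.compHom M i.toRingHom
  have hr : ∀ (r : R) (m : M), r • m = i r • m := fun _ _ => rfl
  have _ : IsScalarTower K R M := ⟨fun c r m => by rw [hr, hr, map_smul, smul_assoc]⟩
  let N : Submodule R M :=
    { carrier := weightPart (Algebra.lsmul K K M (i d))
      add_mem' := (weightPart (Algebra.lsmul K K M (i d))).add_mem
      zero_mem' := (weightPart (Algebra.lsmul K K M (i d))).zero_mem
      smul_mem' := fun r x hx => by
        have hr' : r ∈ ⨆ n, adGrading K d n := hd.submodule_iSup_eq_top ▸ Submodule.mem_top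
        rw [hr]
        rw [SetLike.mem_coe, weightPart] at hx ⊢
        induction hr' using Submodule.iSup_induction' with
        | mem n r hr' =>
          induction hx using Submodule.iSup_induction' with
          | mem l x hx =>
            exact Submodule.mem_iSup_of_mem (l + (n : K))
              (smul_mem_maxGenEigenspace_of_mem_adGrading (map_mem_adGrading i hr') hx)
          | zero => rw [smul_zero]; exact Submodule.zero_mem _
          | add x y _ _ hx hy => rw [smul_add]; exact Submodule.add_mem _ hx hy
        | zero => rw [map_zero, zero_smul]; exact Submodule.zero_mem _
        | add r s _ _ hr hs => rw [map_add, add_smul]; exact Submodule.add_mem _ hr hs }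
  exact ⟨N, inferInstance, inferInstance, inferInstance, inferInstance,
    N.subtype.toAddMonoidHom, fun r n => rfl, Subtype.val_injective,
    fun x => ⟨fun hx => ⟨⟨x, hx⟩, rfl⟩, fun ⟨n, hn⟩ => hn ▸ n.2⟩⟩

end WeightModule

lemma span_weightPart_of_categoryOHat {K : Type w} [NontriviallyNormedField K] [CompleteSpace K]
    [CharZero K] [IsUltrametricDist K] {R : Type u} [Ring R] [Algebra K R] {S : Type u}
    [NormedRing S] [NormedAlgebra K S] [CompleteSpace S] [IsUltrametricDist S] {i : R →ₐ[K] S}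
    {d : R} {A : Subalgebra K R} [IsNoetherianRing S] [IsNoetherianRing (imageClosure i A)]
    {M : ModuleCat.{u} S} (hM : categoryOHat i A d M) : Submodule.span (imageClosure i A)
      (weightPart (Algebra.lsmul K K M (i d)) : Set M) = ⊤ := by
  have := hM.1
  have := hM.2.1
  exact IsWeightDerivation.span_weightPart_eq_top hM.2.2

/-! ### Constancy of the weight spaces along the tower -/

section LimitWeights

variable {K : Type w} [NontriviallyNormedField K] [CompleteSpace K] [CharZero K]
  [IsUltrametricDist K] {𝓡 : ℕ → Type u} [∀ n, NormedRing (𝓡 n)] [∀ n, NormedAlgebra K (𝓡 n)]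
  [∀ n, CompleteSpace (𝓡 n)] [∀ n, IsUltrametricDist (𝓡 n)] {ρ : ∀ n, 𝓡 (n + 1) →ₐ[K] 𝓡 n}
  (hρ : IsFrechetStein ρ) {R : Subalgebra K (inverseLimit ρ)} {A B H : Subalgebra K R} {d : R}
  (hR : IsFrechetTriangularDecomposition R A B H d)
  (hA : ∀ n, IsNoetherianRing (levelClosure R A n))
  {X : ModuleSystem ρ} (hX : limitO R A d X)

lemma toLevel_trans (n : ℕ) :
    (ρ n).toRingHom.comp (toLevel R (n + 1)).toRingHom = (toLevel R n).toRingHom :=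
  RingHom.ext fun r => r.1.2 n

namespace ModuleSystem

/-- The action of an element of the dense subalgebra on a level. -/
abbrev levelEnd (X : ModuleSystem ρ) (d : R) (n : ℕ) : Module.End K (X.obj n) :=
  Algebra.lsmul K K (X.obj n) (toLevel R n d)

/-- The action of an element of the dense subalgebra on the limit. -/
abbrev limitEnd (X : ModuleSystem ρ) (d : R) : Module.End K X.lim :=
  Algebra.lsmul K K X.lim (d : inverseLimit ρ)

/-- The projection to a level as a linear map over the base field. -/
def evalLinear (X : ModuleSystem ρ) (n : ℕ) : X.lim →ₗ[K] X.obj n where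
  toFun := X.eval n
  map_add' := (X.eval n).map_add
  map_smul' _ _ := rfl

/-- The transition map as a linear map over the base field. -/
def transLinear (X : ModuleSystem ρ) (n : ℕ) : X.obj (n + 1) →ₗ[K] X.obj n where
  toFun := X.transHom n
  map_add' := (X.transHom n).map_add
  map_smul' c x := by
    have := X.trans_smul n (algebraMap K _ c) x
    rw [AlgHom.commutes] at this
    exact this

lemma transLinear_smul (X : ModuleSystem ρ) (n : ℕ) (r : R) (x : X.obj (n + 1)) :
    X.transLinear n (toLevel R (n + 1) r • x) = toLevel R n r • X.transLinear n x := by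
  have h : ρ n (toLevel R (n + 1) r) = toLevel R n r := r.1.2 n
  rw [← h]
  exact X.trans_smul n _ x

lemma eval_mem_weightSpace {n : ℕ} {l : K} {x : X.lim}
    (hx : x ∈ (X.limitEnd d).maxGenEigenspace l) :
    X.eval n x ∈ (X.levelEnd d n).maxGenEigenspace l :=
  map_mem_maxGenEigenspace_of_comm (X.evalLinear n) (fun _ => rfl) hx

lemma trans_mem_weightSpace {n : ℕ} {l : K} {x : X.obj (n + 1)}
    (hx : x ∈ (X.levelEnd d (n + 1)).maxGenEigenspace l) :
    X.trans n x ∈ (X.levelEnd d n).maxGenEigenspace l :=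
  map_mem_maxGenEigenspace_of_comm (X.transLinear n)
    (fun m => (X.transLinear_smul n d m).symm) hx

lemma eval_mem_weightPart {n : ℕ} {x : X.lim} (hx : x ∈ weightPart (X.limitEnd d)) :
    X.eval n x ∈ weightPart (X.levelEnd d n) := by
  suffices h : weightPart (X.limitEnd d) ≤
      (weightPart (X.levelEnd d n)).comap (X.evalLinear n) from h hx
  exact iSup_le fun l x hx => Submodule.mem_iSup_of_mem l (eval_mem_weightSpace hx)

end ModuleSystem

include hρ hA hX

lemma limitO_span_weightPart (n : ℕ) : Submodule.span (levelClosure R A n)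
    (weightPart (X.levelEnd d n) : Set (X.obj n)) = ⊤ := by
  have := hρ.noetherian n
  have := hA n
  have hXn : categoryOHat (toLevel R n) A d (X.obj n) := hX n
  have := span_weightPart_of_categoryOHat hXn
  exact this

include hR

/-- By transitivity of extension of scalars, the weight part of the level `n + 1` is a model for
both levels. The comparison of weight spaces of adjacent levels rests on this. -/
lemma exists_weightPart_level (n : ℕ) : ∃ (N : Type u) (_ : AddCommGroup N) (_ : Module R N)
    (_ : Module K N) (_ : IsScalarTower K R N) (j : N →+ X.obj (n + 1)),
    Function.Injective j ∧
    (∀ x, x ∈ weightPart (X.levelEnd d (n + 1)) ↔ ∃ n, j n = x) ∧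
    IsLocallyNilpotent B d N ∧ Module.Finite R N ∧
    IsScalarExtension (R := R) (S := 𝓡 (n + 1)) (toLevel R (n + 1)).toRingHom j ∧
    IsScalarExtension (R := R) (S := 𝓡 n) (toLevel R n).toRingHom ((X.transHom n).comp j) := by
  have := hA (n + 1)
  have := (hX (n + 1)).2.1
  have hM := limitO_span_weightPart hρ hA hX (n + 1)
  obtain ⟨N, _, _, _, _, j, hj, hinj, hrange⟩ := exists_weightPart_module (toLevel R (n + 1))
    (hR.level 0).algebraic.grading (X.obj (n + 1))
  have hSE := (hR.level (n + 1)).isScalarExtension_weightPart hM hj hinj hrange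
  refine ⟨N, _, _, _, inferInstance, j, hinj, hrange,
    (hR.level (n + 1)).isLocallyNilpotent_weightPart hM hj hinj hrange,
    (hR.level (n + 1)).finite_weightPart hM hj hinj hrange, hSE, ?_⟩
  rw [← toLevel_trans]
  exact hSE.comp (X.isScalarExtension_transHom n)

/-- The weight part of level `n + 1` lies in `𝒪` and level `n` is its extension of scalars, in which
it embeds. -/
lemma trans_injective_weightPart {n : ℕ} {x : X.obj (n + 1)}
    (hx : x ∈ weightPart (X.levelEnd d (n + 1)))
    (h0 : X.trans n x = 0) : x = 0 := by
  obtain ⟨N, _, _, _, _, j, hinj, hrange, hnil, _, -, hSE⟩ :=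
    exists_weightPart_level hρ hR hA hX n
  obtain ⟨y, rfl⟩ := (hrange x).1 hx
  have := hA n
  rw [(hR.level n).injective_of_isScalarExtension hnil hSE (h0.trans (map_zero _).symm), map_zero]

lemma exists_trans_preimage {n : ℕ} {l : K} {y : X.obj n}
    (hy : y ∈ (X.levelEnd d n).maxGenEigenspace l) :
    ∃ x ∈ (X.levelEnd d (n + 1)).maxGenEigenspace l,
      X.trans n x = y := by
  obtain ⟨N, _, _, _, _, j, hinj, hrange, hnil, _, hSE, hSE'⟩ :=
    exists_weightPart_level hρ hR hA hX n
  have := hA n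
  obtain ⟨m, hm, rfl⟩ := (hR.level n).exists_weight_preimage hnil hSE' hy
  exact ⟨j m, IsBanachTriangularDecomposition.map_mem_weightSpace hSE hm, rfl⟩

/-- Vanishing at one level descends to level `0` and climbs back to all levels, since the
transitions are injective on weight parts. -/
lemma eq_zero_of_eval_eq_zero {n : ℕ} {x : X.lim}
    (hx : x ∈ weightPart
      (X.limitEnd d))
    (h0 : X.eval n x = 0) : x = 0 := by
  have hdown : ∀ m, X.eval m x = 0 → X.eval 0 x = 0 := by
    intro m
    induction m with
    | zero => exact id
    | succ m ih =>
      intro h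
      refine ih ?_
      rw [← X.transHom_eval, h, map_zero]
  have hup : ∀ m, X.eval m x = 0 := by
    intro m
    induction m with
    | zero => exact hdown n h0
    | succ m ih =>
      exact trans_injective_weightPart hρ hR hA hX (ModuleSystem.eval_mem_weightPart hx)
        ((X.transHom_eval m x).trans ih)
  exact ModuleSystem.lim_ext fun m => (hup m).trans (map_zero (X.eval m)).symm

lemma exists_section_of_weightSpace {n : ℕ} {l : K} {y : X.obj n}
    (hy : y ∈ (X.levelEnd d n).maxGenEigenspace l) :
    ∃ x ∈ (X.limitEnd d).maxGenEigenspace l, X.eval n x = y := by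
  induction n with
  | zero =>
    let E : ℕ → Type u := fun n => (X.levelEnd d n).maxGenEigenspace l
    have hE : ∀ n (a : E n), ∃ b : E (n + 1), X.trans n b.1 = a.1 := fun n a => by
      obtain ⟨x, hx, h⟩ := exists_trans_preimage hρ hR hA hX a.2
      exact ⟨⟨x, hx⟩, h⟩
    choose g hg using hE
    let s : ∀ n, E n := fun n => Nat.rec ⟨y, hy⟩ (fun n a => g n a) n
    obtain ⟨x, hx⟩ := X.exists_lim (fun n => (s n).1) fun n => hg n (s n)
    refine ⟨x, ?_, hx 0⟩
    obtain ⟨k, hk⟩ := (Module.End.mem_maxGenEigenspace _ _ _).1 hy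
    refine (Module.End.mem_maxGenEigenspace _ _ _).2 ⟨k, ?_⟩
    -- The lift was chosen one level at a time, with exponents of nilpotency that could grow. The
    -- exponent `k` of level `0` works for all of them: `(d - l) ^ k x` has zero component at level
    -- `0`, and transitions are injective on weight parts.
    have hev : ∀ n (z : X.lim),
        X.eval n (((X.limitEnd d - l • (1 : Module.End K X.lim)) ^ k) z) =
        ((X.levelEnd d n - l • (1 : Module.End K (X.obj n))) ^ k) (X.eval n z) := fun n z =>
      (intertwine_pow (D := X.limitEnd d) (D' := X.levelEnd d n) (X.eval n) (fun m => rfl)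
        k z).symm
    have hmem : ∀ n, X.eval n (((X.limitEnd d - l • (1 : Module.End K X.lim)) ^ k) x) ∈
        weightPart (X.levelEnd d n) := fun n => by
      rw [hev, hx]
      refine Submodule.mem_iSup_of_mem l ?_
      exact Module.End.mapsTo_maxGenEigenspace_of_comm
        (((Commute.refl (X.levelEnd d n)).sub_right (Algebra.commutes l _).symm).pow_right k) l
        (s n).2
    refine ModuleSystem.lim_ext fun n => ?_
    rw [map_zero]
    induction n with
    | zero => rw [hev, hx]; exact hk
    | succ n ih =>
      exact trans_injective_weightPart hρ hR hA hX (hmem (n + 1)) ((X.transHom_eval n _).trans ih)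
  | succ n ih =>
    -- Lift the image of `y` one level below; at level `n + 1` the lift and `y` are weight vectors
    -- with the same image, hence equal.
    obtain ⟨x, hx, h⟩ := ih (ModuleSystem.trans_mem_weightSpace hy)
    refine ⟨x, hx, ?_⟩
    rw [← sub_eq_zero]
    refine trans_injective_weightPart hρ hR hA hX (Submodule.sub_mem _
      (ModuleSystem.eval_mem_weightPart (Submodule.mem_iSup_of_mem l hx))
      (Submodule.mem_iSup_of_mem l hy)) ?_
    change X.transHom n (X.eval (n + 1) x - y) = 0
    rw [map_sub, X.transHom_eval, h]
    exact sub_self _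

section WeightPart

variable {N : Type u} [AddCommGroup N] [Module R N] [Module K N] [IsScalarTower K R N]
  {j : N →+ X.lim} (hj : ∀ (r : R) n, j (r • n) = (r : inverseLimit ρ) • j n)
  (hinj : Function.Injective j)
  (hrange : ∀ x : X.lim, x ∈ weightPart
    (X.limitEnd d) ↔ ∃ n, j n = x)

include hj hinj hrange

/-- The weight part of the limit projects isomorphically onto that of each level, so the results for
a Banach level apply to the single module `N`. -/
lemma weightPart_level (n : ℕ) : (∀ (r : R) m, (X.eval n).comp j (r • m) =
      toLevel R n r • (X.eval n).comp j m) ∧ Function.Injective ((X.eval n).comp j) ∧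
    ∀ x, x ∈ weightPart (X.levelEnd d n) ↔
      ∃ m, (X.eval n).comp j m = x := by
  refine ⟨fun r m => ?_, (injective_iff_map_eq_zero _).2 fun m hm => ?_, fun x => ⟨fun hx => ?_, ?_⟩⟩
  · rw [AddMonoidHom.comp_apply, hj]
    rfl
  · have := eq_zero_of_eval_eq_zero hρ hR hA hX ((hrange (j m)).2 ⟨m, rfl⟩) hm
    exact hinj (this.trans (map_zero j).symm)
  · rw [weightPart] at hx
    induction hx using Submodule.iSup_induction' with
    | mem l x hx =>
      obtain ⟨y, hy, rfl⟩ := exists_section_of_weightSpace hρ hR hA hX hx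
      obtain ⟨m, rfl⟩ := (hrange y).1 (Submodule.mem_iSup_of_mem l hy)
      exact ⟨m, rfl⟩
    | zero => exact ⟨0, map_zero _⟩
    | add x y _ _ hx hy =>
      obtain ⟨a, rfl⟩ := hx
      obtain ⟨b, rfl⟩ := hy
      exact ⟨a + b, map_add _ _ _⟩
  · rintro ⟨m, rfl⟩
    exact ModuleSystem.eval_mem_weightPart ((hrange (j m)).2 ⟨m, rfl⟩)

theorem isScalarExtension_weightPart_level (n : ℕ) :
    IsScalarExtension (R := R) (S := 𝓡 n) (toLevel R n).toRingHom ((X.eval n).comp j) := by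
  obtain ⟨h1, h2, h3⟩ := weightPart_level hρ hR hA hX hj hinj hrange n
  have := hA n
  have := (hX n).2.1
  exact (hR.level n).isScalarExtension_weightPart (limitO_span_weightPart hρ hA hX n) h1 h2 h3

theorem finite_weightPart_limit : Module.Finite R N := by
  obtain ⟨h1, h2, h3⟩ := weightPart_level hρ hR hA hX hj hinj hrange 0
  have := hA 0
  have := (hX 0).2.1
  exact (hR.level 0).finite_weightPart (limitO_span_weightPart hρ hA hX 0) h1 h2 h3

theorem isLocallyNilpotent_weightPart_limit : IsLocallyNilpotent B d N := by
  obtain ⟨h1, h2, h3⟩ := weightPart_level hρ hR hA hX hj hinj hrange 0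
  have := hA 0
  have := (hX 0).2.1
  exact (hR.level 0).isLocallyNilpotent_weightPart (limitO_span_weightPart hρ hA hX 0) h1 h2 h3

/-- The limit is the extension of scalars of its weight part. -/
theorem isScalarExtension_weightPart_limit : IsScalarExtension (R := R) (S := inverseLimit ρ) R.val.toRingHom j := by
  have := finite_weightPart_limit hρ hR hA hX hj hinj hrange
  have := (hR.level 0).algebraic.noetherian
  have h : ∀ n, IsScalarExtension (levelHom (R := R) R.val.toRingHom n) ((X.eval n).comp j) :=
    isScalarExtension_weightPart_level hρ hR hA hX hj hinj hrange
  exact isScalarExtension_lim hρ (R := R) R.val.toRingHom h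

end WeightPart

end LimitWeights

/-! ## The Fréchet topology on inverse limits -/

section Frechet

open Topology

variable {K : Type w} [NontriviallyNormedField K]

lemma isFrechetSpace_of_finite [IsUltrametricDist K] (S : Type u) [NormedRing S]
    [NormedAlgebra K S] [CompleteSpace S] [IsUltrametricDist S] [IsNoetherianRing S] (M : Type v)
    [AddCommGroup M] [Module S M] [Module K M] [IsScalarTower K S M] [Module.Finite S M]
    [TopologicalSpace M] [IsModuleTopology S M] : IsFrechetSpace K M := by
  have hadd := IsModuleTopology.topologicalAddGroup S M
  obtain ⟨r, W, hW, ⟨e⟩⟩ := exists_continuousLinearEquiv_banach (S := S) (M := M) K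
  have : IsClosed ((W.toAddSubgroup : AddSubgroup (Fin r → S)) : Set (Fin r → S)) := hW
  let _ : MetricSpace ((Fin r → S) ⧸ W) :=
    (inferInstance : NormedAddCommGroup ((Fin r → S) ⧸ W)).toMetricSpace
  refine ⟨hadd, continuousSMul_of_isModuleTopology K S, ?_, fun U hU =>
    exists_openAddSubgroup_of_finite (S := S) K hU, ?_⟩
  · exact e.toHomeomorph.isEmbedding.metrizableSpace
  · let _ : UniformSpace M := IsTopologicalAddGroup.rightUniformSpace M
    have : IsUniformAddGroup M := isUniformAddGroup_of_addCommGroup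
    have he : IsUniformEmbedding e :=
      AddMonoidHom.isUniformEmbedding_of_isEmbedding e.toHomeomorph.isEmbedding
    exact (completeSpace_congr (e := e.toEquiv) he).2 inferInstance

/-- Every defining property passes to countable products and to closed subspaces. The lattices are
finite intersections of pulled back lattices. -/
lemma isFrechetSpace_of_isClosedEmbedding {ι : Type*} [Countable ι] {E : ι → Type*}
    [∀ i, AddCommGroup (E i)] [∀ i, Module K (E i)] [∀ i, TopologicalSpace (E i)]
    (hE : ∀ i, IsFrechetSpace K (E i)) {V : Type*} [AddCommGroup V] [Module K V]
    [TopologicalSpace V] (φ : V →ₗ[K] ∀ i, E i) (hφ : IsClosedEmbedding φ) :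
    IsFrechetSpace K V := by
  have h1 := fun i => (hE i).isTopologicalAddGroup
  have h2 := fun i => (hE i).continuousSMul
  have h3 := fun i => (hE i).metrizable
  have hadd : IsTopologicalAddGroup V := by
    rw [hφ.isInducing.eq_induced]
    exact topologicalAddGroup_induced φ
  have hmet : TopologicalSpace.MetrizableSpace (∀ i, E i) := by
    let _ : ∀ i, MetricSpace (E i) := fun i => TopologicalSpace.metrizableSpaceMetric (E i)
    exact UniformSpace.metrizableSpace
  refine ⟨hadd, ?_, hφ.isEmbedding.metrizableSpace, fun U hU => ?_, ?_⟩
  · rw [hφ.isInducing.eq_induced]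
    exact continuousSMul_induced φ
  · rw [hφ.isInducing.nhds_eq_comap, map_zero, Filter.mem_comap] at hU
    obtain ⟨W, hW, hWU⟩ := hU
    rw [nhds_pi, Filter.mem_pi] at hW
    obtain ⟨I, hI, t, ht, htW⟩ := hW
    choose L hL hLt hLK using fun i => (hE i).locallyConvex (t i) (ht i)
    let P : AddSubgroup V := ⨅ i ∈ I, (L i).comap
      ((Pi.evalAddMonoidHom E i).comp φ.toAddMonoidHom)
    have hP : ∀ x, x ∈ P ↔ ∀ i ∈ I, φ x i ∈ L i := fun x => by
      simp only [P, AddSubgroup.mem_iInf, AddSubgroup.mem_comap]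
      rfl
    refine ⟨P, ?_, fun x hx => hWU (htW fun i hi => hLt i ((hP x).1 hx i hi)), fun c hc x hx => ?_⟩
    · have : (P : Set V) = ⋂ i ∈ I, (fun x => φ x i) ⁻¹' (L i) := by
        ext x
        rw [SetLike.mem_coe, hP]
        simp
      rw [this, Filter.biInter_mem hI]
      intro i _
      refine ((continuous_apply i).comp hφ.continuous).continuousAt ?_
      simp only [Function.comp_apply, map_zero, Pi.zero_apply]
      exact hL i
    · rw [hP] at hx ⊢
      intro i hi
      rw [map_smul]
      exact hLK i c hc _ (hx i hi)
  · let _ : ∀ i, UniformSpace (E i) := fun i => IsTopologicalAddGroup.rightUniformSpace (E i)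
    let _ : UniformSpace V := IsTopologicalAddGroup.rightUniformSpace V
    have : ∀ i, IsUniformAddGroup (E i) := fun i => isUniformAddGroup_of_addCommGroup
    have : IsUniformAddGroup V := isUniformAddGroup_of_addCommGroup
    have : ∀ i, CompleteSpace (E i) := fun i => (hE i).complete
    have he : IsUniformInducing φ :=
      AddMonoidHom.isUniformInducing_of_isInducing hφ.isInducing
    exact (completeSpace_iff_isComplete_range he).2 hφ.isClosed_range.isComplete

end Frechet

/-! ### The inverse limit topology and weight expansions in the limit -/

section LimitTopology

open Topology

variable {K : Type w} [NontriviallyNormedField K] [CompleteSpace K] [CharZero K]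
  [IsUltrametricDist K] {𝓡 : ℕ → Type u} [∀ n, NormedRing (𝓡 n)] [∀ n, NormedAlgebra K (𝓡 n)]
  [∀ n, CompleteSpace (𝓡 n)] [∀ n, IsUltrametricDist (𝓡 n)] {ρ : ∀ n, 𝓡 (n + 1) →ₐ[K] 𝓡 n}

namespace ModuleSystem

instance (X : ModuleSystem ρ) (n : ℕ) : TopologicalSpace (X.obj n) :=
  moduleTopology (𝓡 n) (X.obj n)

instance (X : ModuleSystem ρ) (n : ℕ) : IsModuleTopology (𝓡 n) (X.obj n) := ⟨rfl⟩

instance (X : ModuleSystem ρ) : TopologicalSpace X.lim := X.limitTopology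

/-- The embedding of the limit in the product. -/
def evalPi (X : ModuleSystem ρ) : X.lim →ₗ[K] ∀ n, X.obj n := LinearMap.pi X.evalLinear

lemma isInducing_evalPi (X : ModuleSystem ρ) : IsInducing X.evalPi := ⟨by
  change X.limitTopology = _
  rw [Pi.topologicalSpace, induced_iInf]
  refine iInf_congr fun n => ?_
  rw [induced_compose]
  rfl⟩

lemma continuous_eval (X : ModuleSystem ρ) (n : ℕ) : Continuous (X.eval n) :=
  (continuous_apply n).comp X.isInducing_evalPi.continuous

lemma hasSum_lim {X : ModuleSystem ρ} {ι : Type*} {x : ι → X.lim} {v : X.lim}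
    (h : ∀ n, HasSum (fun l => X.eval n (x l)) (X.eval n v)) : HasSum x v := by
  have h1 : HasSum (X.evalPi ∘ x) (X.evalPi v) := Pi.hasSum.2 h
  exact (X.isInducing_evalPi.hasSum_iff x v).1 h1

lemma continuous_transHom (hρ : IsFrechetStein ρ) (X : ModuleSystem ρ) (n : ℕ) :
    Continuous (X.transHom n) := by
  have := IsModuleTopology.topologicalAddGroup (𝓡 n) (X.obj n)
  let φ : X.obj (n + 1) →ₛₗ[(ρ n).toRingHom] X.obj n :=
    { toFun := X.transHom n
      map_add' := (X.transHom n).map_add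
      map_smul' := X.trans_smul n }
  exact IsModuleTopology.continuous_of_linearMapₛₗ (σ := (ρ n).toRingHom) (hρ.continuous n) φ

lemma isClosedEmbedding_evalPi (hρ : IsFrechetStein ρ) {X : ModuleSystem ρ}
    (hX : ∀ n, Module.Finite (𝓡 n) (X.obj n)) : IsClosedEmbedding X.evalPi := by
  refine ⟨⟨X.isInducing_evalPi, fun x y h => lim_ext fun n => congrFun h n⟩, ?_⟩
  -- The limit is cut out of the product by equalities of continuous maps into Hausdorff spaces.
  have : Set.range X.evalPi = ⋂ n, {x | X.transHom n (x (n + 1)) = x n} := by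
    ext x
    simp only [Set.mem_range, Set.mem_iInter, Set.mem_ofPred_eq]
    constructor
    · rintro ⟨y, rfl⟩ n
      exact X.transHom_eval n y
    · intro hx
      obtain ⟨y, hy⟩ := X.exists_lim x hx
      exact ⟨y, funext hy⟩
  rw [this]
  refine isClosed_iInter fun n => ?_
  have := hρ.noetherian n
  have : T2Space (X.obj n) := t2Space_of_finite K (𝓡 n)
  exact isClosed_eq ((X.continuous_transHom hρ n).comp (continuous_apply _)) (continuous_apply _)

theorem isFrechetSpace_lim (hρ : IsFrechetStein ρ) {X : ModuleSystem ρ}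
    (hX : ∀ n, Module.Finite (𝓡 n) (X.obj n)) : IsFrechetSpace K X.lim :=
  isFrechetSpace_of_isClosedEmbedding (fun n =>
    have := hρ.noetherian n
    have := hX n
    isFrechetSpace_of_finite (𝓡 n) (X.obj n)) X.evalPi (X.isClosedEmbedding_evalPi hρ hX)

/-- The closure of a subset of the limit can be tested at all levels. -/
lemma mem_closure_of_eval (hρ : IsFrechetStein ρ) {X : ModuleSystem ρ} {N : Set X.lim} {y : X.lim}
    (h : ∀ n, X.eval n y ∈ closure (X.eval n '' N)) : y ∈ closure N := by
  rw [mem_closure_iff_nhds]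
  intro U hU
  have hn : 𝓝 y = ⨅ n, (𝓝 (X.eval n y)).comap (X.eval n) := by
    rw [X.isInducing_evalPi.nhds_eq_comap, nhds_pi, Filter.pi, Filter.comap_iInf]
    refine iInf_congr fun n => ?_
    rw [Filter.comap_comap]
    rfl
  rw [hn, Filter.mem_iInf_of_directed] at hU
  · obtain ⟨n, V, hV, hVU⟩ := hU
    obtain ⟨_, hz, x, hx, rfl⟩ := mem_closure_iff_nhds.1 (h n) V hV
    exact ⟨x, hVU hz, hx⟩
  -- The pulled back neighbourhood filters decrease with `n`, because the projection to level `n`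
  -- factors continuously through level `n + 1`; a neighbourhood therefore comes from a single
  -- level.
  · refine directed_of_isDirected_le ?_
    refine antitone_nat_of_succ_le fun n => ?_
    have : (X.eval n : X.lim → X.obj n) = X.transHom n ∘ X.eval (n + 1) :=
      funext fun x => (X.transHom_eval n x).symm
    conv_rhs => rw [this]
    rw [← Filter.comap_comap]
    refine Filter.comap_mono ?_
    rw [← Filter.map_le_iff_le_comap]
    exact (X.continuous_transHom hρ n).continuousAt

end ModuleSystem

variable (hρ : IsFrechetStein ρ) {R : Subalgebra K (inverseLimit ρ)} {A B H : Subalgebra K R}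
  {d : R} (hR : IsFrechetTriangularDecomposition R A B H d)
  (hA : ∀ n, IsNoetherianRing (levelClosure R A n))
  {X : ModuleSystem ρ} (hX : limitO R A d X)

include hρ hR hA hX

/-- Expand `v` at each level. Uniqueness of weight sums makes the expansions compatible, and weight
vectors of level `0` lift uniquely to the limit. -/
theorem exists_hasSum_levels (v : X.lim) : ∃ x : K → X.lim,
    (∀ l, x l ∈ (X.limitEnd d).maxGenEigenspace l) ∧
    ∀ n, HasSum (fun l => X.eval n (x l)) (X.eval n v) := by
  have hfin : ∀ n, Module.Finite (𝓡 n) (X.obj n) := fun n => (hX n).1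
  have hfinA : ∀ n, Module.Finite (levelClosure R A n) (X.obj n) := fun n => (hX n).2.1
  have hM := limitO_span_weightPart hρ hA hX
  choose x hx hs using fun n => (hR.level n).exists_hasSum_weightSpaces (hM n) (X.eval n v)
  have htr : ∀ n l, X.transHom n (x (n + 1) l) = x n l := by
    intro n
    have h1 : HasSum (fun l => X.transHom n (x (n + 1) l)) (X.eval n v) := by
      have := (hs (n + 1)).map (X.transHom n) (X.continuous_transHom hρ n)
      rwa [X.transHom_eval] at this
    exact congrFun ((hR.level n).weightSum_unique (hM n)
      (fun l => ModuleSystem.trans_mem_weightSpace (hx (n + 1) l)) (hx n) h1 (hs n))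
  choose y hy hy0 using fun l => exists_section_of_weightSpace hρ hR hA hX (hx 0 l)
  have hyn : ∀ n l, X.eval n (y l) = x n l := by
    intro n l
    induction n with
    | zero => exact hy0 l
    | succ n ih =>
      rw [← sub_eq_zero]
      refine trans_injective_weightPart hρ hR hA hX (Submodule.sub_mem _
        (ModuleSystem.eval_mem_weightPart (Submodule.mem_iSup_of_mem l (hy l)))
        (Submodule.mem_iSup_of_mem l (hx (n + 1) l))) ?_
      change X.transHom n _ = 0
      rw [map_sub, X.transHom_eval, ih, htr, sub_self]
  refine ⟨y, hy, fun n => ?_⟩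
  simp only [hyn]
  exact hs n

theorem hasFiniteTypeWeightDecomposition_lim :
    HasFiniteTypeWeightDecomposition (X.limitEnd d) := by
  have := (hX 0).2.1
  have hM := limitO_span_weightPart hρ hA hX 0
  refine hasFiniteTypeWeightDecomposition_of_hasSum (fun v => ?_) ?_ fun l => ?_
  · obtain ⟨x, hx, hs⟩ := exists_hasSum_levels hρ hR hA hX v
    exact ⟨x, hx, ModuleSystem.hasSum_lim hs⟩
  · obtain ⟨F, hF⟩ := (hR.level 0).exists_finite_cosets hM
    refine ⟨F, fun l hl => hF l fun hbot => hl ?_⟩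
    rw [eq_bot_iff]
    intro x hx
    have h0 := ModuleSystem.eval_mem_weightSpace (n := 0) hx
    rw [hbot, Submodule.mem_bot] at h0
    exact eq_zero_of_eval_eq_zero hρ hR hA hX (Submodule.mem_iSup_of_mem l hx) h0
  · have := (hR.level 0).finite_weightSpace hM l
    let f : (X.limitEnd d).maxGenEigenspace l →ₗ[K] (X.levelEnd d 0).maxGenEigenspace l :=
      (X.evalLinear 0).restrict fun x hx => ModuleSystem.eval_mem_weightSpace hx
    refine FiniteDimensional.of_injective f ((injective_iff_map_eq_zero f).2 fun x hx => ?_)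
    exact Subtype.ext (eq_zero_of_eval_eq_zero hρ hR hA hX
      (Submodule.mem_iSup_of_mem l x.2) (congrArg Subtype.val hx))

/-- Closed submodules contain the weight components of their elements. -/
theorem weightComponent_mem_of_isClosed {N : Submodule (inverseLimit ρ) X.lim}
    (hN : IsClosed (N : Set X.lim)) {v : X.lim} (hv : v ∈ N) {x : K → X.lim}
    (hx : ∀ l, x l ∈ (X.limitEnd d).maxGenEigenspace l)
    (hs : ∀ n, HasSum (fun l => X.eval n (x l)) (X.eval n v)) (l : K) : x l ∈ N := by
  have hfin : ∀ n, Module.Finite (𝓡 n) (X.obj n) := fun n => (hX n).1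
  have hfinA : ∀ n, Module.Finite (levelClosure R A n) (X.obj n) := fun n => (hX n).2.1
  have hM := limitO_span_weightPart hρ hA hX
  suffices h : x l ∈ closure (N : Set X.lim) by rwa [hN.closure_eq] at h
  refine ModuleSystem.mem_closure_of_eval hρ fun n => ?_
  have hadd := IsModuleTopology.topologicalAddGroup (𝓡 n) (X.obj n)
  -- At a Banach level every submodule contains the weight components of its elements; this is
  -- applied to the submodule generated by the image of `N`.
  have h1 : X.eval n (x l) ∈ Submodule.span (𝓡 n) (X.eval n '' (N : Set X.lim)) :=
    (hR.level n).weightComponent_mem (hM n) _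
      (Submodule.subset_span (Set.mem_image_of_mem _ hv))
      (fun l => ModuleSystem.eval_mem_weightSpace (hx l)) (hs n) l
  generalize X.eval n (x l) = z at h1 ⊢
  -- That submodule lies in the closure of the image of `N`, because its scalars can be approximated
  -- by elements of `R`, which preserve `N`.
  induction h1 using Submodule.span_induction with
  | mem z hz => exact subset_closure hz
  | zero => exact subset_closure ⟨0, zero_mem _, map_zero _⟩
  | add a b _ _ ha hb =>
    refine map_mem_closure₂ continuous_add ha hb ?_
    rintro _ ⟨a, ha, rfl⟩ _ ⟨b, hb, rfl⟩
    exact ⟨a + b, add_mem ha hb, map_add _ _ _⟩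
  | smul c a _ ha =>
    refine map_mem_closure₂ continuous_smul ((hR.level n).denseRange c) ha ?_
    rintro _ ⟨b, rfl⟩ _ ⟨t, ht, rfl⟩
    exact ⟨(b : inverseLimit ρ) • t, N.smul_mem _ ht, rfl⟩

end LimitTopology

/-! ## Systems of modules obtained by extension of scalars -/

/-- The equality `g ∘ f = f'` is a hypothesis so that the maps `R → 𝓡(n)`, compatible only up to a
proof, can be inserted. It provides the transition maps of the system `(𝓡(n) ⊗_R N)`. -/
lemma IsScalarExtension.exists_transition {R S T : Type u} [Ring R] [Ring S] [Ring T] {f : R →+* S}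
    {g : S →+* T} {f' : R →+* T} (h : g.comp f = f') (M : Type u) [AddCommGroup M] [Module R M] :
    ∃ k : BaseChange f M →+ BaseChange f' M, IsScalarExtension g k ∧
      ∀ m, k (BaseChange.unit f M m) = BaseChange.unit f' M m := by
  subst h
  let φ : S →+ M →+ BaseChange (g.comp f) M := AddMonoidHom.mk' (fun s =>
    AddMonoidHom.mk' (fun m => BaseChange.tmul (g.comp f) (g s) m)
      fun m m' => BaseChange.tmul_add _ _ _ _) fun s s' => by
        ext m
        exact (congrArg (fun t => BaseChange.tmul (g.comp f) t m) (map_add g s s')).trans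
          (BaseChange.add_tmul _ _ _ _)
  have hφ : ∀ s m, φ s m = BaseChange.tmul (g.comp f) (g s) m := fun _ _ => rfl
  let k : BaseChange f M →+ BaseChange (g.comp f) M := BaseChange.liftAdd f φ fun s r m => by
    rw [hφ, hφ, BaseChange.tmul_smul, map_mul]
    rfl
  have hk : ∀ s m, k (BaseChange.tmul f s m) = BaseChange.tmul (g.comp f) (g s) m :=
    fun _ _ => rfl
  have hk1 : ∀ m, k (BaseChange.unit f M m) = BaseChange.unit (g.comp f) M m := fun m => by
    rw [BaseChange.unit_apply, hk, map_one]
    rfl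
  refine ⟨k, (IsScalarExtension.unit f M).of_comp (fun s x => ?_) ?_, hk1⟩
  · induction x using BaseChange.induction_on with
    | zero => rw [smul_zero, map_zero, smul_zero]
    | add x y hx hy => rw [smul_add, map_add, map_add, hx, hy, smul_add]
    | tmul t m => rw [BaseChange.smul_tmul, hk, hk, BaseChange.smul_tmul, map_mul]
  · have : k.comp (BaseChange.unit f M) = BaseChange.unit (g.comp f) M := AddMonoidHom.ext hk1
    rw [this]
    exact IsScalarExtension.unit _ M

lemma exists_submodule_comap {R S : Type*} [Ring R] [IsNoetherianRing R] [Ring S] (i : R →+* S)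
    {W : Type u} [AddCommGroup W] [Module R W] [Module.Finite R W] {M : Type*} [AddCommGroup M]
    [Module S M] {j : W →+ M} (hj : ∀ r w, j (r • w) = i r • j w) (Q : Submodule S M) :
    ∃ (N : Type u) (_ : AddCommGroup N) (_ : Module R N) (k : N →ₗ[R] W), Module.Finite R N ∧
      Function.Injective k ∧ ∀ x, j x ∈ Q ↔ ∃ n, k n = x := by
  let N : Submodule R W :=
    { carrier := {x | j x ∈ Q}
      add_mem' := fun {x y} hx hy => by
        simp only [Set.mem_ofPred_eq] at hx hy ⊢
        rw [map_add]
        exact add_mem hx hy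
      zero_mem' := by
        simp only [Set.mem_ofPred_eq, map_zero]
        exact zero_mem _
      smul_mem' := fun r x hx => by
        simp only [Set.mem_ofPred_eq] at hx ⊢
        rw [hj]
        exact Q.smul_mem _ hx }
  exact ⟨N, inferInstance, inferInstance, N.subtype, inferInstance, Subtype.val_injective,
    fun x => ⟨fun hx => ⟨⟨x, hx⟩, rfl⟩, fun ⟨n, hn⟩ => hn ▸ n.2⟩⟩

lemma IsLocallyNilpotent.of_injective {K : Type w} [Field K] {R : Type u} [Ring R] [Algebra K R]
    {B : Subalgebra K R} {d : R} {N W : Type*} [AddCommGroup N] [Module R N] [AddCommGroup W]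
    [Module R W] (hW : IsLocallyNilpotent B d W) (k : N →ₗ[R] W) (hk : Function.Injective k) :
    IsLocallyNilpotent B d N := fun x => by
  obtain ⟨n, hn⟩ := hW (k x)
  refine ⟨n, fun q hq b hb hbq => hk ?_⟩
  rw [map_smul, hn q hq b hb hbq, map_zero]

namespace ModuleSystem

variable {K : Type w} [Field K] {𝓢 : ℕ → Type u} [∀ n, Ring (𝓢 n)] [∀ n, Algebra K (𝓢 n)]
  {ρ : ∀ n, 𝓢 (n + 1) →ₐ[K] 𝓢 n}

/-- The system of modules with given transition maps. -/
def ofScalarExtension (M : ∀ n, ModuleCat.{u} (𝓢 n)) (t : ∀ n, M (n + 1) →+ M n)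
    (h : ∀ n, IsScalarExtension (ρ n).toRingHom (t n)) : ModuleSystem ρ where
  obj := M
  iso n := (h n).equiv.toModuleIso

lemma ofScalarExtension_transHom (M : ∀ n, ModuleCat.{u} (𝓢 n)) (t : ∀ n, M (n + 1) →+ M n)
    (h : ∀ n, IsScalarExtension (ρ n).toRingHom (t n)) (n : ℕ) (x : M (n + 1)) :
    (ofScalarExtension M t h).transHom n x = t n x :=
  (h n).equiv_unit x

/-- A morphism of systems is a family of linear maps compatible with the transition maps. -/
def homMk {X Y : ModuleSystem ρ} (G : ∀ n, X.obj n →ₗ[𝓢 n] Y.obj n)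
    (h : ∀ n x, G n (X.transHom n x) = Y.transHom n (G (n + 1) x)) : X ⟶ Y where
  app n := ModuleCat.ofHom (G n)
  comm n := by
    ext1
    refine BaseChange.hom_ext fun s m => ?_
    have h1 : BaseChange.tmul (ρ n).toRingHom s m = s • BaseChange.tmul (ρ n).toRingHom 1 m := by
      rw [BaseChange.smul_tmul, mul_one]
    have h2 : BaseChange.tmul (ρ n).toRingHom s (G (n + 1) m) =
        s • BaseChange.tmul (ρ n).toRingHom 1 (G (n + 1) m) := by
      rw [BaseChange.smul_tmul, mul_one]
    change G n ((X.iso n).hom.hom (BaseChange.tmul (ρ n).toRingHom s m)) =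
      (Y.iso n).hom.hom (BaseChange.tmul (ρ n).toRingHom s (G (n + 1) m))
    rw [h1, h2]
    refine (congrArg (G n) (map_smul (X.iso n).hom.hom s
      (BaseChange.tmul (ρ n).toRingHom 1 m))).trans ?_
    refine Eq.trans ?_ (map_smul (Y.iso n).hom.hom s
      (BaseChange.tmul (ρ n).toRingHom 1 (G (n + 1) m))).symm
    rw [map_smul]
    exact congrArg (s • ·) (h n m)

/-- The map induced on the limit. -/
def limMap {X Y : ModuleSystem ρ} (f : X ⟶ Y) : X.lim →ₗ[inverseLimit ρ] Y.lim :=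
  ((limitFunctor ρ).map f).hom

lemma eval_limMap {X Y : ModuleSystem ρ} (f : X ⟶ Y) (n : ℕ) (x : X.lim) :
    Y.eval n (limMap f x) = (f.app n).hom (X.eval n x) := rfl

lemma exists_system (M : ℕ → Type u) [∀ n, AddCommGroup (M n)] [∀ n, Module (𝓢 n) (M n)]
    (t : ∀ n, M (n + 1) →+ M n) (h : ∀ n, IsScalarExtension (ρ n).toRingHom (t n)) :
    ∃ (X : ModuleSystem ρ) (e : ∀ n, M n ≃ₗ[𝓢 n] X.obj n),
      ∀ n x, X.transHom n (e (n + 1) x) = e n (t n x) :=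
  ⟨ofScalarExtension (fun n => ModuleCat.of (𝓢 n) (M n)) t h, fun n => LinearEquiv.refl _ _,
    ofScalarExtension_transHom (fun n => ModuleCat.of (𝓢 n) (M n)) t h⟩

/-- Every module over a ring mapping to the limit has an associated system. -/
lemma exists_extension {R : Type u} [Ring R] (i : ∀ n, R →+* 𝓢 n)
    (hi : ∀ n, (ρ n).toRingHom.comp (i (n + 1)) = i n) (N : Type u) [AddCommGroup N] [Module R N] :
    ∃ (X : ModuleSystem ρ) (j : N →+ X.lim),
      ∀ n, IsScalarExtension (i n) ((X.eval n).comp j) := by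
  choose t ht htu using fun n => IsScalarExtension.exists_transition (hi n) N
  obtain ⟨X, e, he⟩ := exists_system (ρ := ρ) (fun n => BaseChange (i n) N) t ht
  choose j hj using fun m : N => X.exists_lim (fun n => e n (BaseChange.unit (i n) N m)) fun n => by
    rw [he, htu]
  let j' : N →+ X.lim := AddMonoidHom.mk' j fun m m' => lim_ext fun n => by
    rw [map_add, hj, hj, hj, map_add, map_add]
  refine ⟨X, j', fun n => ?_⟩
  have : (X.eval n).comp j' = (e n).toLinearMap.toAddMonoidHom.comp (BaseChange.unit (i n) N) :=
    AddMonoidHom.ext fun m => hj m n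
  rw [this]
  exact (IsScalarExtension.unit (i n) N).of_linearEquiv (e n)

end ModuleSystem

lemma isScalarExtension_lim_of_level {K : Type w} [NontriviallyNormedField K] {𝓡 : ℕ → Type u}
    [∀ n, NormedRing (𝓡 n)] [∀ n, NormedAlgebra K (𝓡 n)] [∀ n, CompleteSpace (𝓡 n)]
    {ρ : ∀ n, 𝓡 (n + 1) →ₐ[K] 𝓡 n} (hρ : IsFrechetStein ρ) {R : Subalgebra K (inverseLimit ρ)}
    {A B H : Subalgebra K R} {d : R} (hR : IsFrechetTriangularDecomposition R A B H d)
    {N : Type u} [AddCommGroup N] [Module R N] [Module.Finite R N] {X : ModuleSystem ρ}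
    {j : N →+ X.lim}
    (hj : ∀ n, IsScalarExtension (R := R) (S := 𝓡 n) (toLevel R n).toRingHom ((X.eval n).comp j)) :
    IsScalarExtension (R := R) (S := inverseLimit ρ) R.val.toRingHom j := by
  have := (hR.level 0).algebraic.noetherian
  have h : ∀ n, IsScalarExtension (levelHom (R := R) R.val.toRingHom n) ((X.eval n).comp j) := hj
  exact isScalarExtension_lim hρ (R := R) R.val.toRingHom h

/-! ### Morphisms and closed submodules in the limit category -/

section LimitCategory

variable {K : Type w} [NontriviallyNormedField K] [CompleteSpace K] [CharZero K]
  [IsUltrametricDist K] {𝓡 : ℕ → Type u} [∀ n, NormedRing (𝓡 n)] [∀ n, NormedAlgebra K (𝓡 n)]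
  [∀ n, CompleteSpace (𝓡 n)] [∀ n, IsUltrametricDist (𝓡 n)] {ρ : ∀ n, 𝓡 (n + 1) →ₐ[K] 𝓡 n}
  (hρ : IsFrechetStein ρ) {R : Subalgebra K (inverseLimit ρ)} {A B H : Subalgebra K R} {d : R}
  (hR : IsFrechetTriangularDecomposition R A B H d)
  (hA : ∀ n, IsNoetherianRing (levelClosure R A n))

include hR hA

lemma limitO_of_isScalarExtension {N : Type u} [AddCommGroup N] [Module R N] [Module K N]
    [IsScalarTower K R N] [Module.Finite R N] (hN : IsLocallyNilpotent B d N) {X : ModuleSystem ρ}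
    {j : ∀ n, N →+ X.obj n}
    (hj : ∀ n, IsScalarExtension (R := R) (S := 𝓡 n) (toLevel R n).toRingHom (j n)) :
    limitO R A d X := fun n => by
  have := hA n
  have hfin := (hR.level n).finite_extension hN (hj n)
  exact ⟨Module.Finite.of_restrictScalars_finite (levelClosure R A n) (𝓡 n) (X.obj n), hfin,
    (hR.level n).hasWeightDecomposition_extension hN (hj n)⟩

include hρ

/-- A weight vector of the limit is determined by its component at level `0`, and that component
comes from `N`. -/
lemma weightPart_lim_of_isScalarExtension {N : Type u} [AddCommGroup N] [Module R N] [Module K N]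
    [IsScalarTower K R N] [Module.Finite R N] (hN : IsLocallyNilpotent B d N) {X : ModuleSystem ρ}
    {j : N →+ X.lim} (hj : ∀ n, IsScalarExtension (R := R) (S := 𝓡 n) (toLevel R n).toRingHom
      ((X.eval n).comp j)) :
    Function.Injective j ∧ (∀ x, x ∈ weightPart (X.limitEnd d) ↔ ∃ m, j m = x) := by
  have hX := limitO_of_isScalarExtension hR hA hN hj
  have hinj : Function.Injective ((X.eval 0).comp j) :=
    (hR.level 0).injective_of_isScalarExtension hN (hj 0)
  have hsmul : ∀ (r : R) m, j (r • m) = (r : inverseLimit ρ) • j m := fun r m =>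
    ModuleSystem.lim_ext fun n => (hj n).smul r m
  have hjw : ∀ l, ∀ m ∈ (Algebra.lsmul K K N d).maxGenEigenspace l,
      j m ∈ (X.limitEnd d).maxGenEigenspace l := fun l m hm => by
    refine map_mem_maxGenEigenspace j (fun m => ?_) hm
    rw [map_sub]
    congr 1
    · exact (hsmul d m).symm
    · have := hsmul (algebraMap K R l) m
      rw [algebraMap_smul] at this
      exact this.symm
  refine ⟨fun x y h => hinj (congrArg (X.eval 0) h), fun x => ⟨fun hx => ?_, ?_⟩⟩
  · rw [weightPart] at hx
    induction hx using Submodule.iSup_induction' with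
    | mem l x hx =>
      have := hA 0
      obtain ⟨m, hm, hmx⟩ := (hR.level 0).exists_weight_preimage hN (hj 0)
        (ModuleSystem.eval_mem_weightSpace hx)
      refine ⟨m, ?_⟩
      rw [← sub_eq_zero]
      refine eq_zero_of_eval_eq_zero hρ hR hA hX (n := 0) (Submodule.sub_mem _
        (Submodule.mem_iSup_of_mem l (hjw l m hm)) (Submodule.mem_iSup_of_mem l hx)) ?_
      rw [map_sub, sub_eq_zero]
      exact hmx
    | zero => exact ⟨0, map_zero _⟩
    | add x y _ _ hx hy =>
      obtain ⟨a, rfl⟩ := hx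
      obtain ⟨b, rfl⟩ := hy
      exact ⟨a + b, map_add _ _ _⟩
  · rintro ⟨m, rfl⟩
    have hm : m ∈ weightPart (Algebra.lsmul K K N d) :=
      (hR.level 0).algebraic.weightPart_eq_top hN ▸ Submodule.mem_top
    rw [weightPart] at hm
    induction hm using Submodule.iSup_induction' with
    | mem l m hm => exact Submodule.mem_iSup_of_mem l (hjw l m hm)
    | zero => rw [map_zero]; exact zero_mem _
    | add x y _ _ hx hy => rw [map_add]; exact add_mem hx hy

/-- The weight part of the limit, with its extensions of scalars. -/
lemma exists_weightPart_limit {X : ModuleSystem ρ} (hX : limitO R A d X) :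
    ∃ (N : Type u) (_ : AddCommGroup N) (_ : Module R N) (_ : Module K N)
      (_ : IsScalarTower K R N) (j : N →+ X.lim),
      (∀ (r : R) n, j (r • n) = (r : inverseLimit ρ) • j n) ∧
      Function.Injective j ∧ (∀ x, x ∈ weightPart (X.limitEnd d) ↔ ∃ m, j m = x) ∧
      IsLocallyNilpotent B d N ∧ Module.Finite R N ∧
      (∀ n, IsScalarExtension (R := R) (S := 𝓡 n) (toLevel R n).toRingHom ((X.eval n).comp j)) ∧
      IsScalarExtension (R := R) (S := inverseLimit ρ) R.val.toRingHom j := by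
  obtain ⟨N, _, _, _, _, j, hj, hinj, hrange⟩ := exists_weightPart_module R.val
    (hR.level 0).algebraic.grading X.lim
  exact ⟨N, _, _, _, inferInstance, j, hj, hinj, hrange,
    isLocallyNilpotent_weightPart_limit hρ hR hA hX hj hinj hrange,
    finite_weightPart_limit hρ hR hA hX hj hinj hrange,
    isScalarExtension_weightPart_level hρ hR hA hX hj hinj hrange,
    isScalarExtension_weightPart_limit hρ hR hA hX hj hinj hrange⟩

/-- Linear maps between limits come from morphisms of systems. -/
lemma exists_hom_of_lim {X Y : ModuleSystem ρ} (hX : limitO R A d X)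
    (f : X.lim →ₗ[inverseLimit ρ] Y.lim) : ∃ φ : X ⟶ Y, ModuleSystem.limMap φ = f := by
  obtain ⟨N, _, _, _, _, j, hj, -, -, -, -, hSE, hSE'⟩ := exists_weightPart_limit hρ hR hA hX
  -- The map `f` is determined by its restriction to the weight part, and each level is an extension
  -- of scalars of it, so the restriction extends to every level.
  let G : ∀ n, X.obj n →ₗ[𝓡 n] Y.obj n := fun n =>
    (hSE n).desc ((Y.eval n).comp (f.toAddMonoidHom.comp j)) fun r m => by
      change Y.eval n (f (j (r • m))) = toLevel R n r • Y.eval n (f (j m))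
      rw [hj, map_smul]
      rfl
  have hG : ∀ n m, G n (X.eval n (j m)) = Y.eval n (f (j m)) := fun n m =>
    (hSE n).desc_apply _ _ m
  refine ⟨ModuleSystem.homMk G fun n x => ?_, ?_⟩
  · have hx : x ∈ Submodule.span (𝓡 (n + 1)) (Set.range ((X.eval (n + 1)).comp j)) :=
      (hSE (n + 1)).span_range ▸ Submodule.mem_top
    induction hx using Submodule.span_induction with
    | mem x hx =>
      obtain ⟨m, rfl⟩ := hx
      rw [AddMonoidHom.comp_apply, X.transHom_eval, hG, hG, Y.transHom_eval]
    | zero => simp only [map_zero]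
    | add x y _ _ hx hy => simp only [map_add, hx, hy]
    | smul a x _ hx =>
      have h1 : X.transHom n (a • x) = ρ n a • X.transHom n x := X.trans_smul n a x
      have h2 : Y.transHom n (a • G (n + 1) x) = ρ n a • Y.transHom n (G (n + 1) x) :=
        Y.trans_smul n a _
      rw [h1, (G n).map_smul, (G (n + 1)).map_smul, h2, hx]
  · exact hSE'.hom_ext fun m => ModuleSystem.lim_ext fun n => hG n m

lemma hom_ext_of_lim {X Y : ModuleSystem ρ} (hX : limitO R A d X) {φ ψ : X ⟶ Y}
    (h : ModuleSystem.limMap φ = ModuleSystem.limMap ψ) : φ = ψ := by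
  obtain ⟨N, _, _, _, _, j, -, -, -, -, -, hSE, -⟩ := exists_weightPart_limit hρ hR hA hX
  refine ModuleSystem.Hom.ext (funext fun n => ModuleCat.hom_ext ((hSE n).hom_ext fun m => ?_))
  change (φ.app n).hom (X.eval n (j m)) = (ψ.app n).hom (X.eval n (j m))
  rw [← ModuleSystem.eval_limMap, ← ModuleSystem.eval_limMap, h]

/-- Closed submodules of a limit. -/
theorem exists_system_of_isClosed {X : ModuleSystem ρ} (hX : limitO R A d X)
    {Q : Submodule (inverseLimit ρ) X.lim} (hQ : IsClosed (Q : Set X.lim)) :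
    ∃ Y : ModuleSystem ρ, limitO R A d Y ∧ Nonempty (Y.lim ≃ₗ[inverseLimit ρ] Q) := by
  obtain ⟨W, _, _, _, _, j, hj, hinj, hrange, hnil, hfin, hSE, -⟩ :=
    exists_weightPart_limit hρ hR hA hX
  have hnoeth : IsNoetherianRing R := (hR.level 0).algebraic.noetherian
  -- `N` is the weight part of `Q`. It lies in `𝒪`, and its system of extensions `Y` is the
  -- candidate whose limit should be `Q`.
  obtain ⟨N, _, _, ι, hNfin, hι, hιQ⟩ := exists_submodule_comap (R := R) R.val.toRingHom hj Q
  let _ : Module K N := Module.compHom N (algebraMap K R)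
  have _ : IsScalarTower K R N := ⟨fun c r m => by
    rw [Algebra.smul_def, mul_smul]
    rfl⟩
  have hN : IsLocallyNilpotent B d N := hnil.of_injective ι hι
  obtain ⟨Y, k, hk⟩ := ModuleSystem.exists_extension (R := R) (ρ := ρ)
    (fun n => (toLevel R n).toRingHom) toLevel_trans N
  have hY : limitO R A d Y := limitO_of_isScalarExtension hR hA hN hk
  let G : ∀ n, Y.obj n →ₗ[𝓡 n] X.obj n := fun n =>
    (hk n).desc (((X.eval n).comp j).comp ι.toAddMonoidHom) fun r m =>
      (congrArg ((X.eval n).comp j) (ι.map_smul r m)).trans ((hSE n).smul r (ι m))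
  have hG : ∀ n m, G n (Y.eval n (k m)) = X.eval n (j (ι m)) := fun n m => (hk n).desc_apply _ _ m
  -- Exactness of extension of scalars on `𝒪` replaces flatness of `𝓡(n)` over `R`.
  have hGinj : ∀ n, Function.Injective (G n) := fun n => by
    have := hA n
    exact (hR.level n).injective_extension hN (hk n) hnil (hSE n) ι hι
      (G n) (hG n)
  have hGt : ∀ n x, G n (Y.transHom n x) = X.transHom n (G (n + 1) x) := fun n x => by
    have hx : x ∈ Submodule.span (𝓡 (n + 1)) (Set.range ((Y.eval (n + 1)).comp k)) :=
      (hk (n + 1)).span_range ▸ Submodule.mem_top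
    induction hx using Submodule.span_induction with
    | mem x hx =>
      obtain ⟨m, rfl⟩ := hx
      rw [AddMonoidHom.comp_apply, Y.transHom_eval, hG, hG, X.transHom_eval]
    | zero => simp only [map_zero]
    | add x y _ _ hx hy => simp only [map_add, hx, hy]
    | smul a x _ hx =>
      have h1 : Y.transHom n (a • x) = ρ n a • Y.transHom n x := Y.trans_smul n a x
      have h2 : X.transHom n (a • G (n + 1) x) = ρ n a • X.transHom n (G (n + 1) x) :=
        X.trans_smul n a _
      rw [h1, (G n).map_smul, (G (n + 1)).map_smul, h2, hx]
  let F : Y.lim →ₗ[inverseLimit ρ] X.lim := ModuleSystem.limMap (ModuleSystem.homMk G hGt)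
  have hF : ∀ n y, X.eval n (F y) = G n (Y.eval n y) := fun n y => rfl
  have hFinj : Function.Injective F := fun x y hxy => ModuleSystem.lim_ext fun n => hGinj n (by
    rw [← hF, ← hF, hxy])
  have hkSE : IsScalarExtension (R := R) (S := inverseLimit ρ) R.val.toRingHom k :=
    isScalarExtension_lim_of_level hρ hR hk
  have hrangeF : LinearMap.range F = Q := by
    refine le_antisymm ?_ fun v hv => ?_
    · rw [LinearMap.range_eq_map, ← hkSE.span_range, Submodule.map_span_le]
      rintro _ ⟨m, rfl⟩
      have : F (k m) = j (ι m) := ModuleSystem.lim_ext fun n => hG n m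
      rw [this]
      exact (hιQ _).2 ⟨m, rfl⟩
    · obtain ⟨x, hx, hs⟩ := exists_hasSum_levels hρ hR hA hX v
      have hxQ := weightComponent_mem_of_isClosed hρ hR hA hX hQ hv hx hs
      -- The components of `v` lie in `Q` because `Q` is closed, so they come from `N`. The range of
      -- `G n` is closed and contains their sum. The preimages are compatible because `G n` is
      -- injective.
      have hv' : ∀ n, X.eval n v ∈ LinearMap.range (G n) := fun n => by
        have := hρ.noetherian n
        have : Module.Finite (𝓡 n) (X.obj n) := (hX n).1
        refine (isClosed_submodule K (LinearMap.range (G n))).mem_of_tendsto (hs n)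
          (Filter.Eventually.of_forall fun s => Submodule.sum_mem _ fun l _ => ?_)
        obtain ⟨m, hm⟩ := (hrange (x l)).1 (Submodule.mem_iSup_of_mem l (hx l))
        obtain ⟨q, rfl⟩ := (hιQ m).1 (hm ▸ hxQ l)
        exact ⟨Y.eval n (k q), (hG n q).trans (congrArg (X.eval n) hm)⟩
      choose y hy using hv'
      obtain ⟨y', hy'⟩ := Y.exists_lim y fun n => hGinj n (by
        rw [hGt, hy, hy, X.transHom_eval])
      refine ⟨y', ModuleSystem.lim_ext fun n => ?_⟩
      rw [hF, hy', hy]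
  exact ⟨Y, hY, ⟨(LinearEquiv.ofInjective F hFinj).trans (LinearEquiv.ofEq _ _ hrangeF)⟩⟩

end LimitCategory

/-! ## Abelian subcategories of module categories -/

/-- A class of modules closed under isomorphisms, kernels, cokernels and finite products. -/
structure IsExactModuleClass {S : Type u} [Ring S] (P : ObjectProperty (ModuleCat.{u} S)) :
    Prop where
  of_equiv : ∀ {M N : ModuleCat.{u} S}, (M ≃ₗ[S] N) → P M → P N
  ker : ∀ {M N : ModuleCat.{u} S} (f : M →ₗ[S] N), P M → P N →
    P (ModuleCat.of S (LinearMap.ker f))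
  coker : ∀ {M N : ModuleCat.{u} S} (f : M →ₗ[S] N), P M → P N →
    P (ModuleCat.of S (N ⧸ LinearMap.range f))
  pi : ∀ {J : Type} [Finite J] (M : J → ModuleCat.{u} S), (∀ i, P (M i)) →
    P (ModuleCat.of S (∀ i, M i))

namespace IsExactModuleClass

open Limits ObjectProperty

variable {S : Type u} [Ring S] {P : ObjectProperty (ModuleCat.{u} S)} (h : IsExactModuleClass P)

include h

lemma isClosedUnderIsomorphisms : P.IsClosedUnderIsomorphisms :=
  ⟨fun e hX => h.of_equiv e.toLinearEquiv hX⟩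

lemma isClosedUnderKernels : P.IsClosedUnderKernels :=
  ⟨by
    rintro _ ⟨f, k, hk, hf⟩
    exact h.of_equiv ((ModuleCat.kernelIsLimit f).conePointUniqueUpToIso hk).toLinearEquiv
      (h.ker f.hom hf.1 hf.2)⟩

lemma isClosedUnderCokernels : P.IsClosedUnderCokernels :=
  ⟨by
    rintro _ ⟨f, k, hk, hf⟩
    exact h.of_equiv
      ((ModuleCat.cokernelIsColimit f).coconePointUniqueUpToIso hk).toLinearEquiv
      (h.coker f.hom hf.1 hf.2)⟩

lemma isClosedUnderFiniteProducts : P.IsClosedUnderFiniteProducts where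
  isClosedUnderLimitsOfShape J _ := by
    have := h.isClosedUnderIsomorphisms
    refine ⟨?_⟩
    rintro X ⟨p⟩
    let Z : J → ModuleCat.{u} S := fun i => p.diag.obj ⟨i⟩
    let e : Discrete.functor Z ≅ p.diag := Discrete.natIso fun i => Iso.refl _
    let c : Fan Z := Fan.mk (ModuleCat.of S (∀ i, Z i)) fun i =>
      ModuleCat.ofHom (LinearMap.proj i : (∀ i, Z i) →ₗ[S] Z i)
    let hc : IsLimit c := ModuleCat.productConeIsLimit.{u, 0, u} Z
    exact h.of_equiv (hc.conePointsIsoOfNatIso p.isLimit e).toLinearEquiv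
      (h.pi Z fun i => p.prop_diag_obj ⟨i⟩)

lemma containsZero : P.ContainsZero := by
  have := h.isClosedUnderIsomorphisms
  refine ⟨ModuleCat.of S (∀ _ : PEmpty.{1}, PUnit.{u+1}), ?_,
    h.pi (fun _ : PEmpty.{1} => ModuleCat.of S PUnit) fun i => i.elim⟩
  exact ModuleCat.isZero_of_subsingleton _

/-- The full subcategory is abelian. -/
@[reducible]
def abelian : Abelian P.FullSubcategory := by
  have := h.isClosedUnderKernels
  have := h.isClosedUnderCokernels
  have := h.isClosedUnderFiniteProducts
  have := h.containsZero
  infer_instance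

lemma preservesFiniteLimits_ι : PreservesFiniteLimits P.ι := by
  have := h.isClosedUnderKernels
  let _ := h.abelian
  have : HasBinaryBiproducts P.FullSubcategory := Abelian.hasBinaryBiproducts
  have : P.ContainsZero := h.containsZero
  have : ∀ {X Y : P.FullSubcategory} (f : X ⟶ Y), PreservesLimit (parallelPair f 0) P.ι :=
    fun f => P.preservesKernels_ι f
  exact Functor.preservesFiniteLimits_of_preservesKernels P.ι

lemma preservesFiniteColimits_ι : PreservesFiniteColimits P.ι := by
  have := h.isClosedUnderCokernels
  let _ := h.abelian
  have : HasBinaryBiproducts P.FullSubcategory := Abelian.hasBinaryBiproducts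
  have : P.ContainsZero := h.containsZero
  have : ∀ {X Y : P.FullSubcategory} (f : X ⟶ Y), PreservesColimit (parallelPair f 0) P.ι :=
    fun f => P.preservesCokernels_ι f
  exact Functor.preservesFiniteColimits_of_preservesCokernels P.ι

variable {Q : ObjectProperty (ModuleCat.{u} S)} (hPQ : P ≤ Q)

/-- Finite limits are computed in the ambient module category, and the inclusion of the larger full
subcategory into it reflects them. No exactness property of `Q` is needed. -/
lemma preservesFiniteLimits_ιOfLE : PreservesFiniteLimits (ιOfLE hPQ) := by
  have := h.preservesFiniteLimits_ι
  refine ⟨fun J _ _ => ?_⟩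
  have : PreservesLimitsOfShape J (ιOfLE hPQ ⋙ Q.ι) := inferInstanceAs
    (PreservesLimitsOfShape J P.ι)
  exact preservesLimitsOfShape_of_reflects_of_preserves (ιOfLE hPQ) Q.ι

lemma preservesFiniteColimits_ιOfLE : PreservesFiniteColimits (ιOfLE hPQ) := by
  have := h.preservesFiniteColimits_ι
  refine ⟨fun J _ _ => ?_⟩
  have : PreservesColimitsOfShape J (ιOfLE hPQ ⋙ Q.ι) := inferInstanceAs
    (PreservesColimitsOfShape J P.ι)
  exact preservesColimitsOfShape_of_reflects_of_preserves (ιOfLE hPQ) Q.ι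

end IsExactModuleClass

/-! ## Exactness properties of the extended categories -/

namespace IsScalarExtension

variable {R S : Type u} [Ring R] [Ring S] {f : R →+* S}

/-- A criterion for quotients and products: generation gives surjectivity, and a linear map back to
the tensor product gives injectivity. -/
lemma of_retraction {M : Type u} [AddCommGroup M] [Module R M] {P : Type v} [AddCommGroup P]
    [Module S P] {j : M →+ P} (hj : ∀ r m, j (r • m) = f r • j m)
    (hspan : Submodule.span S (Set.range j) = ⊤) (G : P →ₗ[S] BaseChange f M)
    (hG : ∀ m, G (j m) = BaseChange.unit f M m) : IsScalarExtension f j := by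
  refine ⟨hj, ?_, ?_⟩
  · have : G.comp (BaseChange.lift f j hj) = LinearMap.id :=
      (unit f M).hom_ext fun m => by
        rw [LinearMap.comp_apply, BaseChange.lift_unit, hG]
        rfl
    exact Function.LeftInverse.injective (g := G) (LinearMap.congr_fun this)
  · rw [← LinearMap.range_eq_top, eq_top_iff, ← hspan, Submodule.span_le]
    rintro _ ⟨m, rfl⟩
    exact ⟨BaseChange.unit f M m, BaseChange.lift_unit f j hj m⟩

/-- Right exactness in terms of models: the cokernel of `G` is an extension of scalars of the
cokernel of `g`. -/
lemma exists_cokernel {M N : Type u} [AddCommGroup M] [Module R M] [AddCommGroup N] [Module R N]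
    {P Q : Type*} [AddCommGroup P] [Module S P] [AddCommGroup Q] [Module S Q] {j : M →+ P}
    {k : N →+ Q} (hj : IsScalarExtension f j) (hk : IsScalarExtension f k) (g : M →ₗ[R] N)
    (G : P →ₗ[S] Q) (hG : ∀ m, G (j m) = k (g m)) :
    ∃ (C : Type u) (_ : AddCommGroup C) (_ : Module R C) (π : N →ₗ[R] C)
      (c : C →+ Q ⧸ LinearMap.range G), Function.Surjective π ∧ IsScalarExtension f c := by
  let c : (N ⧸ LinearMap.range g) →+ Q ⧸ LinearMap.range G :=
    QuotientAddGroup.lift (LinearMap.range g).toAddSubgroup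
      ((LinearMap.range G).mkQ.toAddMonoidHom.comp k) <| by
        rintro _ ⟨m, rfl⟩
        exact (Submodule.Quotient.mk_eq_zero _).2 ⟨j m, hG m⟩
  have hc : ∀ n, c ((LinearMap.range g).mkQ n) = (LinearMap.range G).mkQ (k n) := fun _ => rfl
  refine ⟨N ⧸ LinearMap.range g, inferInstance, inferInstance, (LinearMap.range g).mkQ, c,
    Submodule.mkQ_surjective _, of_retraction (fun r x => ?_) ?_
      ((LinearMap.range G).liftQ
        ((BaseChange.map f (LinearMap.range g).mkQ).comp hk.equiv.symm.toLinearMap) ?_)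
      fun x => ?_⟩
  · obtain ⟨n, rfl⟩ := Submodule.mkQ_surjective _ x
    rw [← map_smul, hc, hc, hk.smul, map_smul]
  · have : Submodule.map (LinearMap.range G).mkQ (Submodule.span S (Set.range k)) ≤
        Submodule.span S (Set.range c) := by
      rw [Submodule.map_span_le]
      rintro _ ⟨n, rfl⟩
      exact Submodule.subset_span ⟨(LinearMap.range g).mkQ n, hc n⟩
    rwa [hk.span_range, Submodule.map_top, Submodule.range_mkQ, top_le_iff] at this
  · rw [LinearMap.range_le_ker_iff]
    refine hj.hom_ext fun m => ?_
    have h0 : (LinearMap.range g).mkQ (g m) = 0 :=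
      (Submodule.Quotient.mk_eq_zero _).2 ⟨m, rfl⟩
    simp only [LinearMap.comp_apply, LinearEquiv.coe_coe, hG, equiv_symm, BaseChange.map_unit, h0,
      map_zero, LinearMap.zero_apply]
  · obtain ⟨n, rfl⟩ := Submodule.mkQ_surjective _ x
    rw [hc]
    change BaseChange.map f (LinearMap.range g).mkQ (hk.equiv.symm (k n)) = _
    rw [equiv_symm, BaseChange.map_unit]

lemma exists_pi {J : Type} [Finite J] {M : J → Type u} [∀ i, AddCommGroup (M i)]
    [∀ i, Module R (M i)] {P : J → Type v} [∀ i, AddCommGroup (P i)] [∀ i, Module S (P i)]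
    {j : ∀ i, M i →+ P i} (hj : ∀ i, IsScalarExtension f (j i)) :
    ∃ k : (∀ i, M i) →+ ∀ i, P i, IsScalarExtension f k := by
  classical
  cases nonempty_fintype J
  let k : (∀ i, M i) →+ ∀ i, P i := AddMonoidHom.mk' (fun x i => j i (x i)) fun x y =>
    funext fun i => map_add (j i) _ _
  have hk : ∀ i (m : M i), k (Pi.single i m) = Pi.single i (j i m) := fun i m =>
    funext fun i' => (Pi.apply_single (fun i => j i) (fun i => map_zero (j i)) i m i')
  refine ⟨k, of_retraction (fun r x => funext fun i => (hj i).smul r (x i)) ?_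
    (∑ i, (BaseChange.map f (LinearMap.single R M i)).comp
      ((hj i).equiv.symm.toLinearMap.comp (LinearMap.proj i))) fun x => ?_⟩
  · refine eq_top_iff.2 fun p _ => ?_
    rw [← Finset.univ_sum_single p]
    refine Submodule.sum_mem _ fun i _ => ?_
    have : Submodule.map (LinearMap.single S P i) (Submodule.span S (Set.range (j i))) ≤
        Submodule.span S (Set.range k) := by
      rw [Submodule.map_span_le]
      rintro _ ⟨m, rfl⟩
      exact Submodule.subset_span ⟨Pi.single i m, hk i m⟩
    refine this ⟨p i, ?_, rfl⟩
    rw [(hj i).span_range]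
    trivial
  · rw [LinearMap.sum_apply]
    have : ∀ i, ((BaseChange.map f (LinearMap.single R M i)).comp
        ((hj i).equiv.symm.toLinearMap.comp (LinearMap.proj i))) (k x) =
        BaseChange.unit f (∀ i, M i) (Pi.single i (x i)) := fun i => by
      change BaseChange.map f (LinearMap.single R M i) ((hj i).equiv.symm (j i (x i))) = _
      rw [equiv_symm, BaseChange.map_unit]
      rfl
    simp only [this]
    rw [← map_sum, Finset.univ_sum_single]

end IsScalarExtension

namespace IsLocallyNilpotent

variable {K : Type w} [Field K] {R : Type u} [Ring R] [Algebra K R] {B : Subalgebra K R} {d : R}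

lemma of_surjective {N W : Type*} [AddCommGroup N] [Module R N] [AddCommGroup W] [Module R W]
    (hN : IsLocallyNilpotent B d N) (k : N →ₗ[R] W) (hk : Function.Surjective k) :
    IsLocallyNilpotent B d W := fun y => by
  obtain ⟨x, rfl⟩ := hk y
  obtain ⟨n, hn⟩ := hN x
  exact ⟨n, fun q hq b hb hbq => by rw [← map_smul, hn q hq b hb hbq, map_zero]⟩

lemma pi {J : Type} [Finite J] {M : J → Type*} [∀ i, AddCommGroup (M i)] [∀ i, Module R (M i)]
    (h : ∀ i, IsLocallyNilpotent B d (M i)) : IsLocallyNilpotent B d (∀ i, M i) := fun x => by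
  cases nonempty_fintype J
  choose n hn using fun i => h i (x i)
  exact ⟨Finset.univ.sup n, fun q hq b hb hbq => funext fun i =>
    hn i q ((Finset.le_sup (Finset.mem_univ i)).trans_lt hq) b hb hbq⟩

end IsLocallyNilpotent

lemma isExactModuleClass_categoryO {K : Type w} [Field K] {R : Type u} [Ring R] [Algebra K R]
    [IsNoetherianRing R] (B : Subalgebra K R) (d : R) : IsExactModuleClass (categoryO B d) where
  of_equiv e h := by
    have := h.1
    exact ⟨Module.Finite.equiv e,
      IsLocallyNilpotent.of_surjective (B := B) (d := d) h.2 e.toLinearMap e.surjective⟩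
  ker {M N} f hM _ := by
    have := hM.1
    exact ⟨inferInstanceAs (Module.Finite R (LinearMap.ker f)),
      IsLocallyNilpotent.of_injective (B := B) (d := d) hM.2 (LinearMap.ker f).subtype
        Subtype.val_injective⟩
  coker {M N} f _ hN := by
    have := hN.1
    exact ⟨inferInstanceAs (Module.Finite R (N ⧸ LinearMap.range f)),
      IsLocallyNilpotent.of_surjective (B := B) (d := d) hN.2 (LinearMap.range f).mkQ
        (Submodule.mkQ_surjective _)⟩
  pi M h := by
    have := fun i => (h i).1
    exact ⟨inferInstanceAs (Module.Finite R (∀ i, M i)),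
      IsLocallyNilpotent.pi (B := B) (d := d) fun i => (h i).2⟩

lemma LinearMap.map_mem_weightPart {K : Type w} [Field K] {S : Type u} [Ring S] [Algebra K S]
    {M N : ModuleCat.{u} S} (e : M →ₗ[S] N) (s : S) {x : M}
    (hx : x ∈ weightPart (actionEnd K s M)) : e x ∈ weightPart (actionEnd K s N) := by
  rw [weightPart] at hx
  induction hx using Submodule.iSup_induction' with
  | mem l x hx =>
    refine Submodule.mem_iSup_of_mem l
      (map_mem_maxGenEigenspace e.toAddMonoidHom (fun m => ?_) hx)
    change s • e m - l • e m = e (s • m - l • m)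
    rw [map_sub, e.map_smul s m, algebra_compatible_smul S l m, e.map_smul,
      ← algebra_compatible_smul S l (e m)]
  | zero => rw [map_zero]; exact zero_mem _
  | add x y _ _ hx hy => rw [map_add]; exact add_mem hx hy

lemma LinearEquiv.mem_weightPart_iff {K : Type w} [Field K] {S : Type u} [Ring S] [Algebra K S]
    {M N : ModuleCat.{u} S} (e : M ≃ₗ[S] N) (s : S) (x : M) :
    e x ∈ weightPart (actionEnd K s N) ↔ x ∈ weightPart (actionEnd K s M) := by
  refine ⟨fun h => ?_, e.toLinearMap.map_mem_weightPart s⟩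
  have := e.symm.toLinearMap.map_mem_weightPart s h
  rwa [LinearEquiv.coe_coe, LinearEquiv.symm_apply_apply] at this

/-! ### Modules over the Fréchet-Stein algebra and their weight parts -/

section FrechetCategory

variable {K : Type w} [NontriviallyNormedField K] [CompleteSpace K] [CharZero K]
  [IsUltrametricDist K] {𝓡 : ℕ → Type u} [∀ n, NormedRing (𝓡 n)] [∀ n, NormedAlgebra K (𝓡 n)]
  [∀ n, CompleteSpace (𝓡 n)] [∀ n, IsUltrametricDist (𝓡 n)] {ρ : ∀ n, 𝓡 (n + 1) →ₐ[K] 𝓡 n}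
  (hρ : IsFrechetStein ρ) {R : Subalgebra K (inverseLimit ρ)} {A B H : Subalgebra K R} {d : R}
  (hR : IsFrechetTriangularDecomposition R A B H d)
  (hA : ∀ n, IsNoetherianRing (levelClosure R A n))

include hρ hR hA

/-- The weight part of a module in the Fréchet category lies in category `𝒪` and generates it. -/
lemma weightPart_of_categoryOFrechet {M : ModuleCat.{u} (inverseLimit ρ)}
    (hM : categoryOFrechet R A d M) {N : Type u} [AddCommGroup N] [Module R N] [Module K N]
    [IsScalarTower K R N] {j : N →+ M} (hj : ∀ (r : R) n, j (r • n) = (r : inverseLimit ρ) • j n)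
    (hinj : Function.Injective j)
    (hrange : ∀ x, x ∈ weightPart (actionEnd K (d : inverseLimit ρ) M) ↔ ∃ n, j n = x) :
    IsLocallyNilpotent B d N ∧ Module.Finite R N ∧
      IsScalarExtension (R := R) (S := inverseLimit ρ) R.val.toRingHom j := by
  obtain ⟨X, hX, ⟨e'⟩⟩ := hM
  let e : X.lim ≃ₗ[inverseLimit ρ] M := e'.toLinearEquiv
  let k : N →+ X.lim := e.symm.toLinearMap.toAddMonoidHom.comp j
  have hek : ∀ n, e (k n) = j n := fun n => e.apply_symm_apply (j n)
  have hk : ∀ (r : R) n, k (r • n) = (r : inverseLimit ρ) • k n := fun r n => by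
    change e.symm (j (r • n)) = _
    rw [hj, map_smul]
    rfl
  have hkinj : Function.Injective k := e.symm.injective.comp hinj
  have hkrange : ∀ x, x ∈ weightPart (X.limitEnd d) ↔ ∃ n, k n = x := fun x => by
    refine (e.mem_weightPart_iff (d : inverseLimit ρ) x).symm.trans ((hrange _).trans ?_)
    exact exists_congr fun n => by rw [← hek, e.injective.eq_iff]
  refine ⟨isLocallyNilpotent_weightPart_limit hρ hR hA hX hk hkinj hkrange,
    finite_weightPart_limit hρ hR hA hX hk hkinj hkrange, ?_⟩
  have := (isScalarExtension_weightPart_limit hρ hR hA hX hk hkinj hkrange).of_linearEquiv e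
  rwa [show e.toLinearMap.toAddMonoidHom.comp k = j from AddMonoidHom.ext hek] at this

/-- Extensions of scalars of modules in category `𝒪`. -/
lemma categoryOFrechet_of_isScalarExtension {M : ModuleCat.{u} (inverseLimit ρ)} {N : Type u}
    [AddCommGroup N] [Module R N] [Module.Finite R N] (hN : IsLocallyNilpotent B d N) {j : N →+ M}
    (hj : IsScalarExtension (R := R) (S := inverseLimit ρ) R.val.toRingHom j) :
    categoryOFrechet R A d M ∧ Function.Injective j ∧
      ∀ x, x ∈ weightPart (actionEnd K (d : inverseLimit ρ) M) ↔ ∃ n, j n = x := by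
  let _ : Module K N := Module.compHom N (algebraMap K R)
  have _ : IsScalarTower K R N := ⟨fun c r m => by
    rw [Algebra.smul_def, mul_smul]
    rfl⟩
  obtain ⟨X, k, hk⟩ := ModuleSystem.exists_extension (R := R) (ρ := ρ)
    (fun n => (toLevel R n).toRingHom) toLevel_trans N
  have hX : limitO R A d X := limitO_of_isScalarExtension hR hA hN hk
  have hkSE : IsScalarExtension (R := R) (S := inverseLimit ρ) R.val.toRingHom k :=
    isScalarExtension_lim_of_level hρ hR hk
  obtain ⟨hkinj, hkrange⟩ := weightPart_lim_of_isScalarExtension hρ hR hA hN hk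
  let e : X.lim ≃ₗ[inverseLimit ρ] M := hkSE.equiv.symm.trans hj.equiv
  have he : ∀ n, e (k n) = j n := fun n => by
    change hj.equiv (hkSE.equiv.symm (k n)) = j n
    rw [IsScalarExtension.equiv_symm, IsScalarExtension.equiv_unit]
  refine ⟨⟨X, hX, ⟨e.toModuleIso⟩⟩, fun x y hxy => hkinj (e.injective (by rw [he, he, hxy])),
    fun x => ?_⟩
  obtain ⟨y, rfl⟩ := e.surjective x
  refine (e.mem_weightPart_iff (d : inverseLimit ρ) y).trans ((hkrange y).trans ?_)
  exact exists_congr fun n => by rw [← he, e.injective.eq_iff]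

lemma exists_weightPart_of_categoryOFrechet {M : ModuleCat.{u} (inverseLimit ρ)}
    (hM : categoryOFrechet R A d M) :
    ∃ (N : Type u) (_ : AddCommGroup N) (_ : Module R N) (j : N →+ M),
      Module.Finite R N ∧ IsLocallyNilpotent B d N ∧
      (∀ x, x ∈ weightPart (actionEnd K (d : inverseLimit ρ) M) ↔ ∃ n, j n = x) ∧
      Function.Injective j ∧
      IsScalarExtension (R := R) (S := inverseLimit ρ) R.val.toRingHom j := by
  obtain ⟨N, _, _, _, _, j, hj, hinj, hrange⟩ := exists_weightPart_module R.val
    (hR.level 0).algebraic.grading M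
  obtain ⟨h1, h2, h3⟩ := weightPart_of_categoryOFrechet hρ hR hA hM hj hinj hrange
  exact ⟨N, _, _, j, h2, h1, hrange, hinj, h3⟩

end FrechetCategory

/-! ### Full faithfulness and closure properties of the limit category -/

section FrechetCategory

variable {K : Type w} [NontriviallyNormedField K] [CompleteSpace K] [CharZero K]
  [IsUltrametricDist K] {𝓡 : ℕ → Type u} [∀ n, NormedRing (𝓡 n)] [∀ n, NormedAlgebra K (𝓡 n)]
  [∀ n, CompleteSpace (𝓡 n)] [∀ n, IsUltrametricDist (𝓡 n)] {ρ : ∀ n, 𝓡 (n + 1) →ₐ[K] 𝓡 n}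
  (hρ : IsFrechetStein ρ) {R : Subalgebra K (inverseLimit ρ)} {A B H : Subalgebra K R} {d : R}
  (hR : IsFrechetTriangularDecomposition R A B H d)
  (hA : ∀ n, IsNoetherianRing (levelClosure R A n))

omit [CompleteSpace K] [CharZero K] [IsUltrametricDist K] [∀ n, CompleteSpace (𝓡 n)]
  [∀ n, IsUltrametricDist (𝓡 n)] in
lemma categoryOFrechet_le_coadmissible : categoryOFrechet R A d ≤ coadmissible ρ := by
  rintro M ⟨X, hX, e⟩
  exact ⟨X, fun n => (hX n).1, e⟩

include hρ hR hA

lemma full_limitFunctor : ((limitO R A d).ι ⋙ ModuleSystem.limitFunctor ρ).Full where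
  map_surjective {X Y} f := by
    obtain ⟨φ, hφ⟩ := exists_hom_of_lim (X := X.obj) (Y := Y.obj) hρ hR hA X.property f.hom
    exact ⟨(limitO R A d).homMk φ, ModuleCat.hom_ext hφ⟩

lemma faithful_limitFunctor : ((limitO R A d).ι ⋙ ModuleSystem.limitFunctor ρ).Faithful where
  map_injective {X Y} _ _ h :=
    ObjectProperty.hom_ext _ (hom_ext_of_lim (X := X.obj) (Y := Y.obj) hρ hR hA X.property
      (congrArg ModuleCat.Hom.hom h))

lemma categoryOFrechet_of_isClosed {X : ModuleSystem ρ} (hX : limitO R A d X)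
    {Q : Submodule (inverseLimit ρ) X.lim} (hQ : IsClosed (Q : Set X.lim)) :
    categoryOFrechet R A d (ModuleCat.of _ Q) := by
  obtain ⟨Y, hY, ⟨e⟩⟩ := exists_system_of_isClosed hρ hR hA hX hQ
  exact ⟨Y, hY, ⟨e.toModuleIso⟩⟩

/-- The kernel is the intersection of the preimages of the kernels at the levels, and these are
submodules of finitely generated Banach modules, hence closed. -/
lemma isClosed_ker_limMap {X Y : ModuleSystem ρ} (hX : limitO R A d X) (φ : X ⟶ Y) :
    IsClosed (LinearMap.ker (ModuleSystem.limMap φ) : Set X.lim) := by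
  have : (LinearMap.ker (ModuleSystem.limMap φ) : Set X.lim) =
      ⋂ n, X.eval n ⁻¹' (LinearMap.ker (φ.app n).hom : Set (X.obj n)) := by
    ext x
    rw [Set.mem_iInter]
    refine ⟨fun hx n => ?_, fun hx => ModuleSystem.lim_ext fun n => ?_⟩
    · have h := congrArg (Y.eval n) (LinearMap.mem_ker.1 hx)
      rwa [ModuleSystem.eval_limMap, map_zero] at h
    · rw [ModuleSystem.eval_limMap, map_zero]
      exact hx n
  rw [this]
  refine isClosed_iInter fun n => IsClosed.preimage (X.continuous_eval n) ?_
  have := hρ.noetherian n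
  have : Module.Finite (𝓡 n) (X.obj n) := (hX n).1
  exact isClosed_submodule K (LinearMap.ker (φ.app n).hom)

theorem isExactModuleClass_categoryOFrechet : IsExactModuleClass (categoryOFrechet R A d) where
  of_equiv e := by
    rintro ⟨X, hX, ⟨e'⟩⟩
    exact ⟨X, hX, ⟨e' ≪≫ e.toModuleIso⟩⟩
  ker {M N} f := by
    rintro ⟨X, hX, ⟨a⟩⟩ ⟨Y, _, ⟨b⟩⟩
    let a' : X.lim ≃ₗ[inverseLimit ρ] M := a.toLinearEquiv
    let b' : Y.lim ≃ₗ[inverseLimit ρ] N := b.toLinearEquiv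
    -- Since `f` comes from a morphism of systems, its kernel is a closed submodule and the theorem
    -- on closed submodules applies.
    obtain ⟨φ, hφ⟩ := exists_hom_of_lim hρ hR hA hX
      (b'.symm.toLinearMap.comp (f.comp a'.toLinearMap))
    have hker : (LinearMap.ker f).comap a'.toLinearMap = LinearMap.ker (ModuleSystem.limMap φ) := by
      rw [hφ, LinearEquiv.ker_comp, LinearMap.ker_comp]
    obtain ⟨Z, hZ, ⟨e⟩⟩ := exists_system_of_isClosed hρ hR hA hX
      (hker ▸ isClosed_ker_limMap hρ hR hA hX φ)
    exact ⟨Z, hZ, ⟨(e.trans (a'.ofSubmodule' (LinearMap.ker f))).toModuleIso⟩⟩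
  coker {M N} f hM hN := by
    obtain ⟨V, _, _, j, _, hV, hj, -, hjS⟩ :=
      exists_weightPart_of_categoryOFrechet hρ hR hA hM
    obtain ⟨W, _, _, k, _, hW, hk, hkinj, hkS⟩ :=
      exists_weightPart_of_categoryOFrechet hρ hR hA hN
    -- `f` maps weight vectors to weight vectors and so restricts to a map `V → W` in `𝒪`. The
    -- cokernel of `f` is the extension of scalars of the cokernel of this restriction.
    choose g hg using fun m => (hk (f (j m))).1 (f.map_mem_weightPart _ ((hj _).2 ⟨m, rfl⟩))
    let g' : V →ₗ[R] W :=
      { toFun := g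
        map_add' := fun x y => hkinj (by simp only [map_add, hg])
        map_smul' := fun r x => hkinj (by
          rw [RingHom.id_apply, hkS.smul, hg, hg, hjS.smul, map_smul]) }
    obtain ⟨C, _, _, π, c, hπ, hc⟩ := IsScalarExtension.exists_cokernel (R := R) hjS hkS g' f
      fun m => (hg m).symm
    have : Module.Finite R C := Module.Finite.of_surjective π hπ
    exact (categoryOFrechet_of_isScalarExtension (M := ModuleCat.of _ (N ⧸ LinearMap.range f))
      hρ hR hA (hW.of_surjective π hπ) hc).1
  pi {J} _ M hM := by
    choose V i1 i2 j hfin hV _ _ hjS using fun i =>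
      exists_weightPart_of_categoryOFrechet hρ hR hA (hM i)
    obtain ⟨k, hk⟩ := IsScalarExtension.exists_pi (R := R) hjS
    exact (categoryOFrechet_of_isScalarExtension (M := ModuleCat.of _ (∀ i, M i))
      hρ hR hA (IsLocallyNilpotent.pi hV) hk).1

end FrechetCategory

/-! ## The equivalence of categories -/

section WeightEquivalence

variable {K : Type w} [Field K] {R S : Type u} [Ring R] [Algebra K R] [Ring S] [Algebra K S]
  (i : R →ₐ[K] S) {d : R} (hd : DirectSum.IsInternal (adGrading K d))

/-- The weight part of an `S`-module, as an `R`-module. -/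
abbrev restrictWs : ModuleCat.{u} S ⥤ ModuleCat.{u} R :=
  ModuleCat.restrictScalars i.toRingHom ⋙ wsFunctor hd

/-- The inclusion of the weight part. -/
def wsInclusion (M : ModuleCat.{u} S) : (restrictWs i hd).obj M →+ M :=
  (wsSubmodule hd ((ModuleCat.restrictScalars i.toRingHom).obj M)).subtype.toAddMonoidHom

lemma wsInclusion_injective (M : ModuleCat.{u} S) : Function.Injective (wsInclusion i hd M) :=
  Subtype.val_injective

lemma wsInclusion_smul (M : ModuleCat.{u} S) (r : R) (x : (restrictWs i hd).obj M) :
    wsInclusion i hd M (r • x) = i r • wsInclusion i hd M x := rfl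

/-- The restricted module acquires its `K`-structure through `R`. It agrees with the one through `S`
only by `i.commutes`, so weight vectors are carried back and forth explicitly. -/
lemma mem_weightPart_iff_wsInclusion (M : ModuleCat.{u} S) (x : M) :
    x ∈ weightPart (actionEnd K (i d) M) ↔ ∃ y, wsInclusion i hd M y = x := by
  have h1 : ∀ (c : K) (m : M), (c • (show (ModuleCat.restrictScalars i.toRingHom).obj M from m) :
      (ModuleCat.restrictScalars i.toRingHom).obj M) = (c • m : M) := fun c m => by
    change i (algebraMap K R c) • m = algebraMap K S c • m
    rw [i.commutes]
  let f : M →+ (ModuleCat.restrictScalars i.toRingHom).obj M := AddMonoidHom.id M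
  let g : (ModuleCat.restrictScalars i.toRingHom).obj M →+ M := AddMonoidHom.id M
  have hf : ∀ x, x ∈ weightPart (actionEnd K (i d) M) →
      f x ∈ weightPart (actionEnd K d ((ModuleCat.restrictScalars i.toRingHom).obj M)) := by
    intro x hx
    rw [weightPart] at hx
    induction hx using Submodule.iSup_induction' with
    | mem l x hx =>
      exact Submodule.mem_iSup_of_mem l (map_mem_maxGenEigenspace f
        (fun m => congrArg (i d • m - ·) (h1 l m)) hx)
    | zero => rw [map_zero]; exact zero_mem _
    | add x y _ _ hx hy => rw [map_add]; exact add_mem hx hy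
  have hg : ∀ x, x ∈ weightPart (actionEnd K d ((ModuleCat.restrictScalars i.toRingHom).obj M)) →
      g x ∈ weightPart (actionEnd K (i d) M) := by
    intro x hx
    rw [weightPart] at hx
    induction hx using Submodule.iSup_induction' with
    | mem l x hx =>
      exact Submodule.mem_iSup_of_mem l (map_mem_maxGenEigenspace g
        (fun m => (congrArg (i d • (show M from m) - ·) (h1 l m)).symm) hx)
    | zero => rw [map_zero]; exact zero_mem _
    | add x y _ _ hx hy => rw [map_add]; exact add_mem hx hy
  exact ⟨fun hx => ⟨⟨x, hf x hx⟩, rfl⟩, fun ⟨y, hy⟩ => hy ▸ hg _ y.2⟩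

variable {i} {P : ObjectProperty (ModuleCat.{u} R)} {Q : ObjectProperty (ModuleCat.{u} S)}
  (hP : ∀ {N : ModuleCat.{u} R} {M : ModuleCat.{u} S} {j : N →+ M}, P N →
    IsScalarExtension i.toRingHom j → Q M ∧ Function.Injective j ∧
      ∀ x, x ∈ weightPart (actionEnd K (i d) M) ↔ ∃ n, j n = x)
  (hQ : ∀ {N : ModuleCat.{u} R} {M : ModuleCat.{u} S} {j : N →+ M}, Q M →
    (∀ r n, j (r • n) = i r • j n) → Function.Injective j →
      (∀ x, x ∈ weightPart (actionEnd K (i d) M) ↔ ∃ n, j n = x) →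
      P N ∧ IsScalarExtension i.toRingHom j)

-- The unit of the equivalence: the image of `M` in its extension of scalars is exactly the weight
-- part.
include hP in
lemma exists_wsUnitEquiv {M : ModuleCat.{u} R} (hM : P M) :
    ∃ e : M ≃ₗ[R] (restrictWs i hd).obj ((extendScalarsNC i.toRingHom).obj M),
      ∀ m, wsInclusion i hd _ (e m) = BaseChange.unit i.toRingHom M m := by
  obtain ⟨-, hinj, hrange⟩ := hP (M := (extendScalarsNC i.toRingHom).obj M) hM
    (IsScalarExtension.unit i.toRingHom M)
  choose e he using fun m => (mem_weightPart_iff_wsInclusion i hd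
    ((extendScalarsNC i.toRingHom).obj M) _).1 ((hrange _).2 ⟨m, rfl⟩)
  let e' : M →ₗ[R] (restrictWs i hd).obj ((extendScalarsNC i.toRingHom).obj M) :=
    { toFun := e
      map_add' := fun x y => wsInclusion_injective i hd _ (by
        rw [map_add, he, he, he]
        exact map_add (BaseChange.unit i.toRingHom M) x y)
      map_smul' := fun r x => wsInclusion_injective i hd _ (by
        rw [RingHom.id_apply, wsInclusion_smul, he, he]
        exact BaseChange.unit_smul _ r x) }
  refine ⟨LinearEquiv.ofBijective e' ⟨fun x y h => hinj ?_, fun x => ?_⟩, he⟩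
  · exact (he x).symm.trans ((congrArg (wsInclusion i hd _) h).trans (he y))
  · obtain ⟨m, hm⟩ := (hrange _).1 ((mem_weightPart_iff_wsInclusion i hd _ _).2 ⟨x, rfl⟩)
    exact ⟨m, wsInclusion_injective i hd _ ((he m).trans hm)⟩

include hP hQ in
/-- Extension of scalars and the weight part are mutually inverse equivalences. -/
theorem exists_equivalence_of_weights :
    ∃ (hext : ∀ M : P.FullSubcategory, Q ((P.ι ⋙ extendScalarsNC i.toRingHom).obj M))
      (hws : ∀ N : Q.FullSubcategory, P ((Q.ι ⋙ restrictWs i hd).obj N))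
      (e : P.FullSubcategory ≌ Q.FullSubcategory),
      e.functor = ObjectProperty.lift _ _ hext ∧ e.inverse = ObjectProperty.lift _ _ hws := by
  choose η hη using fun M : P.FullSubcategory => exists_wsUnitEquiv hd hP M.property
  have hext : ∀ M : P.FullSubcategory, Q ((P.ι ⋙ extendScalarsNC i.toRingHom).obj M) := fun M =>
    (hP M.property (IsScalarExtension.unit i.toRingHom M.obj)).1
  have hws := fun N : Q.FullSubcategory => hQ N.property (wsInclusion_smul i hd N.obj)
    (wsInclusion_injective i hd N.obj) (mem_weightPart_iff_wsInclusion i hd N.obj)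
  let F : P.FullSubcategory ⥤ Q.FullSubcategory := ObjectProperty.lift _ _ hext
  let G : Q.FullSubcategory ⥤ P.FullSubcategory :=
    ObjectProperty.lift P (Q.ι ⋙ restrictWs i hd) fun N => (hws N).1
  let η' : 𝟭 P.FullSubcategory ≅ F ⋙ G := NatIso.ofComponents
    (fun M => P.isoMk (X := M) (Y := G.obj (F.obj M)) (η M).toModuleIso) fun {M N} f => ?_
  let ε : G ⋙ F ≅ 𝟭 Q.FullSubcategory := NatIso.ofComponents
    (fun N => Q.isoMk (X := F.obj (G.obj N)) (Y := N) (hws N).2.equiv.toModuleIso) fun {M N} f => ?_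
  refine ⟨hext, fun N => (hws N).1, CategoryTheory.Equivalence.mk F G η' ε, rfl, rfl⟩
  · refine ObjectProperty.hom_ext _ (ModuleCat.hom_ext (BaseChange.hom_ext fun s m => ?_))
    exact (f.hom.hom.map_smul s _).symm
  · refine ObjectProperty.hom_ext _ (ModuleCat.hom_ext (LinearMap.ext fun m => ?_))
    refine wsInclusion_injective i hd _ ?_
    refine (hη N (f.hom.hom m)).trans ?_
    exact (congrArg (BaseChange.map i.toRingHom f.hom.hom) (hη M m)).symm

end WeightEquivalence

/-! ## Extension of scalars between algebras with weights -/

section WeightedExtension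

variable {K : Type w} [NontriviallyNormedField K] {𝒜' 𝒜 : Type u} [Ring 𝒜'] [Algebra K 𝒜']
  [NormedRing 𝒜] [NormedAlgebra K 𝒜] {δ' : Module.End K 𝒜'} {δ : Module.End K 𝒜}
  (f : 𝒜' →ₐ[K] 𝒜) {M' : Type u} [AddCommGroup M'] [Module 𝒜' M'] [Module K M']
  [IsScalarTower K 𝒜' M'] {D' : Module.End K M'}

instance isScalarTower_baseChange : IsScalarTower K 𝒜 (BaseChange f.toRingHom M') :=
  ⟨fun c a y => by
    induction y using BaseChange.induction_on with
    | zero => simp only [smul_zero]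
    | add x y hx hy => simp only [smul_add, hx, hy]
    | tmul b m =>
      rw [BaseChange.smul_tmul, BaseChange.smul_tmul, smul_mul_assoc]
      rfl⟩

/-- The weight operator on an extension of scalars. -/
lemma exists_baseChange_end (hδ : ∀ a b, δ (a * b) = δ a * b + a * δ b)
    (hf : ∀ a, f (δ' a) = δ (f a)) (hD' : ∀ (a : 𝒜') (m : M'), D' (a • m) = δ' a • m + a • D' m) :
    ∃ D : Module.End K (BaseChange f.toRingHom M'), ∀ a m, D (BaseChange.tmul f.toRingHom a m) =
      BaseChange.tmul f.toRingHom (δ a) m + BaseChange.tmul f.toRingHom a (D' m) := by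
  let φ : 𝒜 →+ M' →+ BaseChange f.toRingHom M' := AddMonoidHom.mk' (fun a =>
    AddMonoidHom.mk' (fun m => BaseChange.tmul f.toRingHom (δ a) m +
      BaseChange.tmul f.toRingHom a (D' m)) fun m m' => by
        simp only [map_add, BaseChange.tmul_add]
        abel) fun a a' => by
          ext m
          simp only [AddMonoidHom.mk'_apply, AddMonoidHom.add_apply, map_add, BaseChange.add_tmul]
          abel
  let D₀ : BaseChange f.toRingHom M' →+ BaseChange f.toRingHom M' :=
    BaseChange.liftAdd f.toRingHom φ fun a b m => by
      change BaseChange.tmul f.toRingHom (δ (a * f b)) m +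
          BaseChange.tmul f.toRingHom (a * f b) (D' m) =
        BaseChange.tmul f.toRingHom (δ a) (b • m) + BaseChange.tmul f.toRingHom a (D' (b • m))
      rw [hD', BaseChange.tmul_add, BaseChange.tmul_smul, BaseChange.tmul_smul,
        BaseChange.tmul_smul, hδ, BaseChange.add_tmul, ← hf]
      exact add_assoc _ _ _
  have h0 : ∀ a m, D₀ (BaseChange.tmul f.toRingHom a m) =
      BaseChange.tmul f.toRingHom (δ a) m + BaseChange.tmul f.toRingHom a (D' m) := fun _ _ => rfl
  refine ⟨{ D₀ with map_smul' := fun c y => ?_ }, h0⟩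
  change D₀ (c • y) = c • D₀ y
  induction y using BaseChange.induction_on with
  | zero => simp only [smul_zero, map_zero]
  | add x y hx hy => simp only [smul_add, map_add, hx, hy]
  | tmul b m =>
    have h1 : ∀ (b : 𝒜) (m : M'), c • BaseChange.tmul f.toRingHom b m =
        BaseChange.tmul f.toRingHom (c • b) m := fun _ _ => rfl
    rw [h1, h0, h0, smul_add, h1, h1, map_smul]

variable [IsUltrametricDist K] [CharZero K] [CompleteSpace 𝒜] [IsUltrametricDist 𝒜]
  [IsNoetherianRing 𝒜] (hδ : IsWeightDerivation δ) (hf : ∀ a, f (δ' a) = δ (f a))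
  (hD' : ∀ (a : 𝒜') (m : M'), D' (a • m) = δ' a • m + a • D' m)
  {M : Type*} [AddCommGroup M] [Module 𝒜 M] [Module K M] [IsScalarTower K 𝒜 M]
  {D : Module.End K M} (hD : ∀ (a : 𝒜) (m : M), D (a • m) = δ a • m + a • D m)

include hδ hf hD' hD in
/-- A semilinear map which is bijective on weight parts is an extension of scalars. -/
theorem isScalarExtension_of_weights [Module.Finite 𝒜' M']
    (hspan' : Submodule.span 𝒜' (weightPart D' : Set M') = ⊤)
    (hspan : Submodule.span 𝒜 (weightPart D : Set M) = ⊤)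
    (hlift : ∀ (n : ℕ) a, δ a = (n : K) • a → ∃ a', δ' a' = (n : K) • a' ∧ f a' = a)
    {t : M' →+ M} (ht : ∀ a m, t (a • m) = f a • t m) (htD : ∀ m, D (t m) = t (D' m))
    (hinj : ∀ m ∈ weightPart D', t m = 0 → m = 0)
    (hsurj : ∀ l, ∀ y ∈ D.maxGenEigenspace l, ∃ m, t m = y) :
    IsScalarExtension f.toRingHom t := by
  refine ⟨ht, ?_, ?_⟩
  -- The operator `E = δ ⊗ 1 + 1 ⊗ D'` makes `𝒜 ⊗ M'` a weighted module compatible with `φ`, so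
  -- injectivity of `φ` may be tested on weight vectors.
  · obtain ⟨E, hE⟩ := exists_baseChange_end (M' := M') f hδ.leibniz hf hD'
    set φ := BaseChange.lift f.toRingHom t ht
    have hφ : ∀ a m, φ (BaseChange.tmul f.toRingHom a m) = a • t m := fun _ _ => rfl
    have hφE : ∀ y, φ (E y) = D (φ y) := fun y => by
      induction y using BaseChange.induction_on with
      | zero => simp only [map_zero]
      | add x y hx hy => simp only [map_add, hx, hy]
      | tmul a m => rw [hE, map_add, hφ, hφ, hφ, hD, htD]
    have hEl : ∀ a y, E (a • y) = δ a • y + a • E y := fun a y => by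
      induction y using BaseChange.induction_on with
      | zero => simp only [smul_zero, map_zero, add_zero]
      | add x y hx hy =>
        simp only [smul_add, map_add, hx, hy]
        abel
      | tmul b m =>
        rw [BaseChange.smul_tmul, hE, hE, hδ.leibniz, BaseChange.add_tmul, smul_add,
          BaseChange.smul_tmul, BaseChange.smul_tmul, BaseChange.smul_tmul]
        exact add_assoc _ _ _
    let e := BaseChange.unit f.toRingHom M'
    have hone : δ 1 = 0 := by simpa using hδ.leibniz 1 1
    have hEe : ∀ m, E (e m) = e (D' m) := fun m => by
      change E (BaseChange.tmul f.toRingHom 1 m) = BaseChange.tmul f.toRingHom 1 (D' m)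
      rw [hE, hone, BaseChange.zero_tmul, zero_add]
    have hec : ∀ (c : K) m, e (c • m) = c • e m := fun c m => by
      rw [← algebraMap_smul 𝒜' c m]
      refine (BaseChange.unit_smul f.toRingHom _ m).trans ?_
      change f (algebraMap K 𝒜' c) • e m = _
      rw [f.commutes, algebraMap_smul]
    have hew : ∀ l, ∀ m ∈ D'.maxGenEigenspace l, e m ∈ E.maxGenEigenspace l := fun l m hm =>
      map_mem_maxGenEigenspace e (fun m => by rw [hEe, map_sub, hec]) hm
    obtain ⟨s, wt, hs, hs'⟩ := exists_weight_generators hspan'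
    have hgen : Submodule.span 𝒜 (Set.range fun i : s => e i) = ⊤ := by
      rw [eq_top_iff, ← BaseChange.span_range_unit f.toRingHom, Submodule.span_le]
      rintro _ ⟨m, rfl⟩
      have hm : m ∈ Submodule.span 𝒜' (Set.range fun i : s => (i : M')) := hs' ▸ Submodule.mem_top
      induction hm using Submodule.span_induction with
      | mem m hm =>
        obtain ⟨i, rfl⟩ := hm
        exact Submodule.subset_span ⟨i, rfl⟩
      | zero => rw [map_zero]; exact zero_mem _
      | add x y _ _ hx hy => rw [map_add]; exact add_mem hx hy
      | smul a x _ hx =>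
        rw [BaseChange.unit_smul]
        exact Submodule.smul_mem _ _ hx
    have : Module.Finite 𝒜 (BaseChange f.toRingHom M') :=
      ⟨⟨Set.finite_range (fun i : s => e i) |>.toFinset, by rw [Set.Finite.coe_toFinset, hgen]⟩⟩
    have hew' : ∀ i : s, e i ∈ E.maxGenEigenspace (wt i) := fun i => hew _ _ (hs i)
    refine injective_of_injective_on_weights hδ hEl (span_weightPart_of_generators hew' hgen) φ
      (fun y hy => by rw [hφE, hy, map_zero]) fun l y hy hy0 => ?_
    -- Weight vectors of `𝒜 ⊗ M'` are combinations of homogeneous elements of `𝒜` times generators.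
    -- By `hlift` these elements already live in `𝒜'`, so the vector comes from the weight part of
    -- `M'`, where `t` is injective.
    have hpre : ∃ m ∈ weightPart D', e m = y := by
      rw [maxGenEigenspace_eq_weightSpan hδ hEl hew' hgen, weightSpan] at hy
      clear hy0
      induction hy using Submodule.iSup_induction' with
      | mem i y hy =>
        induction hy using Submodule.iSup_induction' with
        | mem n y hy =>
          obtain ⟨a, ha, rfl⟩ := hy
          obtain ⟨a', ha', rfl⟩ := hlift n a (Module.End.mem_eigenspace_iff.1 ha)
          exact ⟨a' • (i : M'), Submodule.mem_iSup_of_mem (wt i + n)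
            (smul_mem_maxGenEigenspace hD' ha' (hs i)), BaseChange.unit_smul f.toRingHom a' _⟩
        | zero => exact ⟨0, zero_mem _, map_zero _⟩
        | add x y _ _ hx hy =>
          obtain ⟨a, ha, rfl⟩ := hx
          obtain ⟨b, hb, rfl⟩ := hy
          exact ⟨a + b, add_mem ha hb, map_add _ _ _⟩
      | zero => exact ⟨0, zero_mem _, map_zero _⟩
      | add x y _ _ hx hy =>
        obtain ⟨a, ha, rfl⟩ := hx
        obtain ⟨b, hb, rfl⟩ := hy
        exact ⟨a + b, add_mem ha hb, map_add _ _ _⟩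
    obtain ⟨m, hm, rfl⟩ := hpre
    rw [hinj m hm ((BaseChange.lift_unit f.toRingHom t ht m).symm.trans hy0), map_zero]
  · rw [← LinearMap.range_eq_top, eq_top_iff, ← hspan, Submodule.span_le]
    intro y hy
    change y ∈ weightPart D at hy
    rw [weightPart] at hy
    induction hy using Submodule.iSup_induction' with
    | mem l y hy =>
      obtain ⟨m, rfl⟩ := hsurj l y hy
      exact ⟨BaseChange.unit f.toRingHom M' m, BaseChange.lift_unit _ _ _ _⟩
    | zero => exact zero_mem _
    | add x y _ _ hx hy => exact add_mem hx hy

end WeightedExtension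

/-! ## Co-admissibility over the closure of the positive part -/

namespace ModuleSystem

variable {K : Type w} [Field K] {𝓢 𝓣 : ℕ → Type u} [∀ n, Ring (𝓢 n)] [∀ n, Algebra K (𝓢 n)]
  [∀ n, Ring (𝓣 n)] [∀ n, Algebra K (𝓣 n)] {ρ : ∀ n, 𝓢 (n + 1) →ₐ[K] 𝓢 n}
  {σ : ∀ n, 𝓣 (n + 1) →ₐ[K] 𝓣 n}

/-- Restriction of scalars of a system along a homomorphism of towers. -/
lemma exists_restrictScalars (X : ModuleSystem ρ) [∀ n, Module (𝓣 n) (X.obj n)]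
    (h : ∀ n, IsScalarExtension (σ n).toRingHom (X.transHom n))
    (ι : inverseLimit σ →+* inverseLimit ρ)
    (hι : ∀ n (a : inverseLimit σ) (x : X.obj n), (ι a).1 n • x = a.1 n • x) :
    ∃ Y : ModuleSystem σ, (∀ n, Nonempty (X.obj n ≃ₗ[𝓣 n] Y.obj n)) ∧
      Nonempty (Y.lim ≅ (ModuleCat.restrictScalars ι).obj X.lim) := by
  obtain ⟨Y, e, he⟩ := exists_system (ρ := σ) (fun n => X.obj n) X.transHom h
  choose G hG using fun x : X.lim => Y.exists_lim (fun n => e n (X.eval n x)) fun n => by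
    rw [he, X.transHom_eval]
  have hadd : ∀ x y, G (x + y) = G x + G y := fun x y => lim_ext fun n => by
    rw [map_add, hG, hG, hG, map_add, map_add]
  have hsmul : ∀ (a : inverseLimit σ) x, G (ι a • x) = a • G x := fun a x => lim_ext fun n => by
    rw [hG, X.eval_smul, Y.eval_smul, hG, ← (e n).map_smul, hι]
  have hinj : Function.Injective G := fun x y hxy => lim_ext fun n => (e n).injective (by
    rw [← hG, ← hG, hxy])
  have hsurj : Function.Surjective G := fun y => by
    obtain ⟨x, hx⟩ := X.exists_lim (fun n => (e n).symm (Y.eval n y)) fun n =>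
      (e n).injective (by rw [← he, LinearEquiv.apply_symm_apply, LinearEquiv.apply_symm_apply,
        Y.transHom_eval])
    exact ⟨x, lim_ext fun n => (hG x n).trans (by rw [hx, LinearEquiv.apply_symm_apply])⟩
  let G' : (ModuleCat.restrictScalars ι).obj X.lim →ₗ[inverseLimit σ] Y.lim :=
    { toFun := G
      map_add' := hadd
      map_smul' := hsmul }
  have hG' : Function.Bijective G' := ⟨hinj, hsurj⟩
  exact ⟨Y, fun n => ⟨e n⟩, ⟨(LinearEquiv.ofBijective G' hG').symm.toModuleIso⟩⟩

end ModuleSystem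

/-- Both closures have the graded pieces of the same `A` as weight spaces, which supplies the
lifting of homogeneous elements; the remaining hypotheses concern only weight parts. -/
theorem IsBanachTriangularDecomposition.isScalarExtension_closure {K : Type w}
    [NontriviallyNormedField K] [CompleteSpace K] [CharZero K] [IsUltrametricDist K] {R : Type u}
    [Ring R] [Algebra K R] {S' S : Type u} [NormedRing S'] [NormedAlgebra K S'] [CompleteSpace S']
    [IsUltrametricDist S'] [NormedRing S] [NormedAlgebra K S] [CompleteSpace S]
    [IsUltrametricDist S] {i' : R →ₐ[K] S'} {i : R →ₐ[K] S} {d : R} {A B H : Subalgebra K R}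
    (hS' : IsBanachTriangularDecomposition i' A B H d)
    (hS : IsBanachTriangularDecomposition i A B H d) [IsNoetherianRing (imageClosure i A)]
    {g : S' →ₐ[K] S} (hg : ∀ r, g (i' r) = i r) {f : imageClosure i' A →ₐ[K] imageClosure i A}
    (hf : ∀ a, (f a : S) = g a) {M' : Type u} [AddCommGroup M'] [Module S' M'] [Module K M']
    [IsScalarTower K S' M'] [Module.Finite (imageClosure i' A) M'] {M : Type u} [AddCommGroup M]
    [Module S M] [Module K M] [IsScalarTower K S M]
    (hM' : Submodule.span (imageClosure i' A)
      (weightPart (Algebra.lsmul K K M' (i' d)) : Set M') = ⊤)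
    (hM : Submodule.span (imageClosure i A) (weightPart (Algebra.lsmul K K M (i d)) : Set M) = ⊤)
    {t : M' →+ M} (ht : ∀ a m, t (a • m) = g a • t m)
    (hinj : ∀ m ∈ weightPart (Algebra.lsmul K K M' (i' d)), t m = 0 → m = 0)
    (hsurj : ∀ l, ∀ y ∈ (Algebra.lsmul K K M (i d)).maxGenEigenspace l, ∃ m, t m = y) :
    IsScalarExtension f.toRingHom t := by
  obtain ⟨δ', hδ'i, hδ', hδ'A⟩ := hS'.exists_derivation_A
  obtain ⟨δ, hδi, hδ, hδA⟩ := hS.exists_derivation_A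
  refine isScalarExtension_of_weights f hδ (fun a => Subtype.ext ?_) (leibniz_lsmul hδ'i)
    (leibniz_lsmul hδi) hM' hM (fun k a ha => ?_) (fun a m => ?_) (fun m => ?_) hinj hsurj
  · rw [hδi, hf, hδ'i, map_sub, map_mul, map_mul, hg, hf]
  · obtain ⟨c, hc, rfl⟩ := (hδA k a).1 ha
    exact ⟨toClosure i' A c, (hδ'A k _).2 ⟨c, hc, rfl⟩, Subtype.ext ((hf _).trans (hg c))⟩
  · rw [Subalgebra.smul_def, Subalgebra.smul_def, ht, hf]
  · rw [Algebra.lsmul_coe, Algebra.lsmul_coe, ht, hg]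

section CoadmissibleClosure

variable {K : Type w} [NontriviallyNormedField K] [CompleteSpace K] [CharZero K]
  [IsUltrametricDist K] {𝓡 : ℕ → Type u} [∀ n, NormedRing (𝓡 n)] [∀ n, NormedAlgebra K (𝓡 n)]
  [∀ n, CompleteSpace (𝓡 n)] [∀ n, IsUltrametricDist (𝓡 n)] {ρ : ∀ n, 𝓡 (n + 1) →ₐ[K] 𝓡 n}
  (hρ : IsFrechetStein ρ) {R : Subalgebra K (inverseLimit ρ)} {A B H : Subalgebra K R} {d : R}
  (hR : IsFrechetTriangularDecomposition R A B H d)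
  (hA : ∀ n, IsNoetherianRing (levelClosure R A n))

include hR hA

/-- The compatibility required of a coherent system over `𝒜`. It is not formal from the
compatibility over `𝓡(n)`; it uses that transition maps are bijective on weight parts. -/
lemma isScalarExtension_closureTransition {X : ModuleSystem ρ} (hX : limitO R A d X) (n : ℕ) :
    IsScalarExtension (R := levelClosure R A (n + 1)) (S := levelClosure R A n)
      (closureTransition hρ.continuous R A n).toRingHom (X.transHom n) := by
  have := hA n
  have : Module.Finite (levelClosure R A (n + 1)) (X.obj (n + 1)) := (hX (n + 1)).2.1
  have hg : ∀ r : R, ρ n (toLevel R (n + 1) r) = toLevel R n r := fun r => r.1.2 n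
  have hf : ∀ a, (closureTransition hρ.continuous R A n a : 𝓡 n) = ρ n a := fun _ => rfl
  have hinj : ∀ m ∈ weightPart (X.levelEnd d (n + 1)), X.transHom n m = 0 → m = 0 :=
    fun m hm h0 => trans_injective_weightPart hρ hR hA hX hm h0
  have hsurj : ∀ l, ∀ y ∈ (X.levelEnd d n).maxGenEigenspace l, ∃ m, X.transHom n m = y :=
    fun l y hy => by
      obtain ⟨x, -, hx⟩ := exists_trans_preimage hρ hR hA hX hy
      exact ⟨x, hx⟩
  exact (hR.level (n + 1)).isScalarExtension_closure (hR.level n) hg hf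
    (limitO_span_weightPart hρ hA hX (n + 1)) (limitO_span_weightPart hρ hA hX n)
    (X.trans_smul n) hinj hsurj

theorem coadmissible_closure {M : ModuleCat.{u} (inverseLimit ρ)}
    (hM : categoryOFrechet R A d M) :
    coadmissible (𝓢 := fun n => levelClosure R A n) (closureTransition hρ.continuous R A)
      ((ModuleCat.restrictScalars (closureInclusion hρ.continuous R A)).obj M) := by
  obtain ⟨X, hX, ⟨e⟩⟩ := hM
  obtain ⟨Y, hY, ⟨a⟩⟩ := X.exists_restrictScalars (𝓣 := fun n => levelClosure R A n)
    (isScalarExtension_closureTransition hρ hR hA hX) (closureInclusion hρ.continuous R A)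
    fun n b x => rfl
  refine ⟨Y, fun n => ?_, ⟨a ≪≫ (ModuleCat.restrictScalars _).mapIso e⟩⟩
  have : Module.Finite (levelClosure R A n) (X.obj n) := (hX n).2.1
  obtain ⟨e'⟩ := hY n
  exact Module.Finite.equiv e'

end CoadmissibleClosure

end

theorem mainTheorem2 (p : ℕ) [Fact p.Prime] (K : Type w) [NontriviallyNormedField K]
    [NormedAlgebra ℚ_[p] K] [CompleteSpace K] [IsUltrametricDist K] (hK : IsDiscretelyValued K)
    (𝓡 : ℕ → Type u) [∀ n, NormedRing (𝓡 n)] [∀ n, NormedAlgebra K (𝓡 n)]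
    [∀ n, CompleteSpace (𝓡 n)] [∀ n, IsUltrametricDist (𝓡 n)]
    (ρ : ∀ n, 𝓡 (n + 1) →ₐ[K] 𝓡 n) (hρ : IsFrechetStein ρ)
    (R : Subalgebra K (inverseLimit ρ)) (A B H : Subalgebra K R) (d : R)
    (hR : IsFrechetTriangularDecomposition R A B H d)
    (hA : IsFrechetStein (𝓢 := fun n => levelClosure R A n)
      (closureTransition hρ.continuous R A))
    (hB : IsFrechetStein (𝓢 := fun n => levelClosure R B n)
      (closureTransition hρ.continuous R B)) :
    -- the limit category is a full abelian subcategory of the co-admissible modules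
    (((limitO R A d).ι ⋙ ModuleSystem.limitFunctor ρ).Full ∧
      ((limitO R A d).ι ⋙ ModuleSystem.limitFunctor ρ).Faithful ∧
      Nonempty (Abelian (categoryOFrechet R A d).FullSubcategory) ∧
      ∃ h : categoryOFrechet R A d ≤ coadmissible ρ,
        Limits.PreservesFiniteLimits (ObjectProperty.ιOfLE h) ∧
        Limits.PreservesFiniteColimits (ObjectProperty.ιOfLE h)) ∧
    -- it is closed under finite direct sums and closed submodules
    ((categoryOFrechet R A d).IsClosedUnderFiniteProducts ∧
      ∀ X : ModuleSystem ρ, limitO R A d X →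
        ∀ N : Submodule (inverseLimit ρ) ((ModuleSystem.limitFunctor ρ).obj X),
          @IsClosed _ X.limitTopology (N : Set ((ModuleSystem.limitFunctor ρ).obj X)) →
          categoryOFrechet R A d (ModuleCat.of _ N)) ∧
    -- its objects are Fréchet spaces with a weight space decomposition of finite type
    (∀ X : ModuleSystem ρ, limitO R A d X →
      @IsFrechetSpace K ((ModuleSystem.limitFunctor ρ).obj X) _ _ _ X.limitTopology ∧
      @HasFiniteTypeWeightDecomposition K ((ModuleSystem.limitFunctor ρ).obj X) _ _ _
        X.limitTopology (actionEnd K (d : inverseLimit ρ) _)) ∧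
    -- extension of scalars and the weight space functor are mutually inverse equivalences
    (Nonempty (Abelian (categoryO B d).FullSubcategory) ∧
      ∃ (hext : ∀ M : (categoryO B d).FullSubcategory, categoryOFrechet R A d
          (((categoryO B d).ι ⋙ extendScalarsNC R.val.toRingHom).obj M))
        (hd : DirectSum.IsInternal (adGrading K d))
        (hws : ∀ N : (categoryOFrechet R A d).FullSubcategory, categoryO B d
          (((categoryOFrechet R A d).ι ⋙ wsFrechet R hd).obj N))
        (e : (categoryO B d).FullSubcategory ≌ (categoryOFrechet R A d).FullSubcategory),
        e.functor = ObjectProperty.lift _ _ hext ∧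
        e.inverse = ObjectProperty.lift _ _ hws) ∧
    -- its objects are co-admissible modules over the closure of `A`
    (∀ M, categoryOFrechet R A d M →
      coadmissible (𝓢 := fun n => levelClosure R A n) (closureTransition hρ.continuous R A)
        ((ModuleCat.restrictScalars (closureInclusion hρ.continuous R A)).obj M)) := by
  have _ : CharZero K := charZero_of_injective_algebraMap (algebraMap ℚ_[p] K).injective
  have hA' : ∀ n, IsNoetherianRing (levelClosure R A n) := hA.noetherian
  have hE := isExactModuleClass_categoryOFrechet hρ hR hA'
  have : IsNoetherianRing R := (hR.level 0).algebraic.noetherian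
  have hd := (hR.level 0).algebraic.grading
  refine ⟨⟨full_limitFunctor hρ hR hA', faithful_limitFunctor hρ hR hA', ⟨hE.abelian⟩,
    categoryOFrechet_le_coadmissible, hE.preservesFiniteLimits_ιOfLE _,
    hE.preservesFiniteColimits_ιOfLE _⟩, ⟨hE.isClosedUnderFiniteProducts, fun X hX N hN =>
      categoryOFrechet_of_isClosed hρ hR hA' hX hN⟩, fun X hX => ⟨?_, ?_⟩,
    ⟨⟨(isExactModuleClass_categoryO B d).abelian⟩, ?_⟩,
    fun M hM => coadmissible_closure hρ hR hA' hM⟩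
  · exact X.isFrechetSpace_lim hρ fun n => (hX n).1
  · exact hasFiniteTypeWeightDecomposition_lim hρ hR hA' hX
  · obtain ⟨hext, hws, e, h⟩ := exists_equivalence_of_weights (i := R.val) hd
      (P := categoryO B d) (Q := categoryOFrechet R A d)
      (fun {N M j} hN hj => by
        have := hN.1
        exact categoryOFrechet_of_isScalarExtension hρ hR hA' (B := B) hN.2 hj)
      (fun {N M j} hM hj hinj hrange => by
        obtain ⟨h1, h2, h3⟩ := weightPart_of_categoryOFrechet hρ hR hA' hM hj hinj hrange
        exact ⟨⟨h2, h1⟩, h3⟩)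
    exact ⟨hext, hd, hws, e, h⟩
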